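/- **Setting.** Let $d,T,H$ be integers with $T,H\ge 1$, and let $\mathcal V\subset\mathbb R^d$ be convex and compact with $0\in\mathcal V\subset B(0,R)$, where $R>0$ and $B(0,r)$ is the closed Euclidean ball. $\Pi_S$ is the Euclidean projection to $S$. The losses $l_t:\mathcal V^{H+1}\to\mathbb R$, $t\in[1:T]$, are $L$-Lipschitz in each argument separately, and $\tilde l_t(x)=l_t(x,\dots,x)$ is convex and $\tilde G$-Lipschitz on $\mathcal V$, with $0<\tilde G\le L(H+1)$. In round $t$ the player predicts $x_t\in\mathcal V$ and suffers $l_t(x_{t-H},\dots,x_t)$; $x_s=0$ for $s\le 0$. After that the player receives a subgradient $g_t\in\partial\tilde l_t(x_t)$ with $\|g_t\|\le\tilde G$ (such a subgradient always exists). **Algorithm A1** with parameters $(\lambda,\gamma,\varepsilon,G)$, on $[0,\bar R]$. Let $C=G+\lambda+\gamma$, $W_0=\varepsilon$, $\beta_1=x_1=\tilde x_1=0$. In round $t$ predict $x_t$, observe $g_t\in\mathbb R$; put $\tilde g_t=g_t$ if $g_t\tilde x_t\ge g_tx_t$ and $\tilde g_t=0$ otherwise; let $\beta_{t+1}$ be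 the projection of $-\sum_{i\le t}\tilde g_i/(2C^2t)$ to $[0,1/(C\sqrt{2t})]$; let $W_t$ be the unique solution of $W_t=(1-\tilde g_t\beta_t-\gamma\beta_t/\sqrt t)W_{t-1}-\lambda|\beta_tW_{t-1}-\beta_{t+1}W_t|$; let $\tilde x_{t+1}=\beta_{t+1}W_t$ and $x_{t+1}=\Pi_{[0,\bar R]}(\tilde x_{t+1})$. **Algorithm A2** with parameters $(\lambda,\varepsilon,G)$, on $B(0,\bar R)$. Predict $x_t=y_tz_t$, where $y_t$ is the prediction of A1 with parameters $(\lambda,\lambda,\varepsilon,G)$ on $[0,\bar R]$, and $z_t$ that of online gradient descent on $B(0,1)$ with $z_1=0$ and learning rate $1/(G\sqrt t)$. After $g_t$ is observed, send $\langle g_t,z_t\rangle$ to the former and $g_t$ to the latter. **Subroutines** with parameters $(\lambda,\varepsilon,G)$. Subroutine-1d has as base algorithm A1 with parameters $(\lambda,0,\varepsilon,\max\{\lambda,G\}+G)$ on $[0,1]$; Subroutine-ball has A2 with parameters $(\lambda,\varepsilon,\max\{\lambda,G\}+G)$ on $B(0,R)$. Starting from $Z=0$, in each round predict the current prediction of the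 base algorithm and add the observed gradient to $Z$; if then $\|Z\|>\max\{\lambda,G\}$, send $Z$ to the base algorithm as its next gradient and reset $Z=0$. **Meta-algorithm** with parameter $\varepsilon_0>0$. Let $\lambda=LH(H+1)$. The geometric-covering intervals are $[2^ki:2^k(i+1)-1]$ for $k\ge 0$, $i\ge 1$. In round $t=1,\dots,T$: 1. for each $k$ such that one of these intervals of length $2^k$ starts at $t$, create (overwriting older copies) $\mathcal A^k_B$, a Subroutine-ball with parameters $(\lambda,2^k\varepsilon_0,\tilde G)$, and $\mathcal A^k_{1d}$, a Subroutine-1d with parameters $(\lambda R,2^k\varepsilon_0,\tilde GR)$; 2. let $K_t=\lceil\log_2(t+1)\rceil-1$ and $\tilde x^{(K_t+1)}_t=0$; for $k=K_t,\dots,0$ let $x_t^{(k+1)}=\Pi_{B(0,R)}(\tilde x_t^{(k+1)})$ and $\tilde x^{(k)}_t=(1-z^{(k)}_t)x^{(k+1)}_t+w_t^{(k)}$, where $w^{(k)}_t$, $z^{(k)}_t$ are the predictions of $\mathcal A_B^k$, $\mathcal A^k_{1d}$; let $\tilde x_t=\tilde x^{(0)}_t$ and predict $x_t=\Pi_{\mathcal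 V}(\tilde x_t)$; 3. receive $g_t$; let $h_t(x)=\langle g_t,x\rangle$ if $\langle g_t,\tilde x_t\rangle\ge\langle g_t,x_t\rangle$, and $h_t(x)=\langle g_t,x\rangle+\langle g_t,x_t-\tilde x_t\rangle\,\|x-\Pi_{\mathcal V}(x)\|/\|x_t-\tilde x_t\|$ otherwise ($x\in\mathbb R^d$); take $g_t^{(0)}\in\partial h_t(\tilde x_t)$; 4. for $k=0,\dots,K_t$ send $g_t^{(k)}$ to $\mathcal A^k_B$ and $-\langle g_t^{(k)},x_t^{(k+1)}\rangle$ to $\mathcal A^k_{1d}$; let $g_t^{(k+1)}=g_t^{(k)}$ if $\langle g^{(k)}_t,\tilde x^{(k+1)}_t\rangle\ge\langle g^{(k)}_t,x^{(k+1)}_t\rangle$, and otherwise $g_t^{(k+1)}=g_t^{(k)}-\langle g^{(k)}_t,e\rangle e$ with $e=\tilde x_t^{(k+1)}/\|\tilde x_t^{(k+1)}\|$. **Theorem.** There are absolute constants $C$ and $p\in\mathbb N$ such that, in every such setting, the meta-algorithm with $\varepsilon_0=\tilde GR/(T+1)$ satisfies on every interval $\mathcal I=[a:b]\subset[1:T]$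 $$\sum_{t=a}^b l_t(x_{t-H},\dots,x_t)-\min_{x\in\mathcal V}\sum_{t=a}^b\tilde l_t(x)\le C\,RLH^3\log|\mathcal I|+C\,\Lambda^p\Bigl(RLH^2+RH\sqrt{L\textstyle\sum_{t=a}^b\|g_t\|}\Bigr),$$ where $\Lambda=1+\log T+\log H+|\log R|+|\log L|+|\log\tilde G|$; that is, the policy regret is $O(RLH^3\log|\mathcal I|)+\tilde O\bigl(RLH^2+RH\sqrt{L\sum_{t\in\mathcal I}\|g_t\|}\bigr)$, where $O$ subsumes absolute constants and $\tilde O$ subsumes poly-logarithmic factors in $T$ and the problem constants. The minimum is attained. -/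

import Mathlib

open scoped RealInnerProductSpace

noncomputable section

namespace OCOM

/-! Basic notions: Euclidean space, Euclidean projection, subgradients. -/

/-- The Euclidean space of dimension `d`. -/
abbrev Eu (d : ℕ) : Type := EuclideanSpace ℝ (Fin d)

/-- `y` is a Euclidean projection of `x` to the set `S`. -/
def IsProj {d : ℕ} (S : Set (Eu d)) (x y : Eu d) : Prop :=
  y ∈ S ∧ ∀ z ∈ S, ‖x - y‖ ≤ ‖x - z‖

/-- The Euclidean projection of `x` to `S` (it exists for nonempty closed `S`, see below, and is
unique if `S` is also convex). -/
def proj {d : ℕ} (S : Set (Eu d)) (x : Eu d) : Eu d :=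
  Classical.epsilon (IsProj S x)

theorem proj_isProj {d : ℕ} {S : Set (Eu d)} (hc : IsClosed S) (hn : S.Nonempty) (x : Eu d) :
    IsProj S x (proj S x) := by
  obtain ⟨y, hy, hxy⟩ := hc.exists_infDist_eq_dist hn x
  refine Classical.epsilon_spec (p := IsProj S x) ⟨y, hy, fun z hz => ?_⟩
  rw [← dist_eq_norm, ← dist_eq_norm, ← hxy]
  exact Metric.infDist_le_dist_of_mem hz

/-- The projection of a real number to the interval `[0, c]`, where `c ≥ 0`. -/
def clip (c x : ℝ) : ℝ := max 0 (min c x)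

/-- `g` is a subgradient at the point `x ∈ D` of the function `f` with domain `D`. -/
def IsSubgradientOn {d : ℕ} (D : Set (Eu d)) (f : Eu d → ℝ) (x g : Eu d) : Prop :=
  x ∈ D ∧ ∀ y ∈ D, f x + ⟪g, y - x⟫ ≤ f y

/-- An online linear optimization algorithm: a state, from which the prediction of the current
round is read off, and the update of the state by the loss gradient of that round. -/
structure Learner (σ E : Type) where
  start : σ
  predict : σ → E
  update : σ → E → σ

/-! The one-dimensional comparator-adaptive algorithm on `[0, Rbar]`. -/

/-- The internal variables at the beginning of round `t`. -/
structure Bettor where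
  /-- the round `t` -/
  round : ℕ
  /-- the wealth `W_{t-1}` -/
  wealth : ℝ
  /-- the betting fraction `β_t` -/
  frac : ℝ
  /-- the sum of the surrogate gradients of the rounds before `t` -/
  gradSum : ℝ

/-- The unprojected prediction of round `t`. -/
def Bettor.raw (s : Bettor) : ℝ := s.frac * s.wealth

/-- The equation that defines the wealth `w = W_t` from `W = W_{t-1}`, `β = β_t`, `β' = β_{t+1}`
and the surrogate gradient `g` of round `t`. -/
def WealthEq (lam gam : ℝ) (t : ℕ) (g β β' W w : ℝ) : Prop :=
  w = (1 - g * β - gam * β / √(t : ℝ)) * W - lam * |β * W - β' * w|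

/-- The solution of the wealth equation. -/
def newWealth (lam gam : ℝ) (t : ℕ) (g β β' W : ℝ) : ℝ :=
  Classical.epsilon (WealthEq lam gam t g β β' W)

theorem wealthEq_existsUnique {lam gam : ℝ} {t : ℕ} {g β β' W : ℝ} (hl : 0 ≤ lam) (hb : 0 ≤ β')
    (h : lam * β' < 1) : ∃! w, WealthEq lam gam t g β β' W w := by
  unfold WealthEq
  generalize (1 - g * β - gam * β / √(t : ℝ)) * W = A
  generalize β * W = b
  have h1 : 0 < 1 - lam * β' := by linarith
  have h0 : 0 ≤ lam * β' := mul_nonneg hl hb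
  have h2 : 0 < 1 + lam * β' := by linarith
  have n1 : 1 - lam * β' ≠ 0 := h1.ne'
  have n2 : 1 + lam * β' ≠ 0 := h2.ne'
  refine existsUnique_of_exists_of_unique ?_ ?_
  · by_cases hc : β' * A ≤ b
    · refine ⟨(A - lam * b) / (1 - lam * β'), ?_⟩
      have e : b - β' * ((A - lam * b) / (1 - lam * β')) = (b - β' * A) / (1 - lam * β') := by
        rw [eq_div_iff n1, sub_mul, mul_assoc β', div_mul_cancel₀ _ n1]
        ring
      rw [e, abs_of_nonneg (div_nonneg (by linarith) h1.le)]
      field_simp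
      ring
    · refine ⟨(A + lam * b) / (1 + lam * β'), ?_⟩
      have e : b - β' * ((A + lam * b) / (1 + lam * β')) = (b - β' * A) / (1 + lam * β') := by
        field_simp
        ring
      rw [e, abs_of_nonpos (div_nonpos_of_nonpos_of_nonneg (by linarith) h2.le)]
      field_simp
      ring
  · intro v w hv hw
    have h3 : |v - w| ≤ lam * β' * |v - w| := by
      have h4 : v - w = lam * (|b - β' * w| - |b - β' * v|) := by linarith
      have h5 : abs (|b - β' * w| - |b - β' * v|) ≤ β' * |v - w| := by
        refine (abs_abs_sub_abs_le_abs_sub _ _).trans (le_of_eq ?_)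
        rw [show b - β' * w - (b - β' * v) = β' * (v - w) by ring, abs_mul, abs_of_nonneg hb]
      calc |v - w| = lam * abs (|b - β' * w| - |b - β' * v|) := by
            conv_lhs => rw [h4]
            rw [abs_mul, abs_of_nonneg hl]
        _ ≤ lam * (β' * |v - w|) := mul_le_mul_of_nonneg_left h5 hl
        _ = lam * β' * |v - w| := by ring
    have h6 : |v - w| = 0 := by
      have := abs_nonneg (v - w)
      nlinarith
    exact sub_eq_zero.mp (abs_eq_zero.mp h6)

/-- One round of the one-dimensional algorithm, with observed loss gradient `g`. -/
def Bettor.next (lam gam G Rbar : ℝ) (s : Bettor) (g : ℝ) : Bettor :=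
  let C := G + lam + gam
  let gs := if g * clip Rbar s.raw ≤ g * s.raw then g else 0
  let sum := s.gradSum + gs
  let β' := clip (1 / (C * √(2 * (s.round : ℝ)))) (-sum / (2 * C ^ 2 * (s.round : ℝ)))
  { round := s.round + 1
    wealth := newWealth lam gam s.round gs s.frac β' s.wealth
    frac := β'
    gradSum := sum }

/-- One-dimensional comparator-adaptive online linear optimization with movement cost on the
domain `[0, Rbar]`, with hyperparameters `(lam, gam, eps, G)`. -/
def learner1d (lam gam eps G Rbar : ℝ) : Learner Bettor ℝ where
  start := { round := 1, wealth := eps, frac := 0, gradSum := 0 }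
  predict s := clip Rbar s.raw
  update := Bettor.next lam gam G Rbar

/-! The extension to the ball of radius `Rbar` in dimension `d`. -/

/-- Online gradient descent on the unit ball with learning rates `1 / (G √t)`; a state `(t, z)`
consists of the round and the prediction. -/
def ogd (d : ℕ) (G : ℝ) : Learner (ℕ × Eu d) (Eu d) where
  start := (1, 0)
  predict s := s.2
  update s g := (s.1 + 1, proj (Metric.closedBall 0 1) (s.2 - (1 / (G * √(s.1 : ℝ))) • g))

/-- Comparator-adaptive online linear optimization with movement cost on the ball of radius `Rbar`,
with hyperparameters `(lam, eps, G)`: the magnitude is learned by the one-dimensional algorithm,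
the direction by online gradient descent. -/
def learnerBall (d : ℕ) (lam eps G Rbar : ℝ) : Learner (Bettor × (ℕ × Eu d)) (Eu d) :=
  let Ar := learner1d lam lam eps G Rbar
  let AB := ogd d G
  { start := (Ar.start, AB.start)
    predict := fun s => Ar.predict s.1 • AB.predict s.2
    update := fun s g => (Ar.update s.1 ⟪g, AB.predict s.2⟫, AB.update s.2 g) }

/-! The subroutines on geometric-covering intervals. -/

/-- The slowed-down version of the algorithm `A`: the gradients are accumulated, and the sum is
sent to `A` once its norm exceeds the threshold `θ`. -/
def slowdown {σ E : Type} [NormedAddCommGroup E] (A : Learner σ E) (θ : ℝ) :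
    Learner (σ × E) E where
  start := (A.start, 0)
  predict s := A.predict s.1
  update s g :=
    open scoped Classical in
    if θ < ‖s.2 + g‖ then (A.update s.1 (s.2 + g), 0) else (s.1, s.2 + g)

/-- Subroutine-1d with hyperparameters `(lam, eps, G)`, on the domain `[0, 1]`. -/
def subroutine1d (lam eps G : ℝ) : Learner (Bettor × ℝ) ℝ :=
  slowdown (learner1d lam 0 eps (max lam G + G) 1) (max lam G)

/-- Subroutine-ball with hyperparameters `(lam, eps, G)`, on the ball of radius `R`. -/
def subroutineBall (d : ℕ) (R lam eps G : ℝ) :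
    Learner ((Bettor × (ℕ × Eu d)) × Eu d) (Eu d) :=
  slowdown (learnerBall d lam eps (max lam G + G) R) (max lam G)

/-! The meta-algorithm. -/

/-- The inputs of the meta-algorithm: the domain, the constants of the problem and the
hyperparameter `eps0`. -/
structure Inputs (d : ℕ) where
  /-- the domain -/
  V : Set (Eu d)
  /-- the memory length -/
  H : ℕ
  /-- the radius of a ball that contains `V` -/
  R : ℝ
  /-- the Lipschitz constant of the losses in each argument -/
  L : ℝ
  /-- the Lipschitz constant of the instantaneous losses -/
  Gt : ℝ
  /-- the hyperparameter -/
  eps0 : ℝ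

variable {d : ℕ}

/-- The weight `λ = L H (H + 1)` of the movement. -/
def Inputs.lam (P : Inputs d) : ℝ := P.L * P.H * (P.H + 1)

/-- The copy of Subroutine-ball at level `k`. -/
def Inputs.ballAlg (P : Inputs d) (k : ℕ) : Learner ((Bettor × (ℕ × Eu d)) × Eu d) (Eu d) :=
  subroutineBall d P.R P.lam (2 ^ k * P.eps0) P.Gt

/-- The copy of Subroutine-1d at level `k`. -/
def Inputs.lineAlg (P : Inputs d) (k : ℕ) : Learner (Bettor × ℝ) ℝ :=
  subroutine1d (P.lam * P.R) (2 ^ k * P.eps0) (P.Gt * P.R)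

/-- The states of the two subroutines that are in memory at every level `k`. -/
abbrev Memory (d : ℕ) : Type := ℕ → ((Bettor × (ℕ × Eu d)) × Eu d) × (Bettor × ℝ)

/-- The memory with all subroutines in their starting states. -/
def Inputs.fresh (P : Inputs d) : Memory d := fun k => ((P.ballAlg k).start, (P.lineAlg k).start)

/-- The geometric-covering intervals are `[2^k i : 2^k (i+1) - 1]` for `k ≥ 0` and `i ≥ 1`. At the
levels `k` for which one of them starts in round `t ≥ 1`, the subroutines are overwritten by new
copies. -/
def Inputs.renew (P : Inputs d) (t : ℕ) (M : Memory d) : Memory d :=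
  fun k => if 2 ^ k ∣ t then P.fresh k else M k

/-- `K_t = ⌈log₂ (t + 1)⌉ - 1`, the highest level with an active interval in round `t ≥ 1`. -/
def topLevel (t : ℕ) : ℕ := Nat.clog 2 (t + 1) - 1

/-- The predictions `x̃^(k)` for `k = K + 1 - n`, in the order `n = 0, 1, …, K + 1`. -/
def Inputs.combineDown (P : Inputs d) (K : ℕ) (M : Memory d) : ℕ → Eu d
  | 0 => 0
  | n + 1 =>
    let k := K - n
    (1 - (P.lineAlg k).predict (M k).2) •
        proj (Metric.closedBall 0 P.R) (P.combineDown K M n) +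
      (P.ballAlg k).predict (M k).1

/-- The unprojected prediction `x̃^(k)` in round `t`, for `k ≤ K_t + 1`. -/
def Inputs.rawLevel (P : Inputs d) (t : ℕ) (M : Memory d) (k : ℕ) : Eu d :=
  P.combineDown (topLevel t) M (topLevel t + 1 - k)

/-- The projection `x^(k)` of `x̃^(k)` to the ball of radius `R`. -/
def Inputs.level (P : Inputs d) (t : ℕ) (M : Memory d) (k : ℕ) : Eu d :=
  proj (Metric.closedBall 0 P.R) (P.rawLevel t M k)

/-- The gradients `g^(k)` of round `t`, starting from `g^(0) = gs`. -/
def Inputs.gradLevel (P : Inputs d) (t : ℕ) (M : Memory d) (gs : Eu d) : ℕ → Eu d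
  | 0 => gs
  | k + 1 =>
    let g := P.gradLevel t M gs k
    let y := P.rawLevel t M (k + 1)
    let e := (1 / ‖y‖) • y
    if ⟪g, P.level t M (k + 1)⟫ ≤ ⟪g, y⟫ then g else g - ⟪g, e⟫ • e

/-- The update of the active subroutines at the end of round `t`, where `gs` is the surrogate
gradient of that round. -/
def Inputs.feed (P : Inputs d) (t : ℕ) (M : Memory d) (gs : Eu d) : Memory d :=
  fun k =>
    let g := P.gradLevel t M gs k
    if k ≤ topLevel t then
      ((P.ballAlg k).update (M k).1 g, (P.lineAlg k).update (M k).2 (-⟪g, P.level t M (k + 1)⟫))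
    else M k

/-- The memory at the end of round `t`, where `gs t` is the surrogate gradient of round `t`. -/
def Inputs.after (P : Inputs d) (gs : ℕ → Eu d) : ℕ → Memory d
  | 0 => P.fresh
  | t + 1 => P.feed (t + 1) (P.renew (t + 1) (P.after gs t)) (gs (t + 1))

/-- The unprojected prediction `x̃_t` of round `t ≥ 1`; it depends on `gs` only through the rounds
before `t`. -/
def Inputs.rawPrediction (P : Inputs d) (gs : ℕ → Eu d) (t : ℕ) : Eu d :=
  P.rawLevel t (P.renew t (P.after gs (t - 1))) 0

/-- The prediction `x_t` of round `t ≥ 1`, extended by `x_0 = 0`. -/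
def Inputs.prediction (P : Inputs d) (gs : ℕ → Eu d) (t : ℕ) : Eu d :=
  if t = 0 then 0 else proj P.V (P.rawPrediction gs t)

/-- The surrogate loss `h_t` on the whole space, for the subgradient `g = g_t`, the prediction
`x = x_t` and the unprojected prediction `y = x̃_t`. -/
def surrogate (V : Set (Eu d)) (g x y : Eu d) (u : Eu d) : ℝ :=
  if ⟪g, x⟫ ≤ ⟪g, y⟫ then ⟪g, u⟫
  else ⟪g, u⟫ + ⟪g, x - y⟫ * (‖u - proj V u‖ / ‖x - y‖)

/-! The problem of online convex optimization with memory. -/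

/-- The instantaneous loss of a loss with memory `H`. -/
def inst {H : ℕ} (l : (Fin (H + 1) → Eu d) → ℝ) (x : Eu d) : ℝ := l (fun _ => x)

/-- The assumptions on the domain and the constants. -/
structure Inputs.Valid (P : Inputs d) : Prop where
  convex : Convex ℝ P.V
  compact : IsCompact P.V
  zero_mem : 0 ∈ P.V
  subset_ball : P.V ⊆ Metric.closedBall 0 P.R
  R_pos : 0 < P.R
  Gt_pos : 0 < P.Gt
  Gt_le : P.Gt ≤ P.L * (P.H + 1)

/-- The assumptions on a loss with domain `V^(H+1)`. -/
structure Inputs.ValidLoss (P : Inputs d) (l : (Fin (P.H + 1) → Eu d) → ℝ) : Prop where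
  /-- `l` is `L`-Lipschitz in each argument separately -/
  lipschitz_arg : ∀ y : Fin (P.H + 1) → Eu d, (∀ j, y j ∈ P.V) → ∀ i, ∀ u ∈ P.V,
    |l (Function.update y i u) - l y| ≤ P.L * ‖u - y i‖
  convex_inst : ConvexOn ℝ P.V (inst l)
  lipschitz_inst : ∀ x ∈ P.V, ∀ y ∈ P.V, |inst l x - inst l y| ≤ P.Gt * ‖x - y‖

/-- The meta-algorithm is run for `T` rounds on the losses `l 1, …, l T`: `g t` is the subgradient
of the instantaneous loss of round `t`, of norm at most `Gt`, and `gs t` is the subgradient of the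
surrogate loss of round `t`. -/
def Inputs.IsRun (P : Inputs d) (T : ℕ) (l : ℕ → (Fin (P.H + 1) → Eu d) → ℝ)
    (g gs : ℕ → Eu d) : Prop :=
  ∀ t ∈ Finset.Icc 1 T,
    IsSubgradientOn P.V (inst (l t)) (P.prediction gs t) (g t) ∧ ‖g t‖ ≤ P.Gt ∧
    IsSubgradientOn Set.univ
      (surrogate P.V (g t) (P.prediction gs t) (P.rawPrediction gs t))
      (P.rawPrediction gs t) (gs t)

/-- The history `(x_{t-H}, …, x_t)` of the predictions, where `x_s = 0` for `s ≤ 0` (the truncated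
difference of natural numbers is `0` in that case). -/
def Inputs.history (P : Inputs d) (gs : ℕ → Eu d) (t : ℕ) : Fin (P.H + 1) → Eu d :=
  fun j => P.prediction gs (t + j - P.H)

/-- The quantity whose powers are the poly-logarithmic factors in `T` and the constants of the
problem. -/
def Inputs.logs (P : Inputs d) (T : ℕ) : ℝ :=
  1 + Real.log T + Real.log P.H + |Real.log P.R| + |Real.log P.L| + |Real.log P.Gt|

end OCOM

end

/-! ### One round of the betting algorithm -/

namespace OCOM

/-! ### Clipping -/

/-! The losses are L-Lipschitz in each argument, so replacing the history by its last entry costs at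
most λ = LH(H+1) times the path length of the predictions plus R (`memory_cost`). By convexity it
remains to bound, for fixed u, the sum of ⟨g_t, x_t − u⟩ + λ‖x_t − x_{t+1}‖. An interval is a
disjoint union of O(log T) geometric-covering intervals (`sum_Ico_le_of_dyadic`), so one of these,
of length 2^k, suffices (`block_cost`).

There the levels play three roles. Unfolding x̃^(j) = (1 − z)x^(j+1) + w, every level j < k
contributes its own linear loss, that is, its regret against w = 0, z = 0 (`inner_chain`). Together
with its weighted movement this is at most 2·2^j ε₀ on each interval of level j, hence at most 2·2^k
ε₀ on the block. Level k starts afresh with the block and is compared with w = u, z = 1, which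
cancels everything that comes from above (`inner_raw_sub`); its regret is Õ(R√(λV)) + O(Rλ) with V =
∑‖g_t‖. Higher levels matter only through their movement. They do not restart inside the block and
change slowly, so that each moves by O(R√(1 + V/λ)) (`layerMove_seq`). The projections are harmless:
the transformed gradients are not longer and do not decrease the linearized regret
(`surrogate_subgradient`, `ballSurrogate`).

The three required properties of a subroutine are collected in `Learner.Good`. For the betting
algorithm they come from its wealth W, because loss and movement are paid from it (`BetRun.ledger`).
Positivity of W bounds the cost against the comparator 0 by ε. A lower bound of log W, proved by a
follow-the-leader argument (`BetRun.log_wealth_ge`), gives the regret by duality with the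
exponential function. An upper bound W = O(CR√n) (`BetRun.wealth_le`) holds because the gradients
that push the prediction further out of the domain are discarded; since a round moves the prediction
by O(W/(Cn)), this yields movement O(R/√n). On the ball, the γ-term pays for the movement of the
direction (`learnerBall_run`). Slowing down replaces the number of rounds by V/λ, since the base
algorithm is updated only after gradients of total norm above λ (`Learner.Run.of_slowdown`). -/

theorem clip_nonneg (c x : ℝ) : 0 ≤ clip c x := le_max_left _ _

theorem clip_le {c : ℝ} (hc : 0 ≤ c) (x : ℝ) : clip c x ≤ c := max_le hc (min_le_left _ _)

theorem clip_le_self {c x : ℝ} (hx : 0 ≤ x) : clip c x ≤ x := max_le hx (min_le_right _ _)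

theorem clip_of_le {c x : ℝ} (hx : 0 ≤ x) (h : x ≤ c) : clip c x = x := by
  rw [clip, min_eq_right h, max_eq_right hx]

theorem clip_of_ge {c x : ℝ} (hc : 0 ≤ c) (h : c ≤ x) : clip c x = c := by
  rw [clip, min_eq_left h, max_eq_right hc]

theorem clip_of_nonpos {c x : ℝ} (hx : x ≤ 0) : clip c x = 0 := by
  rw [clip, max_eq_left ((min_le_right _ _).trans hx)]

theorem le_clip {c x y : ℝ} (hc : y ≤ c) (hx : y ≤ x) : y ≤ clip c x :=
  (le_min hc hx).trans (le_max_right _ _)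

theorem abs_clip_sub_clip_le (c c' x x' : ℝ) :
    |clip c x - clip c' x'| ≤ |c - c'| + |x - x'| := by
  have h1 : |clip c x - clip c' x'| ≤ |min c x - min c' x'| := by
    unfold clip
    have := abs_max_sub_max_le_max 0 (min c x) 0 (min c' x')
    simpa using this
  have h2 : |min c x - min c' x'| ≤ max |c - c'| |x - x'| := abs_min_sub_min_le_max _ _ _ _
  have h3 : max |c - c'| |x - x'| ≤ |c - c'| + |x - x'| :=
    max_le (le_add_of_nonneg_right (abs_nonneg _)) (le_add_of_nonneg_left (abs_nonneg _))
  exact h1.trans (h2.trans h3)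

theorem abs_clip_sub_clip_le' (c x x' : ℝ) : |clip c x - clip c x'| ≤ |x - x'| := by
  simpa using abs_clip_sub_clip_le c c x x'

/-- The variational inequality of the projection to `[0, c]`. -/
theorem clip_variational {c x y : ℝ} (hy : 0 ≤ y) (hyc : y ≤ c) :
    (x - clip c x) * (y - clip c x) ≤ 0 := by
  have hc := hy.trans hyc
  rcases le_total x 0 with h | h
  · rw [clip_of_nonpos h]; nlinarith
  rcases le_total x c with h' | h'
  · rw [clip_of_le h h']; simp
  · rw [clip_of_ge hc h']; nlinarith

/-! ### One round of the betting algorithm -/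

theorem betCap_mul_le {C n : ℝ} (hC : 0 < C) (hn : 1 ≤ n) {β : ℝ}
    (hβ : β ≤ 1 / (C * √(2 * n))) : C * β * √(2 * n) ≤ 1 := by
  have : 0 < √(2 * n) := Real.sqrt_pos.2 (by linarith)
  rw [le_div_iff₀ (by positivity)] at hβ
  linarith

theorem sq_mul_le_of_le_betCap {C n : ℝ} (hC : 0 < C) (hn : 1 ≤ n) {β : ℝ} (h0 : 0 ≤ β)
    (hβ : β ≤ 1 / (C * √(2 * n))) : (C * β) ^ 2 * (2 * n) ≤ 1 := by
  have h := betCap_mul_le hC hn hβ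
  have hs : √(2 * n) ^ 2 = 2 * n := Real.sq_sqrt (by linarith)
  have : 0 ≤ C * β * √(2 * n) := by positivity
  calc (C * β) ^ 2 * (2 * n) = (C * β * √(2 * n)) ^ 2 := by rw [mul_pow (C * β), hs]
    _ ≤ 1 := by nlinarith

theorem betCap_anti {C n : ℝ} (hC : 0 < C) (hn : 1 ≤ n) :
    1 / (C * √(2 * (n + 1))) ≤ 1 / (C * √(2 * n)) := by
  have : 0 < √(2 * n) := Real.sqrt_pos.2 (by linarith)
  gcongr
  linarith

/-- log(1 − q) ≥ 1 − 1/(1 − q) = −q − q²/(1 − q) ≥ −q − 6q², and q² ≤ 36/n, so the error is 6/n +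
6·36/n = 222/n. In the application B = Cβ, and q is the relative loss of wealth in one round. -/
theorem neg_sub_le_log_one_sub {n B x q : ℝ} (hn : 1 ≤ n) (hB : 0 ≤ B)
    (hBn : B ^ 2 * (2 * n) ≤ 1) (hq : |q| ≤ B + 5 / n) (hqx : q ≤ x + 6 / n)
    (hq1 : 1 / 6 ≤ 1 - q) : -x - 222 / n ≤ Real.log (1 - q) := by
  have hn0 : 0 < n := by linarith
  have hqsq : q ^ 2 ≤ 36 / n := by
    have hB1 : B ≤ 1 := by
      have : B ^ 2 ≤ 1 := by nlinarith [sq_nonneg B]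
      nlinarith
    have h2 : B ^ 2 ≤ 1 / n := by
      rw [le_div_iff₀ hn0]; nlinarith [sq_nonneg B]
    have h3 : (5 / n) ^ 2 ≤ 25 / n := by
      rw [div_pow, div_le_div_iff₀ (by positivity) hn0]; nlinarith
    have h4 : B * (5 / n) ≤ 1 * (5 / n) := by gcongr
    have h5 : q ^ 2 ≤ (B + 5 / n) ^ 2 := by
      rw [← sq_abs q]; gcongr
    have h6 : (36 : ℝ) / n = 1 / n + 2 * (5 / n) + 25 / n := by ring
    linarith
  have hl1 := Real.one_sub_inv_le_log_of_pos (show 0 < 1 - q by linarith)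
  have hl2 : -q - 6 * q ^ 2 ≤ 1 - (1 - q)⁻¹ := by
    have hpos : 0 < 1 - q := by linarith
    have e : 1 - (1 - q)⁻¹ = -q - q ^ 2 * (1 - q)⁻¹ := by field_simp; ring
    have h6 : (1 - q)⁻¹ ≤ 6 := by
      rw [inv_le_comm₀ hpos (by norm_num)]; linarith
    rw [e]
    nlinarith [mul_le_mul_of_nonneg_left h6 (sq_nonneg q)]
  have e : (222 : ℝ) / n = 6 / n + 6 * (36 / n) := by ring
  linarith

/-- The conclusions about one round of the wealth process, from round `n + 1` on. -/
structure WealthStep (C n g β β' W w : ℝ) : Prop where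
  lower : W / 6 ≤ w
  upper : w ≤ W * (1 - g * β)
  move : |β * W - β' * w| ≤ 5 * W / (C * n)
  log_lower : Real.log W - g * β - 222 / n ≤ Real.log w

/-- The movement involves the unknown w, but λβ' ≤ 1/2 allows this dependence to be absorbed. What
remains is |β − β'| and β'·Cβ, both O(1/(Cn)). Hence the costs of the movement and of the γ-term are
O(W/n), and log W changes by −gβ up to O(1/n). -/
theorem wealthStep {lam gam G W g β β' w : ℝ} {n : ℕ} (hlam : 0 ≤ lam) (hgam : 0 ≤ gam)
    (hG : 0 < G) (hn : 1 ≤ n) (hW : 0 < W) (hg : |g| ≤ G)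
    (hβ : 0 ≤ β) (hβc : β ≤ 1 / ((G + lam + gam) * √(2 * (n : ℝ))))
    (hβ' : 0 ≤ β') (hβc' : β' ≤ 1 / ((G + lam + gam) * √(2 * ((n : ℝ) + 1))))
    (hd : |β - β'| ≤ 2 / ((G + lam + gam) * n))
    (hw : WealthEq lam gam (n + 1) g β β' W w) :
    WealthStep (G + lam + gam) n g β β' W w := by
  unfold WealthEq at hw
  set C := G + lam + gam with hC
  have hC0 : 0 < C := by positivity
  have hn1 : (1 : ℝ) ≤ n := by exact_mod_cast hn
  have hn0 : (0 : ℝ) < n := by linarith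
  have hs : 1 ≤ √((n : ℝ) + 1) := Real.one_le_sqrt.2 (by linarith)
  have hs' : √(n : ℝ) ≤ √((n : ℝ) + 1) := Real.sqrt_le_sqrt (by linarith)
  push_cast at hw
  set r := √((n : ℝ) + 1) with hr
  have hr0 : 0 < r := by linarith
  have hsq := sq_mul_le_of_le_betCap hC0 hn1 hβ hβc
  have hsq' := sq_mul_le_of_le_betCap (n := (n : ℝ) + 1) hC0 (by linarith) hβ' hβc'
  have hsq'' := sq_mul_le_of_le_betCap hC0 hn1 hβ' (hβc'.trans (betCap_anti hC0 hn1))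
  -- The cap allows Cβ ≤ 1/√2 when n = 1; β' belongs to the next round, where the cap is at most
  -- 1/2. The fraction 292/1000 below is 1 − 708/1000.
  have hCβ : C * β ≤ 708 / 1000 := by
    have : (C * β) ^ 2 ≤ 1 / 2 := by nlinarith [sq_nonneg (C * β)]
    exact abs_le_of_sq_le_sq' (this.trans (by norm_num)) (by norm_num) |>.2
  have hCβ' : C * β' ≤ 1 / 2 := by
    have : (C * β') ^ 2 ≤ 1 / 4 := by nlinarith [sq_nonneg (C * β')]
    exact abs_le_of_sq_le_sq' (this.trans (by norm_num)) (by norm_num) |>.2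
  have hlβ' : lam * β' ≤ C * β' := by gcongr; linarith
  have hlβ'0 : 0 ≤ lam * β' := by positivity
  have hgβ : |g| * β ≤ G * β := by gcongr
  have hgβ1 : g * β ≤ |g| * β := by gcongr; exact le_abs_self g
  have hgβ2 : -(g * β) ≤ |g| * β := by
    rw [← neg_mul]; gcongr; exact neg_le_abs g
  have hγ : gam * β / r ≤ gam * β := div_le_self (by positivity) hs
  have hγ0 : 0 ≤ gam * β / r := by positivity
  have hCe : C * β = G * β + lam * β + gam * β := by rw [hC]; ring
  have hlβ : 0 ≤ lam * β := by positivity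
  set μ := |β * W - β' * w| with hμ
  have hμ0 : 0 ≤ μ := abs_nonneg _
  -- lower bound
  have hA : (292 / 1000) * W ≤ (1 - g * β - gam * β / r) * W - lam * (β * W) := by
    have : 292 / 1000 ≤ 1 - g * β - gam * β / r - lam * β := by linarith
    calc (292 / 1000) * W ≤ (1 - g * β - gam * β / r - lam * β) * W := by gcongr
      _ = _ := by ring
  have hlow : W / 6 ≤ w := by
    -- The sign of the movement turns the equation into w(1 ∓ λβ') = (1 − gβ − γβ/r)W ∓ λβW. The
    -- worse case is the factor 1 + λβ' ≤ 3/2, and 0.292/1.5 > 1/6.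
    rcases abs_cases (β * W - β' * w) with ⟨h1, h2⟩ | ⟨h1, h2⟩
    · rw [hμ, h1] at hw
      have h3 : (292 / 1000) * W ≤ w * (1 - lam * β') := by linarith
      have hw0 : 0 < w := by
        by_contra hneg
        push Not at hneg
        have : w * (1 - lam * β') ≤ 0 := mul_nonpos_of_nonpos_of_nonneg hneg (by linarith)
        linarith
      linarith [mul_nonneg hw0.le hlβ'0]
    · rw [hμ, h1] at hw
      have h4 : 0 ≤ lam * (β * W) := by positivity
      have h3 : (292 / 1000) * W ≤ w * (1 + lam * β') := by linarith
      have hw0 : 0 < w := by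
        by_contra hneg
        push Not at hneg
        have : w * (1 + lam * β') ≤ 0 := mul_nonpos_of_nonpos_of_nonneg hneg (by linarith)
        linarith
      linarith [mul_le_mul_of_nonneg_left (hlβ'.trans hCβ') hw0.le]
  have hw0 : 0 < w := by linarith
  have hlμ : 0 ≤ lam * μ := by positivity
  -- movement
  have hWw : W - w = (g * β + gam * β / r) * W + lam * μ := by linarith
  have habs : |W - w| ≤ C * β * W + lam * μ := by
    rw [hWw]
    have : |(g * β + gam * β / r) * W| ≤ C * β * W := by
      rw [abs_mul, abs_of_pos hW]
      gcongr
      rw [abs_le]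
      constructor <;> linarith
    refine (abs_add_le _ _).trans ?_
    rw [abs_of_nonneg hlμ]
    linarith
  have hμle : μ ≤ |β - β'| * W + β' * |W - w| := by
    have e : β * W - β' * w = (β - β') * W + β' * (W - w) := by ring
    rw [hμ, e]
    refine (abs_add_le _ _).trans ?_
    rw [abs_mul, abs_mul, abs_of_pos hW, abs_of_nonneg hβ']
  -- The arithmetic-geometric mean inequality for Cβ and Cβ', whose squares are both at most 1/(2n).
  have hprod : C * β * (C * β') * (2 * n) ≤ 1 := by
    linarith [mul_nonneg (sq_nonneg (C * β - C * β')) hn0.le]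
  have hprod' : β' * (C * β) ≤ 1 / (2 * (C * n)) := by
    rw [le_div_iff₀ (by positivity)]
    linarith
  have hmove : μ ≤ 5 * W / (C * n) := by
    have h1 : β' * |W - w| ≤ β' * (C * β) * W + lam * β' * μ := by
      calc β' * |W - w| ≤ β' * (C * β * W + lam * μ) := by gcongr
        _ = _ := by ring
    have h2 : lam * β' * μ ≤ 1 / 2 * μ := by gcongr; linarith
    -- Half of μ is absorbed on the left; then 2(2 + 1/2) = 5.
    have h3 : μ ≤ 2 * (|β - β'| * W + β' * (C * β) * W) := by linarith
    calc μ ≤ 2 * (|β - β'| * W + β' * (C * β) * W) := h3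
      _ ≤ 2 * (2 / (C * n) * W + 1 / (2 * (C * n)) * W) := by gcongr
      _ = 5 * W / (C * n) := by field_simp; norm_num
  refine ⟨hlow, ?_, hmove, ?_⟩
  · have : 0 ≤ gam * β / r * W := by positivity
    linarith
  -- logarithm
  · have hlμ5 : lam * μ ≤ 5 * W / n := by
      calc lam * μ ≤ C * (5 * W / (C * n)) := by gcongr; linarith
        _ = 5 * W / n := by field_simp
    set q := (W - w) / W with hq
    have hqw : w = W * (1 - q) := by
      have : W * q = W - w := by rw [hq]; field_simp
      linarith
    have hq1 : 1 / 6 ≤ 1 - q := by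
      have h6 : W * (1 / 6) ≤ W * (1 - q) := by rw [← hqw]; linarith
      exact le_of_mul_le_mul_left h6 hW
    have hq2 : q = g * β + gam * β / r + lam * μ / W := by
      rw [hq, hWw]; field_simp
    have hlq : lam * μ / W ≤ 5 / n := by
      rw [div_le_iff₀ hW, div_mul_eq_mul_div]; exact hlμ5
    have hlq0 : 0 ≤ lam * μ / W := by positivity
    have hγn : gam * β / r ≤ 1 / n := by
      have h1 : gam * β ≤ C * β := by gcongr; linarith
      have h2 : C * β * √(n : ℝ) ≤ 1 := by
        refine le_trans ?_ (betCap_mul_le hC0 hn1 hβc)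
        gcongr; linarith
      have hsn : 0 < √(n : ℝ) := Real.sqrt_pos.2 hn0
      rw [div_le_div_iff₀ hr0 hn0]
      calc gam * β * n ≤ C * β * n := by gcongr
        _ = C * β * √(n : ℝ) * √(n : ℝ) := by
          rw [mul_assoc (C * β), Real.mul_self_sqrt hn0.le]
        _ ≤ 1 * r := by gcongr
    have hqu : q ≤ g * β + 6 / n := by
      have : (6 : ℝ) / n = 1 / n + 5 / n := by ring
      linarith
    have h1 : |q| ≤ C * β + 5 / n := by
      rw [hq2, abs_le]; constructor <;> linarith
    have h2 := neg_sub_le_log_one_sub hn1 (by positivity) hsq h1 hqu hq1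
    rw [hqw, Real.log_mul hW.ne' (by linarith)]
    linarith

/-- The betting fraction changes slowly. -/
theorem abs_frac_sub_frac_le {C G S g : ℝ} {n : ℕ} (hG : 0 ≤ G) (hGC : G ≤ C) (hC : 0 < C)
    (hn : 1 ≤ n) (hS : |S| ≤ G * n) (hg : |g| ≤ G) :
    |clip (1 / (C * √(2 * (n : ℝ)))) (-S / (2 * C ^ 2 * n)) -
      clip (1 / (C * √(2 * ((n : ℝ) + 1)))) (-(S + g) / (2 * C ^ 2 * ((n : ℝ) + 1)))| ≤
      2 / (C * n) := by
  have hn1 : (1 : ℝ) ≤ n := by exact_mod_cast hn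
  have hn0 : (0 : ℝ) < n := by linarith
  refine (abs_clip_sub_clip_le _ _ _ _).trans ?_
  have h1 : |1 / (C * √(2 * (n : ℝ))) - 1 / (C * √(2 * ((n : ℝ) + 1)))| ≤ 1 / (C * n) := by
    have hle := betCap_anti hC hn1
    rw [abs_of_nonneg (by linarith)]
    set p := √(2 * (n : ℝ)) with hp
    set q := √(2 * ((n : ℝ) + 1)) with hq
    have hp2 : p ^ 2 = 2 * n := Real.sq_sqrt (by linarith)
    have hq2 : q ^ 2 = 2 * (n + 1) := Real.sq_sqrt (by linarith)
    have hp1 : 1 ≤ p := Real.one_le_sqrt.2 (by linarith)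
    have hpq : p ≤ q := Real.sqrt_le_sqrt (by linarith)
    have e : 1 / (C * p) - 1 / (C * q) = (q - p) / (C * (p * q)) := by
      have : p ≠ 0 := by linarith
      have : q ≠ 0 := by linarith
      field_simp
    rw [e, div_le_div_iff₀ (by positivity) (by positivity)]
    have h2 : (q - p) * (q + p) = 2 := by nlinarith
    have h3 : (q - p) * n ≤ p * q := by nlinarith
    nlinarith
  have h2 : |-S / (2 * C ^ 2 * n) - -(S + g) / (2 * C ^ 2 * ((n : ℝ) + 1))| ≤ 1 / (C * n) := by
    have e : -S / (2 * C ^ 2 * n) - -(S + g) / (2 * C ^ 2 * ((n : ℝ) + 1)) =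
        (g * n - S) / (2 * C ^ 2 * n * (n + 1)) := by field_simp; ring
    rw [e, abs_div, abs_of_pos (show 0 < 2 * C ^ 2 * n * ((n : ℝ) + 1) by positivity)]
    have h3 : |g * n - S| ≤ 2 * C * n := by
      refine (abs_sub _ _).trans ?_
      rw [abs_mul, abs_of_pos hn0]
      nlinarith
    rw [div_le_div_iff₀ (by positivity) (by positivity)]
    calc |g * n - S| * (C * n) ≤ 2 * C * n * (C * n) := by gcongr
      _ ≤ 1 * (2 * C ^ 2 * n * (n + 1)) := by
        have : 0 ≤ 2 * C ^ 2 * n := by positivity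
        nlinarith
  have e : 2 / (C * (n : ℝ)) = 1 / (C * n) + 1 / (C * n) := by ring
  linarith

end OCOM

/-! ### The wealth process and the regret in dimension one -/

namespace OCOM

/-! ### Runs of the one-dimensional algorithm -/

/-- The assumptions on the parameters of the one-dimensional algorithm. -/
structure BetParams (lam gam eps G Rb : ℝ) : Prop where
  lam_nonneg : 0 ≤ lam
  gam_nonneg : 0 ≤ gam
  eps_pos : 0 < eps
  G_pos : 0 < G
  Rb_pos : 0 < Rb

/-- The surrogate gradient. -/
noncomputable def Bettor.surr (Rb : ℝ) (s : Bettor) (g : ℝ) : ℝ :=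
  if g * clip Rb s.raw ≤ g * s.raw then g else 0

/-- `BetRun lam gam eps G Rb n s U l m c`: the one-dimensional algorithm is in the state `s` after
`n` rounds, in which the sum of the gradients was `U`, the loss `l`, the movement `m`, and the sum
of the predictions, weighted by `1 / √t`, was `c`. -/
inductive BetRun (lam gam eps G Rb : ℝ) : ℕ → Bettor → ℝ → ℝ → ℝ → ℝ → Prop
  | start : BetRun lam gam eps G Rb 0 ⟨1, eps, 0, 0⟩ 0 0 0 0
  | step {n : ℕ} {s : Bettor} {U l m c : ℝ} (h : BetRun lam gam eps G Rb n s U l m c) (g : ℝ)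
      (hg : |g| ≤ G) :
      BetRun lam gam eps G Rb (n + 1) (s.next lam gam G Rb g) (U + g) (l + g * clip Rb s.raw)
        (m + |clip Rb s.raw - clip Rb (s.next lam gam G Rb g).raw|)
        (c + clip Rb s.raw / √((n : ℝ) + 1))

/-- The basic invariants of the state after `n` rounds. -/
structure BetState (lam gam eps G : ℝ) (n : ℕ) (s : Bettor) : Prop where
  round_eq : s.round = n + 1
  abs_gradSum : |s.gradSum| ≤ G * n
  frac_eq : s.frac = clip (1 / ((G + lam + gam) * √(2 * (n : ℝ))))
    (-s.gradSum / (2 * (G + lam + gam) ^ 2 * n))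
  wealth_pos : 0 < s.wealth
  wealth_zero : n = 0 → s.wealth = eps
  grad_zero : n = 0 → s.gradSum = 0

variable {lam gam eps G Rb : ℝ}

theorem BetParams.C_pos (hp : BetParams lam gam eps G Rb) : 0 < G + lam + gam := by
  have := hp.lam_nonneg
  have := hp.gam_nonneg
  have := hp.G_pos
  linarith

theorem BetState.frac_nonneg {n : ℕ} {s : Bettor} (h : BetState lam gam eps G n s) :
    0 ≤ s.frac := by rw [h.frac_eq]; exact clip_nonneg _ _

theorem BetState.raw_nonneg {n : ℕ} {s : Bettor} (h : BetState lam gam eps G n s) :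
    0 ≤ s.raw := mul_nonneg h.frac_nonneg h.wealth_pos.le

theorem BetState.frac_le {n : ℕ} {s : Bettor} (hp : BetParams lam gam eps G Rb)
    (h : BetState lam gam eps G n s) : s.frac ≤ 1 / ((G + lam + gam) * √(2 * (n : ℝ))) := by
  have := hp.C_pos
  rw [h.frac_eq]; exact clip_le (by positivity) _

theorem BetState.frac_zero {s : Bettor} (h : BetState lam gam eps G 0 s) : s.frac = 0 := by
  rw [h.frac_eq]; simp [clip]

theorem Bettor.abs_surr_le (s : Bettor) {g : ℝ} (hg : |g| ≤ G) : |s.surr Rb g| ≤ G := by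
  unfold Bettor.surr
  split_ifs
  · exact hg
  · simpa using (abs_nonneg g).trans hg

theorem Bettor.next_gradSum (s : Bettor) (g : ℝ) :
    (s.next lam gam G Rb g).gradSum = s.gradSum + s.surr Rb g := rfl

theorem BetState.next_frac {n : ℕ} {s : Bettor} (h : BetState lam gam eps G n s) (g : ℝ) :
    (s.next lam gam G Rb g).frac = clip (1 / ((G + lam + gam) * √(2 * ((n : ℝ) + 1))))
      (-(s.gradSum + s.surr Rb g) / (2 * (G + lam + gam) ^ 2 * ((n : ℝ) + 1))) := by
  simp only [Bettor.next, h.round_eq, Bettor.surr]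
  push_cast
  rfl

/-- The cap after n + 1 ≥ 1 rounds is strictly below 1/C ≤ 1/λ (for λ > 0). This is the condition
under which the wealth equation has a unique solution. -/
theorem BetState.lam_mul_next_frac_lt {n : ℕ} {s : Bettor} (hp : BetParams lam gam eps G Rb)
    (h : BetState lam gam eps G n s) (g : ℝ) :
    lam * (s.next lam gam G Rb g).frac < 1 := by
  have hC := hp.C_pos
  have h1 : (s.next lam gam G Rb g).frac ≤ 1 / ((G + lam + gam) * √(2 * ((n : ℝ) + 1))) := by
    rw [h.next_frac]; exact clip_le (by positivity) _
  have hs : 1 < √(2 * ((n : ℝ) + 1)) := by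
    rw [Real.lt_sqrt (by norm_num)]
    have : (0 : ℝ) ≤ n := n.cast_nonneg
    linarith
  have h2 : 1 / ((G + lam + gam) * √(2 * ((n : ℝ) + 1))) < 1 / (G + lam + gam) := by
    apply one_div_lt_one_div_of_lt hC
    nlinarith
  have hl := hp.lam_nonneg
  calc lam * (s.next lam gam G Rb g).frac ≤ lam * (1 / (G + lam + gam)) := by
        gcongr; exact h1.trans h2.le
    _ < 1 := by
      rw [mul_one_div, div_lt_one hC]
      have := hp.G_pos
      have := hp.gam_nonneg
      linarith

theorem BetState.wealthEq {n : ℕ} {s : Bettor} (hp : BetParams lam gam eps G Rb)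
    (h : BetState lam gam eps G n s) (g : ℝ) :
    WealthEq lam gam (n + 1) (s.surr Rb g) s.frac (s.next lam gam G Rb g).frac s.wealth
      (s.next lam gam G Rb g).wealth := by
  have hb : 0 ≤ (s.next lam gam G Rb g).frac := by rw [h.next_frac]; exact clip_nonneg _ _
  have := Classical.epsilon_spec (wealthEq_existsUnique (gam := gam) (t := s.round)
    (g := s.surr Rb g) (β := s.frac) (W := s.wealth) hp.lam_nonneg hb
    (h.lam_mul_next_frac_lt hp g)).exists
  rw [← h.round_eq]
  exact this

theorem BetState.wealthStep {n : ℕ} {s : Bettor} (hp : BetParams lam gam eps G Rb)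
    (h : BetState lam gam eps G n s) (hn : 1 ≤ n) {g : ℝ} (hg : |g| ≤ G) :
    WealthStep (G + lam + gam) n (s.surr Rb g) s.frac (s.next lam gam G Rb g).frac s.wealth
      (s.next lam gam G Rb g).wealth := by
  have hC := hp.C_pos
  refine OCOM.wealthStep hp.lam_nonneg hp.gam_nonneg hp.G_pos hn h.wealth_pos
    (s.abs_surr_le hg) h.frac_nonneg (h.frac_le hp) ?_ ?_ ?_ (h.wealthEq hp g)
  · rw [h.next_frac]; exact clip_nonneg _ _
  · rw [h.next_frac]; exact clip_le (by positivity) _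
  · rw [h.next_frac, h.frac_eq]
    have := hp.lam_nonneg
    have := hp.gam_nonneg
    exact abs_frac_sub_frac_le hp.G_pos.le (by linarith) hC hn h.abs_gradSum
      (s.abs_surr_le hg)

/-- The wealth after the first round. -/
theorem BetState.first {s : Bettor} (hp : BetParams lam gam eps G Rb)
    (h : BetState lam gam eps G 0 s) (g : ℝ) :
    eps / 2 ≤ (s.next lam gam G Rb g).wealth ∧ (s.next lam gam G Rb g).wealth ≤ eps := by
  have hw := h.wealthEq hp g
  unfold WealthEq at hw
  rw [h.frac_zero, h.wealth_zero rfl] at hw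
  have hl := hp.lam_nonneg
  have he := hp.eps_pos
  have hb : 0 ≤ (s.next lam gam G Rb g).frac := by rw [h.next_frac]; exact clip_nonneg _ _
  have hlt := h.lam_mul_next_frac_lt hp g
  set w := (s.next lam gam G Rb g).wealth
  set β := (s.next lam gam G Rb g).frac
  simp only [mul_zero, sub_zero, zero_div, one_mul, zero_mul, zero_sub, abs_neg, abs_mul,
    abs_of_nonneg hb] at hw
  have h0 : 0 ≤ lam * β := mul_nonneg hl hb
  have hw' : w = eps - lam * β * |w| := by rw [mul_assoc]; exact hw
  have hw0 : 0 ≤ w := by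
    by_contra hneg
    push Not at hneg
    rw [abs_of_neg hneg] at hw'
    nlinarith
  rw [abs_of_nonneg hw0] at hw'
  constructor <;> nlinarith

theorem BetRun.betState (hp : BetParams lam gam eps G Rb) {n : ℕ} {s : Bettor} {U l m c : ℝ}
    (h : BetRun lam gam eps G Rb n s U l m c) : BetState lam gam eps G n s := by
  induction h with
  | start => exact ⟨rfl, by simp, by simp [clip], hp.eps_pos, fun _ => rfl, fun _ => rfl⟩
  | @step n s U l m c h g hg ih =>
    refine ⟨by simp [Bettor.next, ih.round_eq], ?_, ?_, ?_, by simp, by simp⟩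
    · rw [Bettor.next_gradSum]
      refine (abs_add_le _ _).trans ?_
      have := s.abs_surr_le (Rb := Rb) hg
      have := ih.abs_gradSum
      push_cast
      linarith
    · rw [ih.next_frac, Bettor.next_gradSum]
      push_cast
      rfl
    · rcases Nat.eq_zero_or_pos n with rfl | hn
      · have := (ih.first hp g).1
        have := hp.eps_pos
        linarith
      · have := (ih.wealthStep hp hn hg).lower
        have := ih.wealth_pos
        linarith

/-! ### The lower bound of the wealth -/

theorem one_div_le_log_succ_sub_log {n : ℝ} (hn : 1 ≤ n) :
    1 / (2 * n) ≤ Real.log (n + 1) - Real.log n := by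
  have hn0 : 0 < n := by linarith
  rw [← Real.log_div (by positivity) (by positivity)]
  have h1 := Real.one_sub_inv_le_log_of_pos (show 0 < (n + 1) / n by positivity)
  refine le_trans ?_ h1
  rw [inv_div, one_sub_div (by positivity), div_le_div_iff₀ (by positivity) (by positivity)]
  linarith

/-- The fraction β_t minimizes Sβ + C²nβ² on [0, cap], so the log-wealth competes with the best
fixed fraction as in follow-the-leader with a growing quadratic regularizer. The induction
hypothesis is applied at the current fraction; strong convexity transfers it to any β' at a price
O(1/n) per round, and these prices sum to a multiple of log n. -/
theorem BetRun.log_wealth_ge (hp : BetParams lam gam eps G Rb) {n : ℕ} {s : Bettor}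
    {U l m c : ℝ} (h : BetRun lam gam eps G Rb n s U l m c) (hn : 1 ≤ n) :
    ∀ β, 0 ≤ β → β ≤ 1 / ((G + lam + gam) * √(2 * (n : ℝ))) →
      Real.log eps - s.gradSum * β - (G + lam + gam) ^ 2 * n * β ^ 2 - 446 * Real.log n - 2 ≤
        Real.log s.wealth := by
  have hC := hp.C_pos
  have hl0 := hp.lam_nonneg
  have hg0 := hp.gam_nonneg
  have he := hp.eps_pos
  induction h with
  | start => simp at hn
  | @step n s U l m c h g hg ih =>
    have hs := h.betState hp
    have hsg := s.abs_surr_le (Rb := Rb) hg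
    intro β' hβ' hβc'
    rw [Bettor.next_gradSum]
    set gt := s.surr Rb g with hgt
    set C := G + lam + gam with hCdef
    have hgtC : |gt| ≤ C := by linarith
    rcases Nat.eq_zero_or_pos n with rfl | hn
    · have h1 := (hs.first hp g).1
      have h2 : Real.log eps - 1 ≤ Real.log (s.next lam gam G Rb g).wealth := by
        refine le_trans ?_ (Real.log_le_log (by positivity) h1)
        rw [Real.log_div he.ne' (by norm_num)]
        have := Real.log_two_lt_d9
        linarith
      have h3 : -(gt * β') ≤ 1 := by
        have hb := betCap_mul_le hC (n := ((0 + 1 : ℕ) : ℝ)) (by simp) hβc'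
        have hs1 : 1 ≤ √(2 * ((0 + 1 : ℕ) : ℝ)) := Real.one_le_sqrt.2 (by norm_num)
        have h4 : C * β' ≤ 1 := by
          have : 0 ≤ C * β' := by positivity
          nlinarith
        have h5 : -gt ≤ C := (neg_le_abs _).trans hgtC
        nlinarith
      rw [hs.grad_zero rfl]
      have h4 : 0 ≤ C ^ 2 * β' ^ 2 := by positivity
      simp only [zero_add, Nat.cast_one, Real.log_one, mul_zero, mul_one, sub_zero]
      linarith
    · have hn1 : (1 : ℝ) ≤ n := by exact_mod_cast hn
      have hn0 : (0 : ℝ) < n := by linarith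
      have hfn := hs.frac_nonneg
      have hfc := hs.frac_le hp
      have hih := ih hn s.frac hfn hfc
      have hstep := (hs.wealthStep hp hn hg).log_lower
      rw [← hgt] at hstep
      have hβc : β' ≤ 1 / (C * √(2 * (n : ℝ))) := by
        refine hβc'.trans ?_
        push_cast
        exact betCap_anti hC hn1
      -- First-order optimality of the current fraction for Sβ + C²nβ².
      have hvar : 0 ≤ (β' - s.frac) * (s.gradSum + 2 * C ^ 2 * n * s.frac) := by
        have := clip_variational (x := -s.gradSum / (2 * C ^ 2 * n)) hβ' hβc
        rw [← hs.frac_eq] at this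
        have e : (-s.gradSum / (2 * C ^ 2 * n) - s.frac) * (β' - s.frac) * (2 * C ^ 2 * n) =
            -((β' - s.frac) * (s.gradSum + 2 * C ^ 2 * n * s.frac)) := by
          field_simp; ring
        have h2 : 0 ≤ 2 * C ^ 2 * n := by positivity
        have := mul_nonpos_of_nonpos_of_nonneg this h2
        linarith
      have hlog := one_div_le_log_succ_sub_log hn1
      -- Completing the square: the gain from strong convexity outweighs the linear term of the new
      -- gradient up to 1/(4n).
      have hq : -(1 / (4 * (n : ℝ))) ≤ C ^ 2 * n * (β' - s.frac) ^ 2 + gt * (β' - s.frac) := by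
        have h1 : -(C * |β' - s.frac|) ≤ gt * (β' - s.frac) := by
          have := neg_abs_le (gt * (β' - s.frac))
          rw [abs_mul] at this
          have : |gt| * |β' - s.frac| ≤ C * |β' - s.frac| := by gcongr
          linarith
        have h2 : (β' - s.frac) ^ 2 = |β' - s.frac| ^ 2 := (sq_abs _).symm
        rw [h2]
        set a := |β' - s.frac|
        have e : C ^ 2 * n * a ^ 2 - C * a + 1 / (4 * n) = n * (C * a - 1 / (2 * n)) ^ 2 := by
          field_simp; ring
        have : 0 ≤ (n : ℝ) * (C * a - 1 / (2 * n)) ^ 2 := by positivity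
        linarith
      -- In units of 1/(2n) ≤ log(n + 1) − log n the losses are 444 and 1/2, below the available
      -- 446.
      have e1 : (222 : ℝ) / n = 444 * (1 / (2 * n)) := by ring
      have e2 : 1 / (4 * (n : ℝ)) = 1 / 2 * (1 / (2 * n)) := by ring
      have h3 : 0 ≤ 1 / (2 * (n : ℝ)) := by positivity
      have h4 : 0 ≤ C ^ 2 * β' ^ 2 := by positivity
      push_cast
      linarith

/-! ### The regret -/

/-- A gradient is discarded only if the raw prediction exceeds `Rb` and g < 0. The clipped
prediction is then `Rb`, the best point below `Rb` for such a g, so the discarded round has no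
positive regret. -/
theorem Bettor.surr_regret {n : ℕ} {s : Bettor} (h : BetState lam gam eps G n s) (hR : 0 ≤ Rb)
    (g : ℝ) {u : ℝ} (huR : u ≤ Rb) :
    g * clip Rb s.raw - g * u ≤ s.surr Rb g * s.raw - s.surr Rb g * u := by
  unfold Bettor.surr
  split_ifs with hc
  · linarith
  · push Not at hc
    have h0 := h.raw_nonneg
    rcases le_total s.raw Rb with h1 | h1
    · rw [clip_of_le h0 h1] at hc; exact absurd hc (lt_irrefl _)
    · rw [clip_of_ge hR h1] at hc ⊢
      have : g < 0 := by
        by_contra hg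
        push Not at hg
        nlinarith
      nlinarith

/-- The wealth equation says that surrogate loss, γ-term and λ-weighted movement of the raw
predictions in a round add up to the decrease of the wealth. Clipping only lowers the movement and
the γ-term, so the sum telescopes. -/
theorem BetRun.ledger (hp : BetParams lam gam eps G Rb) {n : ℕ} {s : Bettor} {U l m c : ℝ}
    (h : BetRun lam gam eps G Rb n s U l m c) {u : ℝ} (huR : u ≤ Rb) :
    l - U * u + lam * m + gam * c ≤ eps - s.wealth - s.gradSum * u := by
  induction h with
  | start => simp
  | @step n s U l m c h g hg ih =>
    have hs := h.betState hp
    have hw := hs.wealthEq hp g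
    unfold WealthEq at hw
    rw [Bettor.next_gradSum]
    have h1 := Bettor.surr_regret hs hp.Rb_pos.le g huR
    have h2 : |clip Rb s.raw - clip Rb (s.next lam gam G Rb g).raw| ≤
        |s.raw - (s.next lam gam G Rb g).raw| := abs_clip_sub_clip_le' _ _ _
    have h3 := mul_le_mul_of_nonneg_left h2 hp.lam_nonneg
    have h4 : clip Rb s.raw / √((n : ℝ) + 1) ≤ s.raw / √((n : ℝ) + 1) := by
      gcongr; exact clip_le_self hs.raw_nonneg
    have h5 := mul_le_mul_of_nonneg_left h4 hp.gam_nonneg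
    have e : s.frac * s.wealth - (s.next lam gam G Rb g).frac * (s.next lam gam G Rb g).wealth =
      s.raw - (s.next lam gam G Rb g).raw := rfl
    rw [e] at hw
    push_cast at hw
    have e2 : (1 - s.surr Rb g * s.frac - gam * s.frac / √((n : ℝ) + 1)) * s.wealth =
        s.wealth - s.surr Rb g * s.raw - gam * (s.raw / √((n : ℝ) + 1)) := by
      unfold Bettor.raw; ring
    linarith

/-- The convex conjugate of the exponential function. -/
theorem mul_sub_exp_le {a b u X : ℝ} (ha : 0 < a) (hb : 0 < b) (hu : 0 < u) :
    u * X - a * Real.exp (X / b) ≤ u * b * Real.log (u * b / a) := by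
  set y := X / b - Real.log (u * b / a) with hy
  have e : a * Real.exp (X / b) = u * b * Real.exp y := by
    rw [hy, Real.exp_sub, Real.exp_log (by positivity)]
    field_simp
  have h1 := Real.add_one_le_exp y
  have h2 : u * b * (y + 1) ≤ u * b * Real.exp y := by gcongr
  have h3 : u * b * y = u * X - u * b * Real.log (u * b / a) := by
    rw [hy, mul_sub]; field_simp
  have : 0 < u * b := by positivity
  rw [e]
  linarith

/-- Taking β equal to the cap 1/b, with b = C√(2n), in the lower bound of the wealth makes the
quadratic penalty 1/2, so W ≥ a·exp(−S/b). The ledger then bounds the cost by ε + u(−S) −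
a·exp(−S/b), and maximizing over S gives ub·log(ub/a). -/
theorem BetRun.regret (hp : BetParams lam gam eps G Rb) {n : ℕ} {s : Bettor} {U l m c : ℝ}
    (h : BetRun lam gam eps G Rb n s U l m c) {u X : ℝ} (hu : 0 ≤ u) (huR : u ≤ Rb)
    (hX : 0 ≤ X) (hn : 1 ≤ n)
    (hlog : Real.log (Rb * ((G + lam + gam) * √(2 * (n : ℝ)))) - Real.log eps +
      446 * Real.log n + 5 / 2 ≤ X) :
    l - U * u + lam * m + gam * c ≤ eps + Rb * ((G + lam + gam) * √(2 * (n : ℝ))) * X := by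
  have hC := hp.C_pos
  have he := hp.eps_pos
  have hR := hp.Rb_pos
  have hs := h.betState hp
  have hW := hs.wealth_pos
  have hn1 : (1 : ℝ) ≤ n := by exact_mod_cast hn
  have hsq : 0 < √(2 * (n : ℝ)) := Real.sqrt_pos.2 (by linarith)
  have hled := h.ledger hp huR
  have hlow := h.log_wealth_ge hp hn (1 / ((G + lam + gam) * √(2 * (n : ℝ)))) (by positivity) le_rfl
  set b := (G + lam + gam) * √(2 * (n : ℝ)) with hb
  have hb0 : 0 < b := by positivity
  have hb2 : (G + lam + gam) ^ 2 * n * (1 / b) ^ 2 = 1 / 2 := by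
    rw [div_pow, hb, mul_pow (G + lam + gam), Real.sq_sqrt (by linarith)]
    field_simp
  rw [hb2] at hlow
  rcases hu.eq_or_lt with rfl | hu
  · have : 0 ≤ Rb * b * X := by positivity
    linarith
  · set a := Real.exp (Real.log eps - 446 * Real.log n - 5 / 2) with ha
    have hWa : a * Real.exp (-s.gradSum / b) ≤ s.wealth := by
      rw [ha, ← Real.exp_add, ← Real.le_log_iff_exp_le hW]
      refine le_trans (le_of_eq ?_) hlow
      ring
    have h1 := mul_sub_exp_le (a := a) (X := -s.gradSum) (Real.exp_pos _) hb0 hu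
    have h2 : Real.log (u * b / a) ≤ X := by
      refine le_trans ?_ hlog
      rw [Real.log_div (by positivity) (Real.exp_pos _).ne', Real.log_exp]
      have : Real.log (u * b) ≤ Real.log (Rb * b) :=
        Real.log_le_log (by positivity) (by gcongr)
      linarith
    have h3 : u * b * Real.log (u * b / a) ≤ Rb * b * X := by
      calc u * b * Real.log (u * b / a) ≤ u * b * X := by gcongr
        _ ≤ Rb * b * X := by gcongr
    linarith

/-- The prediction is small in comparison with the wealth. -/
theorem BetState.two_lam_raw_le {n : ℕ} {s : Bettor} (hp : BetParams lam gam eps G Rb)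
    (h : BetState lam gam eps G n s) (hlam : 2 * lam ≤ G + lam + gam) :
    2 * lam * s.raw ≤ s.wealth := by
  have hC := hp.C_pos
  rcases Nat.eq_zero_or_pos n with rfl | hn
  · rw [Bettor.raw, h.frac_zero]
    simpa using h.wealth_pos.le
  · have hn1 : (1 : ℝ) ≤ n := by exact_mod_cast hn
    have h1 := betCap_mul_le hC hn1 (h.frac_le hp)
    have hs : 1 ≤ √(2 * (n : ℝ)) := Real.one_le_sqrt.2 (by linarith)
    have h2 := h.frac_nonneg
    have h3 : (G + lam + gam) * s.frac ≤ 1 := by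
      have : 0 ≤ (G + lam + gam) * s.frac := by positivity
      nlinarith
    have h4 : 2 * lam * s.frac ≤ 1 := by nlinarith
    have := h.wealth_pos
    unfold Bettor.raw
    nlinarith

end OCOM

/-! ### Upper bounds of the wealth and of the movement in dimension one -/

namespace OCOM

variable {lam gam eps G Rb : ℝ}

/-! ### The upper bound of the wealth and of the movement -/

/-- The potential in the upper bound of the wealth, where `m` is the negative of the sum of the
surrogate gradients and `A` is proportional to the number of rounds. -/
noncomputable def betPotential (A m : ℝ) : ℝ := min (max m 0 ^ 2) A / (4 * A)

theorem betPotential_nonneg {A : ℝ} (hA : 0 < A) (m : ℝ) : 0 ≤ betPotential A m := by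
  unfold betPotential; positivity

theorem betPotential_le {A : ℝ} (hA : 0 < A) (m : ℝ) : betPotential A m ≤ 1 / 4 := by
  unfold betPotential
  rw [div_le_div_iff₀ (by positivity) (by norm_num)]
  linarith [min_le_right (max m 0 ^ 2) A]

theorem betPotential_of_nonpos {A m : ℝ} (hA : 0 < A) (hm : m ≤ 0) : betPotential A m = 0 := by
  rw [betPotential, max_eq_right hm, min_eq_left (by simpa using hA.le)]; simp

theorem betPotential_of_sq_le {A m : ℝ} (hm : 0 ≤ m) (h : m ^ 2 ≤ A) :
    betPotential A m = m ^ 2 / (4 * A) := by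
  rw [betPotential, max_eq_left hm, min_eq_left h]

theorem betPotential_of_le_sq {A m : ℝ} (hA : 0 < A) (hm : 0 ≤ m) (h : A ≤ m ^ 2) :
    betPotential A m = 1 / 4 := by
  rw [betPotential, max_eq_left hm, min_eq_right h]; field_simp

/-- While m² ≤ A the potential is quadratic and the clipped value is half its normalized slope, so
the step is a completed square. Beyond that the potential is flat and could not pay for a gain, but
there g ≥ 0. With A = C²n the remainder is 1/(2(n + 1)), which sums to (log n)/2. -/
theorem betPotential_step {C A m g : ℝ} (hC : 0 < C) (hA : C ^ 2 ≤ A) (hg : |g| ≤ C)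
    (hbig : √A / 3 ≤ m → 0 ≤ g) :
    -(g * clip (1 / √(2 * A)) (m / (2 * A))) ≤
      betPotential (A + C ^ 2) (m - g) - betPotential A m + C ^ 2 / (2 * (A + C ^ 2)) := by
  have hA0 : 0 < A := lt_of_lt_of_le (by positivity) hA
  have hA'0 : 0 < A + C ^ 2 := by positivity
  set r := √A with hr
  have hr2 : r ^ 2 = A := Real.sq_sqrt hA0.le
  have hr0 : 0 < r := Real.sqrt_pos.2 hA0
  have hrC : C ≤ r := Real.le_sqrt_of_sq_le hA
  have hgl := abs_le.1 hg
  have hCA : 0 ≤ C ^ 2 / (2 * (A + C ^ 2)) := by positivity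
  have hCA' : C ^ 2 / (4 * (A + C ^ 2)) ≤ C ^ 2 / (2 * (A + C ^ 2)) := by gcongr; norm_num
  have hpot' := betPotential_nonneg hA'0 (m - g)
  have hcap : √(2 * A) ≤ 2 * r := by
    rw [Real.sqrt_le_left (by positivity), mul_pow, hr2]; linarith
  have hcap0 : 0 < √(2 * A) := Real.sqrt_pos.2 (by linarith)
  have hcap1 : 1 / (2 * r) ≤ 1 / √(2 * A) := by gcongr
  -- The price of enlarging the denominator from A to A + C² within the quadratic regime.
  have hkey : ∀ m', 0 ≤ m' → m' ^ 2 ≤ A + C ^ 2 →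
      m' ^ 2 / (4 * A) ≤ m' ^ 2 / (4 * (A + C ^ 2)) + C ^ 2 / (4 * A) := by
    intro m' _ h2
    have e : m' ^ 2 / (4 * (A + C ^ 2)) + C ^ 2 / (4 * A) - m' ^ 2 / (4 * A) =
        (C ^ 2 * (A + C ^ 2 - m' ^ 2)) / (4 * A * (A + C ^ 2)) := by field_simp; ring
    have : 0 ≤ (C ^ 2 * (A + C ^ 2 - m' ^ 2)) / (4 * A * (A + C ^ 2)) := by
      apply div_nonneg
      · exact mul_nonneg (by positivity) (by linarith)
      · positivity
    linarith
  rcases le_or_gt m 0 with hm | hm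
  · rw [clip_of_nonpos (div_nonpos_of_nonpos_of_nonneg hm (by positivity)),
      betPotential_of_nonpos hA0 hm]
    linarith
  rcases le_or_gt (m ^ 2) A with hmA | hmA
  · have hmr : m ≤ r := Real.le_sqrt_of_sq_le hmA
    have hβ : clip (1 / √(2 * A)) (m / (2 * A)) = m / (2 * A) := by
      refine clip_of_le (by positivity) (le_trans ?_ hcap1)
      rw [div_le_div_iff₀ (by positivity) (by positivity)]
      nlinarith
    rw [hβ, betPotential_of_sq_le hm.le hmA]
    have e : -(g * (m / (2 * A))) =
        (m - g) ^ 2 / (4 * A) - m ^ 2 / (4 * A) - g ^ 2 / (4 * A) := by field_simp; ring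
    have hg2 : 0 ≤ g ^ 2 / (4 * A) := by positivity
    rcases le_or_gt (m - g) 0 with hm' | hm'
    · have h1 : (m - g) ^ 2 ≤ g ^ 2 := by nlinarith
      have h2 : (m - g) ^ 2 / (4 * A) ≤ g ^ 2 / (4 * A) := by gcongr
      linarith
    -- The new argument stays in the quadratic regime: m can increase only if m < r/3, and then (r/3
    -- + C)² ≤ r² + C² because C ≤ r.
    · have hle : (m - g) ^ 2 ≤ A + C ^ 2 := by
        rcases le_or_gt 0 g with h0 | h0
        · nlinarith
        · have h1 : m < r / 3 := by
            by_contra h; push Not at h; linarith [hbig h]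
          have h2 : m - g ≤ r / 3 + C := by linarith
          calc (m - g) ^ 2 ≤ (r / 3 + C) ^ 2 := by gcongr
            _ ≤ A + C ^ 2 := by nlinarith
      rw [betPotential_of_sq_le hm'.le hle]
      have h1 := hkey _ hm'.le hle
      have h2 : C ^ 2 / (4 * A) ≤ C ^ 2 / (2 * (A + C ^ 2)) := by
        rw [div_le_div_iff₀ (by positivity) (by positivity)]
        exact mul_le_mul_of_nonneg_left (by linarith) (by positivity)
      linarith
  · have hmr : r ≤ m := by
      by_contra h; push Not at h; nlinarith
    have hg0 : 0 ≤ g := hbig (by linarith)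
    have hβ : 1 / (2 * r) ≤ clip (1 / √(2 * A)) (m / (2 * A)) := by
      refine le_clip hcap1 ?_
      rw [div_le_div_iff₀ (by positivity) (by positivity)]
      nlinarith
    have hm' : 0 ≤ m - g := by linarith
    have hgβ : g * (1 / (2 * r)) ≤ g * clip (1 / √(2 * A)) (m / (2 * A)) := by gcongr
    have hgr : 0 ≤ g * (1 / (2 * r)) := by positivity
    rw [betPotential_of_le_sq hA0 hm.le hmA.le]
    rcases le_or_gt (A + C ^ 2) ((m - g) ^ 2) with h1 | h1
    · rw [betPotential_of_le_sq hA'0 hm' h1]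
      linarith
    rw [betPotential_of_sq_le hm' h1.le]
    rcases le_or_gt r (m - g) with h2 | h2
    · have h3 : A / (4 * (A + C ^ 2)) ≤ (m - g) ^ 2 / (4 * (A + C ^ 2)) := by
        gcongr; rw [← hr2]; gcongr
      have e : A / (4 * (A + C ^ 2)) = 1 / 4 - C ^ 2 / (4 * (A + C ^ 2)) := by field_simp; ring
      linarith
    · have h3 : (m - g) ^ 2 / (4 * A) - C ^ 2 / (4 * (A + C ^ 2)) ≤
          (m - g) ^ 2 / (4 * (A + C ^ 2)) := by
        have e : (m - g) ^ 2 / (4 * (A + C ^ 2)) + C ^ 2 / (4 * (A + C ^ 2)) -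
            (m - g) ^ 2 / (4 * A) =
            (C ^ 2 * (A - (m - g) ^ 2)) / (4 * A * (A + C ^ 2)) := by field_simp; ring
        have : 0 ≤ (C ^ 2 * (A - (m - g) ^ 2)) / (4 * A * (A + C ^ 2)) := by
          apply div_nonneg
          · refine mul_nonneg (by positivity) ?_
            nlinarith
          · positivity
        linarith
      -- A descent from the flat part into the quadratic one: g is at least the depth r − (m − g)
      -- below the kink, and the loss of potential is at most the resulting decrease of the
      -- logarithm.
      have h4 : (r - (m - g)) * (1 / (2 * r)) ≤ g * (1 / (2 * r)) := by gcongr; linarith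
      have e : (r - (m - g)) * (1 / (2 * r)) + (m - g) ^ 2 / (4 * A) - 1 / 4 =
          (r - (m - g)) ^ 2 / (4 * A) := by
        rw [← hr2]; field_simp; ring
      have : 0 ≤ (r - (m - g)) ^ 2 / (4 * A) := by positivity
      linarith

/-- If the wealth is large and the betting fraction is not small, then the surrogate gradient is
not negative. -/
theorem BetState.surr_nonneg {n : ℕ} {s : Bettor} (hp : BetParams lam gam eps G Rb)
    (hs : BetState lam gam eps G n s) (hn : 1 ≤ n)
    (hlarge : 6 * ((G + lam + gam) * Rb) * √(n : ℝ) < s.wealth)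
    (hm : (G + lam + gam) * √(n : ℝ) / 3 ≤ -s.gradSum) (g : ℝ) : 0 ≤ s.surr Rb g := by
  have hC := hp.C_pos
  have hR := hp.Rb_pos
  have hW := hs.wealth_pos
  have hfe := hs.frac_eq
  set C := G + lam + gam
  have hn1 : (1 : ℝ) ≤ n := by exact_mod_cast hn
  have hn0 : (0 : ℝ) < n := by linarith
  have hsn : √(n : ℝ) ^ 2 = n := Real.sq_sqrt hn0.le
  have hsn1 : 1 ≤ √(n : ℝ) := Real.one_le_sqrt.2 hn1
  have h1 : 1 / (6 * (C * √(n : ℝ))) ≤ s.frac := by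
    rw [hfe]
    refine le_clip ?_ ?_
    · refine one_div_le_one_div_of_le (by positivity) ?_
      have : √(2 * (n : ℝ)) ≤ 2 * √(n : ℝ) := by
        rw [Real.sqrt_le_left (by positivity), mul_pow, hsn]; linarith
      have h3 := mul_le_mul_of_nonneg_left this hC.le
      have h4 : 0 ≤ C * √(n : ℝ) := by positivity
      linarith
    · rw [div_le_div_iff₀ (by positivity) (by positivity)]
      calc 1 * (2 * C ^ 2 * (n : ℝ)) = C * √(n : ℝ) / 3 * (6 * (C * √(n : ℝ))) := by
            nth_rewrite 1 [← hsn]; ring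
        _ ≤ -s.gradSum * (6 * (C * √(n : ℝ))) := by gcongr
  have h2 : Rb < s.raw := by
    calc Rb = 1 / (6 * (C * √(n : ℝ))) * (6 * (C * Rb) * √(n : ℝ)) := by field_simp
      _ < 1 / (6 * (C * √(n : ℝ))) * s.wealth := by gcongr
      _ ≤ s.frac * s.wealth := by gcongr
  rw [Bettor.surr, clip_of_ge hR.le h2.le]
  split_ifs with hc
  · by_contra hneg
    push Not at hneg
    nlinarith
  · exact le_rfl

/-- If the wealth is at most 6CR√n, one round at most doubles it, and the bound 12CR√n starts anew
with a nonnegative potential. If it is larger and the betting fraction is not small, the raw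
prediction is outside the domain and the surrogate gradient cannot be negative; the potential then
controls the growth. -/
theorem BetRun.log_wealth_le (hp : BetParams lam gam eps G Rb)
    (heps : eps ≤ (G + lam + gam) * Rb) {n : ℕ} {s : Bettor}
    {U l m c : ℝ} (h : BetRun lam gam eps G Rb n s U l m c) (hn : 1 ≤ n) :
    Real.log s.wealth ≤ Real.log (12 * ((G + lam + gam) * Rb)) + Real.log n / 2 +
      betPotential ((G + lam + gam) ^ 2 * n) (-s.gradSum) := by
  have hC := hp.C_pos
  have hl0 := hp.lam_nonneg
  have hg0 := hp.gam_nonneg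
  have he := hp.eps_pos
  have hR := hp.Rb_pos
  induction h with
  | start => simp at hn
  | @step n s U l m c h g hg ih =>
    have hs := h.betState hp
    have hs' := (h.step g hg).betState hp
    have hsg := s.abs_surr_le (Rb := Rb) hg
    have hW' := hs'.wealth_pos
    rw [Bettor.next_gradSum]
    set gt := s.surr Rb g with hgt
    set C := G + lam + gam with hCdef
    have hgtC : |gt| ≤ C := by linarith
    have hpot := betPotential_nonneg (A := C ^ 2 * ((n + 1 : ℕ) : ℝ)) (by positivity)
      (-(s.gradSum + gt))
    rcases Nat.eq_zero_or_pos n with rfl | hn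
    · have h1 := (hs.first hp g).2
      have h2 : Real.log (s.next lam gam G Rb g).wealth ≤ Real.log (12 * (C * Rb)) :=
        Real.log_le_log hW' (by nlinarith [mul_pos hC hR])
      simp only [zero_add, Nat.cast_one, Real.log_one, zero_div, add_zero] at hpot ⊢
      linarith
    · have hn1 : (1 : ℝ) ≤ n := by exact_mod_cast hn
      have hn0 : (0 : ℝ) < n := by linarith
      have hstep := (hs.wealthStep hp hn hg).upper
      rw [← hgt] at hstep
      have hW := hs.wealth_pos
      have hlogn : Real.log n ≤ Real.log ((n + 1 : ℕ) : ℝ) :=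
        Real.log_le_log hn0 (by push_cast; linarith)
      have hfr := hs.frac_nonneg
      have hfc := hs.frac_le hp
      have hsn : √(n : ℝ) ^ 2 = n := Real.sq_sqrt hn0.le
      have hsn1 : 1 ≤ √(n : ℝ) := Real.one_le_sqrt.2 hn1
      rcases le_or_gt s.wealth (6 * (C * Rb) * √(n : ℝ)) with hsmall | hlarge
      · have h1 : -(gt * s.frac) ≤ 1 := by
          have hb := betCap_mul_le hC hn1 hfc
          have hs1 : 1 ≤ √(2 * (n : ℝ)) := Real.one_le_sqrt.2 (by linarith)
          have h4 : C * s.frac ≤ 1 := by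
            have : 0 ≤ C * s.frac := by positivity
            nlinarith
          have h5 : -gt ≤ C := (neg_le_abs _).trans hgtC
          nlinarith
        have h2 : (s.next lam gam G Rb g).wealth ≤ 12 * (C * Rb) * √(n : ℝ) := by nlinarith
        have h3 := Real.log_le_log hW' h2
        rw [Real.log_mul (by positivity) (by positivity), Real.log_sqrt hn0.le] at h3
        linarith
      · have hA : √(C ^ 2 * (n : ℝ)) = C * √(n : ℝ) := by
          rw [Real.sqrt_mul (by positivity), Real.sqrt_sq hC.le]
        have hA2 : √(2 * (C ^ 2 * (n : ℝ))) = C * √(2 * (n : ℝ)) := by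
          rw [show 2 * (C ^ 2 * (n : ℝ)) = C ^ 2 * (2 * n) by ring,
            Real.sqrt_mul (by positivity), Real.sqrt_sq hC.le]
        have hfe : s.frac = clip (1 / √(2 * (C ^ 2 * (n : ℝ)))) (-s.gradSum / (2 * (C ^ 2 * n))) := by
          rw [hA2, hs.frac_eq, ← mul_assoc 2]
        have hbig : √(C ^ 2 * (n : ℝ)) / 3 ≤ -s.gradSum → 0 ≤ gt := by
          intro hm
          rw [hA] at hm
          exact hs.surr_nonneg hp hn hlarge hm g
        have hps := betPotential_step hC (A := C ^ 2 * n) (by nlinarith [sq_nonneg C]) hgtC hbig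
        rw [← hfe] at hps
        have e1 : -s.gradSum - gt = -(s.gradSum + gt) := by ring
        have e2 : C ^ 2 * (n : ℝ) + C ^ 2 = C ^ 2 * ((n + 1 : ℕ) : ℝ) := by push_cast; ring
        rw [e1, e2] at hps
        have hlog1 : Real.log (s.next lam gam G Rb g).wealth ≤
            Real.log s.wealth - gt * s.frac := by
          have h1 : 0 < 1 - gt * s.frac := by
            by_contra hneg
            push Not at hneg
            nlinarith
          have h2 := Real.log_le_log hW' hstep
          rw [Real.log_mul hW.ne' h1.ne'] at h2
          have := Real.log_le_sub_one_of_pos h1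
          linarith
        have hlog2 : C ^ 2 / (2 * (C ^ 2 * ((n + 1 : ℕ) : ℝ))) ≤
            (Real.log ((n + 1 : ℕ) : ℝ) - Real.log n) / 2 := by
          rw [← Real.log_div (by positivity) (by positivity)]
          have h1 := Real.one_sub_inv_le_log_of_pos
            (show 0 < ((n + 1 : ℕ) : ℝ) / (n : ℝ) by positivity)
          have e : C ^ 2 / (2 * (C ^ 2 * ((n + 1 : ℕ) : ℝ))) =
              (1 - (((n + 1 : ℕ) : ℝ) / (n : ℝ))⁻¹) / 2 := by
            push_cast; field_simp; ring
          rw [e]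
          linarith
        have := ih hn
        linarith

theorem BetRun.wealth_le (hp : BetParams lam gam eps G Rb)
    (heps : eps ≤ (G + lam + gam) * Rb) {n : ℕ} {s : Bettor}
    {U l m c : ℝ} (h : BetRun lam gam eps G Rb n s U l m c) (hn : 1 ≤ n) :
    s.wealth ≤ 16 * ((G + lam + gam) * Rb) * √(n : ℝ) := by
  have hC := hp.C_pos
  have hR := hp.Rb_pos
  have hn1 : (1 : ℝ) ≤ n := by exact_mod_cast hn
  have hn0 : (0 : ℝ) < n := by linarith
  have h1 := h.log_wealth_le hp heps hn
  have h2 := betPotential_le (A := (G + lam + gam) ^ 2 * n) (by positivity) (-s.gradSum)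
  rw [← Real.log_le_log_iff (h.betState hp).wealth_pos (by positivity),
    Real.log_mul (by positivity) (by positivity), Real.log_sqrt hn0.le]
  have hX : 0 < (G + lam + gam) * Rb := by positivity
  -- The potential adds at most 1/4 ≤ log(4/3), which turns 12 into 16.
  have h3 : Real.log (12 * ((G + lam + gam) * Rb)) + 1 / 4 ≤
      Real.log (16 * ((G + lam + gam) * Rb)) := by
    rw [Real.log_mul (by norm_num) hX.ne', Real.log_mul (by norm_num) hX.ne']
    have h4 : Real.log 16 = Real.log 12 + Real.log (4 / 3) := by
      rw [← Real.log_mul (by norm_num) (by norm_num)]; norm_num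
    have h5 := Real.one_sub_inv_le_log_of_pos (show (0 : ℝ) < 4 / 3 by norm_num)
    norm_num at h5 h4 ⊢
    linarith
  linarith

/-- Puts movements of order 1/√n into a telescoping form, so that they can be summed from any
starting round. -/
theorem one_div_sqrt_le_sqrt_sub {x : ℝ} (hx : 1 ≤ x) : 1 / √x ≤ 3 * (√(x + 1) - √x) := by
  set a := √x
  set b := √(x + 1)
  have ha : a ^ 2 = x := Real.sq_sqrt (by linarith)
  have hb : b ^ 2 = x + 1 := Real.sq_sqrt (by linarith)
  have ha1 : 1 ≤ a := Real.one_le_sqrt.2 hx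
  have hab : a ≤ b := Real.sqrt_le_sqrt (by linarith)
  have hb2 : b ≤ 2 * a := by nlinarith
  have h1 : (b - a) * (b + a) = 1 := by nlinarith
  rw [div_le_iff₀ (by linarith)]
  nlinarith

/-- The predictions change slowly. -/
theorem BetRun.move_le (hp : BetParams lam gam eps G Rb)
    (heps : eps ≤ (G + lam + gam) * Rb) {n : ℕ} {s : Bettor}
    {U l m c : ℝ} (h : BetRun lam gam eps G Rb n s U l m c) {g : ℝ} (hg : |g| ≤ G) :
    |clip Rb s.raw - clip Rb (s.next lam gam G Rb g).raw| ≤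
      480 * Rb * (√((n : ℝ) + 2) - √((n : ℝ) + 1)) := by
  have hC := hp.C_pos
  have hR := hp.Rb_pos
  have hs := h.betState hp
  have hnn : (0 : ℝ) ≤ n := n.cast_nonneg
  have hd := one_div_sqrt_le_sqrt_sub (x := (n : ℝ) + 1) (by linarith)
  rw [show (n : ℝ) + 1 + 1 = n + 2 by ring] at hd
  -- The movement 5W/(Cn) with W ≤ 16CR√n is 80R/√n, and √(n + 1) ≤ 2√n doubles the constant. With
  -- no round played before, the diameter `Rb` suffices.
  have hmain : |clip Rb s.raw - clip Rb (s.next lam gam G Rb g).raw| ≤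
      160 * Rb * (1 / √((n : ℝ) + 1)) := by
    rcases Nat.eq_zero_or_pos n with rfl | hn
    · have h1 := clip_nonneg Rb s.raw
      have h2 := clip_nonneg Rb (s.next lam gam G Rb g).raw
      have h3 := clip_le hR.le s.raw
      have h4 := clip_le hR.le (s.next lam gam G Rb g).raw
      have : |clip Rb s.raw - clip Rb (s.next lam gam G Rb g).raw| ≤ Rb := by
        rw [abs_le]; constructor <;> linarith
      simp
      linarith
    · have hn1 : (1 : ℝ) ≤ n := by exact_mod_cast hn
      have hn0 : (0 : ℝ) < n := by linarith
      have hsn : 0 < √(n : ℝ) := Real.sqrt_pos.2 hn0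
      have hsn2 : √(n : ℝ) ^ 2 = n := Real.sq_sqrt hn0.le
      have h1 := (hs.wealthStep hp hn hg).move
      have h2 := h.wealth_le hp heps hn
      refine (abs_clip_sub_clip_le' _ _ _).trans (h1.trans ?_)
      have h3 : √((n : ℝ) + 1) ≤ 2 * √(n : ℝ) := by
        rw [Real.sqrt_le_left (by positivity), mul_pow, hsn2]; linarith
      have h4 : 1 / (2 * √(n : ℝ)) ≤ 1 / √((n : ℝ) + 1) := by gcongr
      calc 5 * s.wealth / ((G + lam + gam) * n) ≤
            5 * (16 * ((G + lam + gam) * Rb) * √(n : ℝ)) / ((G + lam + gam) * n) := by gcongr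
        _ = 160 * Rb * (1 / (2 * √(n : ℝ))) := by
            nth_rewrite 2 [← hsn2]; field_simp; norm_num
        _ ≤ _ := by gcongr
  calc _ ≤ 160 * Rb * (1 / √((n : ℝ) + 1)) := hmain
    _ ≤ 160 * Rb * (3 * (√((n : ℝ) + 2) - √((n : ℝ) + 1))) := by gcongr
    _ = _ := by ring

end OCOM

/-! ### Projections, guarantees of the base algorithms, and slowing down -/

namespace OCOM

/-! ### Euclidean projections -/

section Projection

variable {d : ℕ} {S : Set (Eu d)}

theorem proj_mem (hc : IsClosed S) (hn : S.Nonempty) (x : Eu d) : proj S x ∈ S :=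
  (proj_isProj hc hn x).1

theorem inner_sub_proj_le (hc : IsClosed S) (hn : S.Nonempty) (hv : Convex ℝ S) (x : Eu d)
    {z : Eu d} (hz : z ∈ S) : ⟪x - proj S x, z - proj S x⟫ ≤ 0 := by
  have h := proj_isProj hc hn x
  have : Nonempty S := hn.to_subtype
  refine (norm_eq_iInf_iff_real_inner_le_zero hv h.1).1 ?_ z hz
  refine le_antisymm (le_ciInf fun w => h.2 w w.2) ?_
  exact ciInf_le (f := fun w : S => ‖x - w‖) ⟨0, by rintro _ ⟨w, rfl⟩; positivity⟩ ⟨_, h.1⟩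

theorem norm_proj_sub_proj_le (hc : IsClosed S) (hn : S.Nonempty) (hv : Convex ℝ S)
    (x y : Eu d) : ‖proj S x - proj S y‖ ≤ ‖x - y‖ := by
  have h1 := inner_sub_proj_le hc hn hv x (proj_mem hc hn y)
  have h2 := inner_sub_proj_le hc hn hv y (proj_mem hc hn x)
  have e : ⟪x - y, proj S x - proj S y⟫ = ‖proj S x - proj S y‖ ^ 2 -
      ⟪x - proj S x, proj S y - proj S x⟫ - ⟪y - proj S y, proj S x - proj S y⟫ := by
    rw [← real_inner_self_eq_norm_sq]
    simp only [inner_sub_left, inner_sub_right]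
    ring
  have h3 := real_inner_le_norm (x - y) (proj S x - proj S y)
  rcases (norm_nonneg (proj S x - proj S y)).eq_or_lt with h0 | h0
  · rw [← h0]; positivity
  · have : ‖proj S x - proj S y‖ * ‖proj S x - proj S y‖ ≤
        ‖x - y‖ * ‖proj S x - proj S y‖ := by nlinarith
    exact le_of_mul_le_mul_right this h0

theorem proj_of_mem (hc : IsClosed S) {x : Eu d} (hx : x ∈ S) : proj S x = x := by
  have := (proj_isProj hc ⟨x, hx⟩ x).2 x hx
  rw [sub_self, norm_zero] at this
  exact (sub_eq_zero.1 (norm_le_zero_iff.1 this)).symm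

theorem norm_proj_ball_le {r : ℝ} (hr : 0 ≤ r) (x : Eu d) :
    ‖proj (Metric.closedBall 0 r) x‖ ≤ r := by
  have := proj_mem (S := Metric.closedBall (0 : Eu d) r) Metric.isClosed_closedBall
    ⟨0, by simpa using hr⟩ x
  simpa using this

theorem norm_proj_ball_sub_le {r : ℝ} (hr : 0 ≤ r) (x y : Eu d) :
    ‖proj (Metric.closedBall 0 r) x - proj (Metric.closedBall 0 r) y‖ ≤ ‖x - y‖ :=
  norm_proj_sub_proj_le Metric.isClosed_closedBall ⟨0, by simpa using hr⟩
    (convex_closedBall _ _) x y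

theorem proj_ball_of_le {r : ℝ} {x : Eu d} (hx : ‖x‖ ≤ r) :
    proj (Metric.closedBall 0 r) x = x :=
  proj_of_mem Metric.isClosed_closedBall (by simpa using hx)

theorem proj_ball_of_ge {r : ℝ} (hr : 0 < r) {x : Eu d} (hx : r ≤ ‖x‖) :
    proj (Metric.closedBall 0 r) x = (r / ‖x‖) • x := by
  have hx0 : 0 < ‖x‖ := hr.trans_le hx
  have hy : ‖(r / ‖x‖) • x‖ = r := by
    rw [norm_smul, Real.norm_of_nonneg (by positivity)]; field_simp
  set p := proj (Metric.closedBall 0 r) x with hp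
  have hpr : ‖p‖ ≤ r := norm_proj_ball_le hr.le x
  have h1 := inner_sub_proj_le (S := Metric.closedBall (0 : Eu d) r) Metric.isClosed_closedBall
    ⟨0, by simpa using hr.le⟩ (convex_closedBall _ _) x (z := (r / ‖x‖) • x)
    (by simpa using hy.le)
  rw [← hp] at h1
  set y := (r / ‖x‖) • x with hydef
  have e : x - p = (y - p) + (‖x‖ / r - 1) • y := by
    have : x = (‖x‖ / r) • y := by
      rw [hydef, smul_smul]
      have : ‖x‖ / r * (r / ‖x‖) = 1 := by field_simp
      rw [this, one_smul]
    nth_rewrite 1 [this]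
    module
  rw [e, inner_add_left, real_inner_smul_left, real_inner_self_eq_norm_sq] at h1
  have h2 : 0 ≤ ⟪y, y - p⟫ := by
    rw [inner_sub_right, real_inner_self_eq_norm_sq, hy]
    have := real_inner_le_norm y p
    rw [hy] at this
    nlinarith
  have h3 : 0 ≤ ‖x‖ / r - 1 := by rw [sub_nonneg, le_div_iff₀ hr]; linarith
  have h4 : ‖y - p‖ ^ 2 ≤ 0 := by nlinarith
  have h5 : y - p = 0 := by
    rw [← norm_eq_zero]
    nlinarith [norm_nonneg (y - p)]
  exact (sub_eq_zero.1 h5).symm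

end Projection

/-! ### Runs of a learner -/

section Runs

variable {σ E : Type} [NormedAddCommGroup E] [InnerProductSpace ℝ E]

/-- `A.Run G n s U l m v`: the learner `A` is in the state `s` after `n` rounds with gradients of
norm at most `G`, in which the sum of the gradients was `U`, the loss `l`, the movement `m`, and
the sum of the norms of the gradients `v`. -/
inductive Learner.Run (A : Learner σ E) (G : ℝ) : ℕ → σ → E → ℝ → ℝ → ℝ → Prop
  | start : A.Run G 0 A.start 0 0 0 0
  | step {n : ℕ} {s : σ} {U : E} {l m v : ℝ} (h : A.Run G n s U l m v) (g : E) (hg : ‖g‖ ≤ G) :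
      A.Run G (n + 1) (A.update s g) (U + g) (l + ⟪g, A.predict s⟫)
        (m + ‖A.predict s - A.predict (A.update s g)‖) (v + ‖g‖)

/-- The guarantees of a base algorithm for gradients of norm at most `G`: the predictions are
bounded by `R`; the loss and the movement with weight `lam` are at most `eps`; the regret with
respect to the elements of `K` is `O(√n)` with constant `B`, in the first `N` rounds; and the
predictions change slowly. The number of rounds is read off from the state by `rnd`. -/
structure Learner.Good (A : Learner σ E) (rnd : σ → ℕ) (K : Set E) (G lam eps R B : ℝ)
    (N : ℕ) : Prop where
  rnd_eq {n s U l m v} : A.Run G n s U l m v → rnd s = n + 1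
  norm_predict {n s U l m v} : A.Run G n s U l m v → ‖A.predict s‖ ≤ R
  zero {n s U l m v} : A.Run G n s U l m v → l + lam * m + 2 * lam * ‖A.predict s‖ ≤ eps
  regret {n s U l m v} : A.Run G n s U l m v → n ≤ N → ∀ u ∈ K, l - ⟪U, u⟫ ≤ eps + B * √(n : ℝ)
  move {n s U l m v} : A.Run G n s U l m v → ∀ g, ‖g‖ ≤ G →
    ‖A.predict s - A.predict (A.update s g)‖ ≤ 500 * R * (√((n : ℝ) + 2) - √((n : ℝ) + 1))

/-! ### The slowed-down version of a learner -/

/-- A slowed-down run is a base run on the forwarded sums plus one pending sum of norm at most θ.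
The prediction is constant while a sum accumulates, so linear losses add up exactly. Each forwarded
sum has norm above θ, hence gradients of total norm v allow at most v/θ base rounds when θ > 0. -/
theorem Learner.Run.of_slowdown {A : Learner σ E} {θ G : ℝ} (hθ : 0 ≤ θ) {N : ℕ} {s : σ × E}
    {U : E} {l m v : ℝ} (h : (slowdown A θ).Run G N s U l m v) :
    ∃ n U' l' v', A.Run (θ + G) n s.1 U' l' m v' ∧ ‖s.2‖ ≤ θ ∧ U = U' + s.2 ∧
      l = l' + ⟪s.2, A.predict s.1⟫ ∧ n ≤ N ∧ θ * n + ‖s.2‖ ≤ v := by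
  induction h with
  | start => exact ⟨0, 0, 0, 0, .start, by simpa [slowdown] using hθ, by simp [slowdown],
      by simp [slowdown], le_rfl, by simp [slowdown]⟩
  | @step N s U l m v h g hg ih =>
    obtain ⟨n, U', l', v', hr, hs, hU, hl, hn, hv⟩ := ih
    have hadd := norm_add_le s.2 g
    by_cases hc : θ < ‖s.2 + g‖
    · have e : (slowdown A θ).update s g = (A.update s.1 (s.2 + g), 0) := by
        simp [slowdown, hc]
      rw [e]
      refine ⟨n + 1, U' + (s.2 + g), _, _, hr.step (s.2 + g) (by linarith), by simpa using hθ,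
        ?_, ?_, by omega, ?_⟩
      · rw [hU]; simp only; abel
      · rw [hl, inner_add_left]
        simp [slowdown]
        ring
      · push_cast
        simp only [norm_zero]
        linarith
    · have e : (slowdown A θ).update s g = (s.1, s.2 + g) := by
        simp [slowdown, hc]
      rw [e]
      refine ⟨n, U', l', v', ?_, by simpa using hc, ?_, ?_, by omega, ?_⟩
      · simpa [slowdown] using hr
      · rw [hU]; simp only; abel
      · rw [hl, inner_add_left]
        simp [slowdown]
        ring
      · simp only
        linarith

variable {A : Learner σ E} {rnd : σ → ℕ} {K : Set E} {G lam eps R B : ℝ} {N : ℕ}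

/-- The comparator `0`: the loss and the movement, including the return to `0` at the end. -/
theorem Learner.Good.slowdown_zero (hA : A.Good rnd K (lam + G) lam eps R B N)
    (hlam : 0 ≤ lam) {n : ℕ} {s : σ × E} {U : E} {l m v : ℝ}
    (h : (slowdown A lam).Run G n s U l m v) :
    l + lam * (m + ‖(slowdown A lam).predict s‖) ≤ eps := by
  obtain ⟨n', U', l', v', hr, hs, -, hl, -⟩ := h.of_slowdown hlam
  have h1 := hA.zero hr
  have h2 := real_inner_le_norm s.2 (A.predict s.1)
  -- The pending loss and the return to 0 each cost at most λ‖p‖ for the current prediction p; this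
  -- is the reserve 2λ‖p‖ in `Learner.Good.zero`.
  have h3 : ‖s.2‖ * ‖A.predict s.1‖ ≤ lam * ‖A.predict s.1‖ := by gcongr
  have e : (slowdown A lam).predict s = A.predict s.1 := rfl
  rw [e]
  linarith

/-- The regret of the base algorithm after at most v/λ rounds, plus the pending sum of norm at most
λ paired with a vector of norm at most 2R. -/
theorem Learner.Good.slowdown_regret (hA : A.Good rnd K (lam + G) lam eps R B N)
    (hlam : 0 < lam) (hB : 0 ≤ B) {n : ℕ} {s : σ × E} {U : E} {l m v : ℝ}
    (h : (slowdown A lam).Run G n s U l m v) (hn : n ≤ N) {u : E} (hu : u ∈ K) (huR : ‖u‖ ≤ R) :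
    l - ⟪U, u⟫ ≤ eps + B * √(v / lam) + 2 * R * lam := by
  obtain ⟨n', U', l', v', hr, hs, hU, hl, hn', hv⟩ := h.of_slowdown hlam.le
  have h1 := hA.regret hr (hn'.trans hn) u hu
  have h2 := real_inner_le_norm s.2 (A.predict s.1 - u)
  have h3 : ‖A.predict s.1 - u‖ ≤ 2 * R := by
    have := norm_sub_le (A.predict s.1) u
    have := hA.norm_predict hr
    linarith
  have h4 : ‖s.2‖ * ‖A.predict s.1 - u‖ ≤ lam * (2 * R) := by gcongr
  have h5 : B * √(n' : ℝ) ≤ B * √(v / lam) := by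
    gcongr
    rw [le_div_iff₀ hlam]
    have := norm_nonneg s.2
    linarith
  rw [inner_sub_right] at h2
  rw [hU, hl, inner_add_left]
  linarith

/-- One round of the slowed-down version: the movement, and the number of rounds of the base
algorithm. -/
theorem Learner.Good.slowdown_step (hA : A.Good rnd K (lam + G) lam eps R B N)
    (hlam : 0 ≤ lam) {n : ℕ} {s : σ × E} {U : E} {l m v : ℝ}
    (h : (slowdown A lam).Run G n s U l m v) {g : E} (hg : ‖g‖ ≤ G) :
    ‖(slowdown A lam).predict s - (slowdown A lam).predict ((slowdown A lam).update s g)‖ ≤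
      500 * R * (√(rnd ((slowdown A lam).update s g).1 : ℝ) - √(rnd s.1 : ℝ)) ∧
    lam * rnd ((slowdown A lam).update s g).1 + ‖((slowdown A lam).update s g).2‖ ≤
      lam * rnd s.1 + ‖s.2‖ + ‖g‖ := by
  obtain ⟨n', U', l', v', hr, hs, -⟩ := h.of_slowdown hlam
  have hadd := norm_add_le s.2 g
  by_cases hc : lam < ‖s.2 + g‖
  · have e : (slowdown A lam).update s g = (A.update s.1 (s.2 + g), 0) := by
      simp [slowdown, hc]
    have hG : ‖s.2 + g‖ ≤ lam + G := by linarith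
    rw [e]
    simp only [hA.rnd_eq hr, hA.rnd_eq (hr.step (s.2 + g) hG), norm_zero]
    push_cast
    refine ⟨?_, by linarith⟩
    have := hA.move hr (s.2 + g) hG
    rw [show (n' : ℝ) + 1 + 1 = n' + 2 by ring]
    exact this
  · have e : (slowdown A lam).update s g = (s.1, s.2 + g) := by
      simp [slowdown, hc]
    rw [e]
    simp only [slowdown, sub_self, norm_zero, mul_zero, le_refl, true_and]
    linarith

theorem Learner.Good.slowdown_norm_le (hlam : 0 ≤ lam)
    {n : ℕ} {s : σ × E} {U : E} {l m v : ℝ} (h : (slowdown A lam).Run G n s U l m v) :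
    ‖s.2‖ ≤ lam := by
  obtain ⟨n', U', l', v', hr, hs, -⟩ := h.of_slowdown hlam
  exact hs

end Runs

/-! ### The guarantees of the one-dimensional algorithm -/

variable {lam gam eps G Rb : ℝ}

theorem BetRun.c_nonneg {n : ℕ} {s : Bettor} {U l m c : ℝ}
    (h : BetRun lam gam eps G Rb n s U l m c) : 0 ≤ c := by
  induction h with
  | start => exact le_rfl
  | step h g hg ih =>
    have := clip_nonneg Rb (Bettor.raw ‹_›)
    positivity

theorem BetRun.m_nonneg {n : ℕ} {s : Bettor} {U l m c : ℝ}
    (h : BetRun lam gam eps G Rb n s U l m c) : 0 ≤ m := by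
  induction h with
  | start => exact le_rfl
  | step h g hg ih => positivity

/-- The ledger with u = 0 leaves the final wealth unspent, and the wealth is at least 2λ times the
prediction. -/
theorem BetRun.zero (hp : BetParams lam gam eps G Rb) (hlam : 2 * lam ≤ G + lam + gam) {n : ℕ}
    {s : Bettor} {U l m c : ℝ} (h : BetRun lam gam eps G Rb n s U l m c) :
    l + lam * m + gam * c + 2 * lam * clip Rb s.raw ≤ eps := by
  have h1 := h.ledger hp (u := 0) hp.Rb_pos.le
  have hs := h.betState hp
  have h2 := hs.two_lam_raw_le hp hlam
  have h3 : 2 * lam * clip Rb s.raw ≤ 2 * lam * s.raw := by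
    have := hp.lam_nonneg
    gcongr; exact clip_le_self hs.raw_nonneg
  linarith

theorem BetRun.regret' (hp : BetParams lam gam eps G Rb) {N : ℕ} {X : ℝ} (hX : 0 ≤ X)
    (hXlog : ∀ n : ℕ, 1 ≤ n → n ≤ N → Real.log (Rb * ((G + lam + gam) * √(2 * (n : ℝ)))) -
      Real.log eps + 446 * Real.log n + 5 / 2 ≤ X) {n : ℕ} {s : Bettor} {U l m c : ℝ}
    (h : BetRun lam gam eps G Rb n s U l m c) (hn : n ≤ N) {u : ℝ} (hu : 0 ≤ u) (huR : u ≤ Rb) :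
    l - U * u ≤ eps + 2 * Rb * (G + lam + gam) * X * √(n : ℝ) := by
  have hC := hp.C_pos
  have hR := hp.Rb_pos
  rcases Nat.eq_zero_or_pos n with rfl | hn0
  · cases h
    simpa using hp.eps_pos.le
  · have h1 := h.regret hp hu huR hX hn0 (hXlog n hn0 hn)
    have h2 := mul_nonneg hp.lam_nonneg h.m_nonneg
    have h3 := mul_nonneg hp.gam_nonneg (h.c_nonneg)
    have h4 : √(2 * (n : ℝ)) ≤ 2 * √(n : ℝ) := by
      rw [Real.sqrt_le_left (by positivity), mul_pow, Real.sq_sqrt n.cast_nonneg]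
      have : (0 : ℝ) ≤ n := n.cast_nonneg
      linarith
    calc l - U * u ≤ eps + Rb * ((G + lam + gam) * √(2 * (n : ℝ))) * X := by linarith
      _ ≤ eps + Rb * ((G + lam + gam) * (2 * √(n : ℝ))) * X := by gcongr
      _ = _ := by ring

theorem real_inner_eq_mul (x y : ℝ) : ⟪x, y⟫ = x * y := by simp [mul_comm]

theorem learner1d_run {n : ℕ} {s : Bettor} {U l m v : ℝ}
    (h : (learner1d lam gam eps G Rb).Run G n s U l m v) :
    ∃ c, BetRun lam gam eps G Rb n s U l m c := by
  induction h with
  | start => exact ⟨0, .start⟩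
  | step h g hg ih =>
    obtain ⟨c, hc⟩ := ih
    rw [real_inner_eq_mul]
    exact ⟨_, hc.step g hg⟩

theorem learner1d_good (hp : BetParams lam gam eps G Rb) (hlam : 2 * lam ≤ G + lam + gam)
    (heps : eps ≤ (G + lam + gam) * Rb) {N : ℕ} {X : ℝ} (hX : 0 ≤ X)
    (hXlog : ∀ n : ℕ, 1 ≤ n → n ≤ N → Real.log (Rb * ((G + lam + gam) * √(2 * (n : ℝ)))) -
      Real.log eps + 446 * Real.log n + 5 / 2 ≤ X) :
    (learner1d lam gam eps G Rb).Good Bettor.round (Set.Icc 0 Rb) G lam eps Rb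
      (2 * Rb * (G + lam + gam) * X) N where
  rnd_eq h := by
    obtain ⟨c, hc⟩ := learner1d_run h
    exact (hc.betState hp).round_eq
  norm_predict h := by
    change ‖clip Rb _‖ ≤ Rb
    rw [Real.norm_of_nonneg (clip_nonneg _ _)]
    exact clip_le hp.Rb_pos.le _
  zero {n s U l m v} h := by
    obtain ⟨c, hc⟩ := learner1d_run h
    have h1 := hc.zero hp hlam
    have h2 := mul_nonneg hp.gam_nonneg (hc.c_nonneg)
    change l + lam * m + 2 * lam * ‖clip Rb s.raw‖ ≤ eps
    rw [Real.norm_of_nonneg (clip_nonneg _ _)]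
    linarith
  regret h hn u hu := by
    obtain ⟨c, hc⟩ := learner1d_run h
    rw [real_inner_eq_mul]
    exact hc.regret' hp hX hXlog hn hu.1 hu.2
  move {n s U l m v} h g hg := by
    obtain ⟨c, hc⟩ := learner1d_run h
    refine (hc.move_le hp heps hg).trans ?_
    have h1 : √((n : ℝ) + 1) ≤ √((n : ℝ) + 2) := Real.sqrt_le_sqrt (by linarith)
    have := hp.Rb_pos
    gcongr
    · linarith

/-! ### The guarantees of the algorithm on the ball -/

variable {d : ℕ}

theorem inner_ogd_le {η G : ℝ} (hη : 0 < η) {g z v : Eu d} (hg : ‖g‖ ≤ G)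
    (hv : ‖v‖ ≤ 1) :
    ⟪g, z - v⟫ ≤ (‖z - v‖ ^ 2 - ‖proj (Metric.closedBall 0 1) (z - η • g) - v‖ ^ 2) / (2 * η) +
      η * G ^ 2 / 2 := by
  have h1 : ‖proj (Metric.closedBall 0 1) (z - η • g) - v‖ ≤ ‖z - v - η • g‖ := by
    have := norm_proj_ball_sub_le zero_le_one (z - η • g) v
    rw [proj_ball_of_le hv] at this
    rwa [sub_right_comm] at this
  have h2 : ‖proj (Metric.closedBall 0 1) (z - η • g) - v‖ ^ 2 ≤ ‖z - v - η • g‖ ^ 2 := by gcongr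
  have h3 : ‖z - v - η • g‖ ^ 2 = ‖z - v‖ ^ 2 - 2 * η * ⟪g, z - v⟫ + η ^ 2 * ‖g‖ ^ 2 := by
    rw [norm_sub_sq_real, real_inner_smul_right, norm_smul, mul_pow, real_inner_comm,
      Real.norm_of_nonneg hη.le]
    ring
  have h4 : η ^ 2 * ‖g‖ ^ 2 ≤ η ^ 2 * G ^ 2 := by gcongr
  rw [div_add_div _ _ (by positivity) (by norm_num), le_div_iff₀ (by positivity)]
  nlinarith

/-- Magnitude and direction separate: the bettor plays against ⟨g, z⟩, whose sum is U', and gradient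
descent makes U' − ⟨U, w⟩ small for every unit direction w. The product moves by at most |y − y'| +
y‖z − z'‖ with ‖z − z'‖ ≤ 1/√t, and the second term is exactly what c records. Keeping the squared
distance in the invariant lets the changing learning rates telescope. -/
theorem learnerBall_run (hG : 0 < G) {n : ℕ} {s : Bettor × (ℕ × Eu d)} {U : Eu d} {l m v : ℝ}
    (h : (learnerBall d lam eps G Rb).Run G n s U l m v) :
    ∃ U' m' c, BetRun lam lam eps G Rb n s.1 U' l m' c ∧ s.2.1 = n + 1 ∧ ‖s.2.2‖ ≤ 1 ∧
      m ≤ m' + c ∧ ∀ w : Eu d, ‖w‖ ≤ 1 →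
        U' - ⟪U, w⟫ + G * √(n : ℝ) / 2 * ‖s.2.2 - w‖ ^ 2 ≤ 3 * G * √(n : ℝ) := by
  induction h with
  | start => exact ⟨0, 0, 0, .start, rfl, by simp [learnerBall, ogd], by simp, by simp⟩
  | @step n s U l m v h g hg ih =>
    obtain ⟨U', m', c, hr, ht, hz, hm, hU⟩ := ih
    obtain ⟨b, t, z⟩ := s
    simp only at ht hz hr hU
    subst ht
    have hgz : |⟪g, z⟫| ≤ G := by
      refine (abs_real_inner_le_norm g z).trans ?_
      calc ‖g‖ * ‖z‖ ≤ G * 1 := by gcongr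
        _ = G := mul_one G
    have hn0 : (0 : ℝ) ≤ n := n.cast_nonneg
    set r := √((n : ℝ) + 1) with hrdef
    set q := √(n : ℝ) with hqdef
    have hr2 : r ^ 2 = n + 1 := Real.sq_sqrt (by linarith)
    have hq2 : q ^ 2 = n := Real.sq_sqrt hn0
    have hr1 : 1 ≤ r := Real.one_le_sqrt.2 (by linarith)
    have hqr : q ≤ r := Real.sqrt_le_sqrt (by linarith)
    have hq0 : 0 ≤ q := Real.sqrt_nonneg _
    set η := 1 / (G * r) with hη
    have hη0 : 0 < η := by positivity
    set z' := proj (Metric.closedBall 0 1) (z - η • g) with hz'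
    have hz'1 : ‖z'‖ ≤ 1 := norm_proj_ball_le zero_le_one _
    have eu : (learnerBall d lam eps G Rb).update (b, n + 1, z) g =
        (b.next lam lam G Rb ⟪g, z⟫, n + 1 + 1, z') := by
      simp only [learnerBall, learner1d, ogd, hz', hη, hrdef]
      push_cast
      rfl
    have ep : (learnerBall d lam eps G Rb).predict (b, n + 1, z) = clip Rb b.raw • z := rfl
    have ep' : (learnerBall d lam eps G Rb).predict
        (b.next lam lam G Rb ⟪g, z⟫, n + 1 + 1, z') =
        clip Rb (b.next lam lam G Rb ⟪g, z⟫).raw • z' := rfl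
    rw [eu, ep, ep', real_inner_smul_right, mul_comm (clip Rb b.raw) ⟪g, z⟫]
    refine ⟨_, _, _, hr.step ⟪g, z⟫ hgz, rfl, hz'1, ?_, ?_⟩
    · set y := clip Rb b.raw
      set y' := clip Rb (b.next lam lam G Rb ⟪g, z⟫).raw
      have hy : 0 ≤ y := clip_nonneg _ _
      have h1 : ‖y • z - y' • z'‖ ≤ y * ‖z - z'‖ + |y - y'| * ‖z'‖ := by
        have e : y • z - y' • z' = y • (z - z') + (y - y') • z' := by module
        rw [e]
        refine (norm_add_le _ _).trans ?_
        rw [norm_smul, norm_smul, Real.norm_of_nonneg hy, Real.norm_eq_abs]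
      have h2 : ‖z - z'‖ ≤ 1 / r := by
        have h3 := norm_proj_ball_sub_le zero_le_one z (z - η • g)
        rw [proj_ball_of_le hz, ← hz', sub_sub_cancel, norm_smul,
          Real.norm_of_nonneg hη0.le] at h3
        calc ‖z - z'‖ ≤ η * ‖g‖ := h3
          _ ≤ η * G := by gcongr
          _ = 1 / r := by rw [hη]; field_simp
      have h4 : y * ‖z - z'‖ ≤ y / r := by
        rw [div_eq_mul_one_div]; gcongr
      have h5 : |y - y'| * ‖z'‖ ≤ |y - y'| * 1 := by gcongr
      linarith
    · intro w hw
      have h1 := inner_ogd_le (z := z) hη0 hg hw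
      rw [← hz'] at h1
      have h2 := hU w hw
      have hD : ‖z - w‖ ^ 2 ≤ 4 := by
        have : ‖z - w‖ ≤ 2 := (norm_sub_le z w).trans (by linarith)
        nlinarith [norm_nonneg (z - w)]
      have e1 : (‖z - w‖ ^ 2 - ‖z' - w‖ ^ 2) / (2 * η) =
          G * r / 2 * (‖z - w‖ ^ 2 - ‖z' - w‖ ^ 2) := by rw [hη]; field_simp
      have e2 : η * G ^ 2 / 2 = G * (1 / (2 * r)) := by rw [hη]; field_simp
      rw [e1, e2, inner_sub_right] at h1
      -- Both error terms are multiples of r − q: the gradient term is at most G(r − q), the change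
      -- of the learning rate at most 2G(r − q). Hence the constant 3.
      have h3 : 1 / (2 * r) ≤ r - q := by
        rw [div_le_iff₀ (by positivity)]; nlinarith
      have h4 : G * (1 / (2 * r)) ≤ G * (r - q) := by gcongr
      have h5 : G * (r - q) * ‖z - w‖ ^ 2 ≤ G * (r - q) * 4 := by
        have : 0 ≤ r - q := by linarith
        gcongr
      rw [inner_add_left]
      push_cast
      rw [← hrdef]
      linarith

theorem learnerBall_good (hp : BetParams lam lam eps G Rb)
    (heps : eps ≤ (G + lam + lam) * Rb) {N : ℕ} {X : ℝ} (hX : 0 ≤ X)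
    (hXlog : ∀ n : ℕ, 1 ≤ n → n ≤ N → Real.log (Rb * ((G + lam + lam) * √(2 * (n : ℝ)))) -
      Real.log eps + 446 * Real.log n + 5 / 2 ≤ X) :
    (learnerBall d lam eps G Rb).Good (fun s => s.1.round) (Metric.closedBall 0 Rb) G lam eps Rb
      (2 * Rb * (G + lam + lam) * X + 3 * Rb * G) N where
  rnd_eq h := by
    obtain ⟨U', m', c, hr, -⟩ := learnerBall_run hp.G_pos h
    exact (hr.betState hp).round_eq
  norm_predict {n s U l m v} h := by
    obtain ⟨U', m', c, hr, ht, hz, -⟩ := learnerBall_run hp.G_pos h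
    change ‖clip Rb s.1.raw • s.2.2‖ ≤ Rb
    rw [norm_smul, Real.norm_of_nonneg (clip_nonneg _ _)]
    have := clip_le hp.Rb_pos.le s.1.raw
    have := clip_nonneg Rb s.1.raw
    nlinarith
  zero {n s U l m v} h := by
    obtain ⟨U', m', c, hr, ht, hz, hm, -⟩ := learnerBall_run hp.G_pos h
    have hG := hp.G_pos
    have hl := hp.lam_nonneg
    have h1 := hr.zero hp (by linarith)
    change l + lam * m + 2 * lam * ‖clip Rb s.1.raw • s.2.2‖ ≤ eps
    rw [norm_smul, Real.norm_of_nonneg (clip_nonneg _ _)]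
    have h2 := clip_nonneg Rb s.1.raw
    have h3 : 2 * lam * (clip Rb s.1.raw * ‖s.2.2‖) ≤ 2 * lam * (clip Rb s.1.raw * 1) := by
      gcongr
    have h4 : lam * m ≤ lam * (m' + c) := by gcongr
    linarith
  regret {n s U l m v} h hn u hu := by
    obtain ⟨U', m', c, hr, ht, hz, hm, hU⟩ := learnerBall_run hp.G_pos h
    have hu' : ‖u‖ ≤ Rb := by simpa using hu
    have h1 := hr.regret' hp hX hXlog hn (norm_nonneg u) hu'
    -- For u = 0 the direction is 0, because 1/0 = 0; it still lies in the unit ball.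
    have hw : ‖(1 / ‖u‖) • u‖ ≤ 1 := by
      rw [norm_smul, Real.norm_of_nonneg (by positivity), one_div]
      exact inv_mul_le_one
    have h2 := hU _ hw
    have hG := hp.G_pos
    have h3 : 0 ≤ G * √(n : ℝ) / 2 * ‖s.2.2 - (1 / ‖u‖) • u‖ ^ 2 := by positivity
    have e : ‖u‖ * ⟪U, (1 / ‖u‖) • u⟫ = ⟪U, u⟫ := by
      rw [real_inner_smul_right, ← mul_assoc]
      rcases eq_or_ne u 0 with rfl | h0
      · simp
      · rw [mul_one_div_cancel (norm_ne_zero_iff.2 h0), one_mul]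
    have h4 : ‖u‖ * (U' - ⟪U, (1 / ‖u‖) • u⟫) ≤ ‖u‖ * (3 * G * √(n : ℝ)) := by
      gcongr; linarith
    have h5 : ‖u‖ * (3 * G * √(n : ℝ)) ≤ Rb * (3 * G * √(n : ℝ)) := by gcongr
    rw [mul_sub, e] at h4
    linarith
  move {n s U l m v} h g hg := by
    obtain ⟨U', m', c, hr, ht, hz, hm, -⟩ := learnerBall_run hp.G_pos h
    obtain ⟨b, t, z⟩ := s
    simp only at ht hz hr
    subst ht
    have hG := hp.G_pos
    have hR := hp.Rb_pos
    have hgz : |⟪g, z⟫| ≤ G := by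
      refine (abs_real_inner_le_norm g z).trans ?_
      calc ‖g‖ * ‖z‖ ≤ G * 1 := by gcongr
        _ = G := mul_one G
    have h0 := hr.move_le hp heps hgz
    set r := √((n : ℝ) + 1) with hrdef
    have hr1 : 1 ≤ r := Real.one_le_sqrt.2 (by linarith [(n.cast_nonneg : (0 : ℝ) ≤ n)])
    set η := 1 / (G * r) with hη
    have hη0 : 0 < η := by positivity
    set z' := proj (Metric.closedBall 0 1) (z - η • g) with hz'
    have hz'1 : ‖z'‖ ≤ 1 := norm_proj_ball_le zero_le_one _
    have eu : (learnerBall d lam eps G Rb).predict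
          ((learnerBall d lam eps G Rb).update (b, n + 1, z) g) =
        clip Rb (b.next lam lam G Rb ⟪g, z⟫).raw • z' := by
      simp only [learnerBall, learner1d, ogd, hz', hη, hrdef]
      push_cast
      rfl
    have ep : (learnerBall d lam eps G Rb).predict (b, n + 1, z) = clip Rb b.raw • z := rfl
    rw [eu, ep]
    set y := clip Rb b.raw with hydef
    set y' := clip Rb (b.next lam lam G Rb ⟪g, z⟫).raw
    have hy : 0 ≤ y := clip_nonneg _ _
    have hyR : y ≤ Rb := clip_le hR.le _
    have h1 : ‖y • z - y' • z'‖ ≤ y * ‖z - z'‖ + |y - y'| * ‖z'‖ := by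
      have e : y • z - y' • z' = y • (z - z') + (y - y') • z' := by module
      rw [e]
      refine (norm_add_le _ _).trans ?_
      rw [norm_smul, norm_smul, Real.norm_of_nonneg hy, Real.norm_eq_abs]
    have h2 : ‖z - z'‖ ≤ 1 / r := by
      have h3 := norm_proj_ball_sub_le zero_le_one z (z - η • g)
      rw [proj_ball_of_le hz, ← hz', sub_sub_cancel, norm_smul,
        Real.norm_of_nonneg hη0.le] at h3
      calc ‖z - z'‖ ≤ η * ‖g‖ := h3
        _ ≤ η * G := by gcongr
        _ = 1 / r := by rw [hη]; field_simp
    have h4 : y * ‖z - z'‖ ≤ Rb * (1 / r) := by gcongr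
    have h5 : |y - y'| * ‖z'‖ ≤ |y - y'| * 1 := by gcongr
    have hd := one_div_sqrt_le_sqrt_sub (x := (n : ℝ) + 1)
      (by linarith [(n.cast_nonneg : (0 : ℝ) ≤ n)])
    rw [show (n : ℝ) + 1 + 1 = n + 2 by ring, ← hrdef] at hd
    -- The direction adds 3R to the 480R of the magnitude, within 500R.
    have h6 : Rb * (1 / r) ≤ Rb * (3 * (√((n : ℝ) + 2) - r)) := by gcongr
    have h7 : 0 ≤ Rb * (√((n : ℝ) + 2) - r) := by
      have : r ≤ √((n : ℝ) + 2) := Real.sqrt_le_sqrt (by linarith)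
      exact mul_nonneg hR.le (by linarith)
    linarith

end OCOM

/-! ### Subroutines on sequences, surrogate gradients, dyadic sums -/

namespace OCOM

theorem sqrt_add_le (x y : ℝ) : √(x + y) ≤ √x + √y := by
  rcases le_total x 0 with hx | hx
  · rw [Real.sqrt_eq_zero_of_nonpos hx, zero_add]
    exact Real.sqrt_le_sqrt (by linarith)
  rcases le_total y 0 with hy | hy
  · rw [Real.sqrt_eq_zero_of_nonpos hy, add_zero]
    exact Real.sqrt_le_sqrt (by linarith)
  rw [Real.sqrt_le_left (by positivity), add_sq, Real.sq_sqrt hx, Real.sq_sqrt hy]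
  have : 0 ≤ √x * √y := by positivity
  linarith

/-! ### Runs of a slowed-down learner on a sequence of gradients -/

section Sequences

variable {σ E : Type} [NormedAddCommGroup E] [InnerProductSpace ℝ E]

theorem Learner.run_of_seq {A : Learner σ E} {G : ℝ} {n : ℕ} {S : ℕ → σ} {γ : ℕ → E}
    (h0 : S 0 = A.start) (hS : ∀ r < n, S (r + 1) = A.update (S r) (γ r))
    (hγ : ∀ r < n, ‖γ r‖ ≤ G) :
    A.Run G n (S n) (∑ r ∈ Finset.range n, γ r)
      (∑ r ∈ Finset.range n, ⟪γ r, A.predict (S r)⟫)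
      (∑ r ∈ Finset.range n, ‖A.predict (S r) - A.predict (S (r + 1))‖)
      (∑ r ∈ Finset.range n, ‖γ r‖) := by
  induction n with
  | zero => simpa [h0] using Learner.Run.start (A := A) (G := G)
  | succ n ih =>
    have h := ih (fun r hr => hS r (by omega)) (fun r hr => hγ r (by omega))
    have h' := h.step (γ n) (hγ n (by omega))
    simp only [Finset.sum_range_succ, hS n (by omega)]
    exact h'

variable {A : Learner σ E} {rnd : σ → ℕ} {K : Set E} {G lam eps R B : ℝ} {N : ℕ}

/-- The comparator `0`: `p` is the sequence of the predictions, with a return to `0`. -/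
theorem Learner.Good.seq_zero (hA : A.Good rnd K (lam + G) lam eps R B N) (hlam : 0 ≤ lam)
    {n : ℕ} {S : ℕ → σ × E} {γ p : ℕ → E} (hn : 1 ≤ n)
    (h0 : S 0 = (slowdown A lam).start)
    (hS : ∀ r < n, S (r + 1) = (slowdown A lam).update (S r) (γ r))
    (hγ : ∀ r < n, ‖γ r‖ ≤ G) (hp : ∀ r < n, p r = (slowdown A lam).predict (S r))
    (hpn : p n = 0) :
    ∑ r ∈ Finset.range n, (⟪γ r, p r⟫ + lam * ‖p r - p (r + 1)‖) ≤ eps := by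
  have h := hA.slowdown_zero hlam (Learner.run_of_seq h0 hS hγ)
  refine le_trans ?_ h
  rw [Finset.sum_add_distrib, ← Finset.mul_sum]
  have h1 : ∑ r ∈ Finset.range n, ⟪γ r, p r⟫ =
      ∑ r ∈ Finset.range n, ⟪γ r, (slowdown A lam).predict (S r)⟫ :=
    Finset.sum_congr rfl fun r hr => by rw [hp r (Finset.mem_range.1 hr)]
  rw [h1]
  gcongr
  -- The last move goes to 0 instead of the next prediction; by the triangle inequality it is at
  -- most the move to that prediction plus its norm.
  obtain ⟨m, rfl⟩ : ∃ m, n = m + 1 := ⟨n - 1, by omega⟩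
  rw [Finset.sum_range_succ, Finset.sum_range_succ, add_assoc]
  refine add_le_add (le_of_eq (Finset.sum_congr rfl fun r hr => ?_)) ?_
  · have := Finset.mem_range.1 hr
    rw [hp r (by omega), hp (r + 1) (by omega)]
  · rw [hpn, hp m (by omega), sub_zero]
    have := norm_add_le ((slowdown A lam).predict (S m) - (slowdown A lam).predict (S (m + 1)))
      ((slowdown A lam).predict (S (m + 1)))
    simpa using this

theorem Learner.Good.seq_regret (hA : A.Good rnd K (lam + G) lam eps R B N) (hlam : 0 < lam)
    (hB : 0 ≤ B) {n : ℕ} {S : ℕ → σ × E} {γ p : ℕ → E} (hn : n ≤ N)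
    (h0 : S 0 = (slowdown A lam).start)
    (hS : ∀ r < n, S (r + 1) = (slowdown A lam).update (S r) (γ r))
    (hγ : ∀ r < n, ‖γ r‖ ≤ G) (hp : ∀ r < n, p r = (slowdown A lam).predict (S r))
    {u : E} (hu : u ∈ K) (huR : ‖u‖ ≤ R) :
    ∑ r ∈ Finset.range n, ⟪γ r, p r - u⟫ ≤
      eps + B * √((∑ r ∈ Finset.range n, ‖γ r‖) / lam) + 2 * R * lam := by
  have h := hA.slowdown_regret hlam hB (Learner.run_of_seq h0 hS hγ) hn hu huR
  refine le_trans (le_of_eq ?_) h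
  rw [sum_inner, ← Finset.sum_sub_distrib]
  refine Finset.sum_congr rfl fun r hr => ?_
  rw [hp r (Finset.mem_range.1 hr), inner_sub_right]

/-- The movement between two rounds, from an arbitrary reachable state. -/
theorem Learner.Good.seq_move (hA : A.Good rnd K (lam + G) lam eps R B N) (hlam : 0 < lam)
    (hR : 0 ≤ R) {n : ℕ} {S : ℕ → σ × E} {γ : ℕ → E}
    (h0 : ∃ k U l m v, (slowdown A lam).Run G k (S 0) U l m v)
    (hS : ∀ r < n, S (r + 1) = (slowdown A lam).update (S r) (γ r))
    (hγ : ∀ r < n, ‖γ r‖ ≤ G) :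
    ∑ r ∈ Finset.range n,
        ‖(slowdown A lam).predict (S r) - (slowdown A lam).predict (S (r + 1))‖ ≤
      500 * R * √(1 + (∑ r ∈ Finset.range n, ‖γ r‖) / lam) := by
  -- The movement telescopes in the square root of the base round, while λ times that round plus the
  -- pending norm grows at most by the norms of the gradients.
  have key : ∀ q ≤ n, (∃ k U l m v, (slowdown A lam).Run G k (S q) U l m v) ∧
      ∑ r ∈ Finset.range q,
        ‖(slowdown A lam).predict (S r) - (slowdown A lam).predict (S (r + 1))‖ ≤
        500 * R * (√(rnd (S q).1 : ℝ) - √(rnd (S 0).1 : ℝ)) ∧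
      lam * rnd (S q).1 + ‖(S q).2‖ ≤
        lam * rnd (S 0).1 + ‖(S 0).2‖ + ∑ r ∈ Finset.range q, ‖γ r‖ := by
    intro q hq
    induction q with
    | zero => exact ⟨h0, by simp, by simp⟩
    | succ q ih =>
      obtain ⟨⟨k, U, l, m, v, hrun⟩, h1, h2⟩ := ih (by omega)
      have h3 := hA.slowdown_step hlam.le hrun (hγ q (by omega))
      rw [← hS q (by omega)] at h3
      have hnew := hrun.step (γ q) (hγ q (by omega))
      rw [← hS q (by omega)] at hnew
      refine ⟨⟨_, _, _, _, _, hnew⟩, ?_, ?_⟩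
      · rw [Finset.sum_range_succ]; linarith [h3.1]
      · rw [Finset.sum_range_succ]; linarith [h3.2]
  obtain ⟨-, h1, h2⟩ := key n le_rfl
  refine h1.trans ?_
  have h3 : ‖(S 0).2‖ ≤ lam := by
    obtain ⟨k, U, l, m, v, hrun⟩ := h0
    exact Learner.Good.slowdown_norm_le hlam.le hrun
  gcongr
  rw [sub_le_iff_le_add, add_comm]
  refine le_trans ?_ (sqrt_add_le _ _)
  apply Real.sqrt_le_sqrt
  have h4 := norm_nonneg (S n).2
  -- The 1 accounts for the pending sum at the start, of norm at most λ: it can trigger one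
  -- additional base round.
  have h5 : lam * (rnd (S n).1 : ℝ) ≤
      lam * (rnd (S 0).1 + (1 + (∑ r ∈ Finset.range n, ‖γ r‖) / lam)) := by
    rw [mul_add, mul_add, mul_div_cancel₀ _ hlam.ne']
    linarith
  exact le_of_mul_le_mul_left h5 hlam

end Sequences

/-! ### Surrogate gradients -/

section Surrogate

variable {d : ℕ}

theorem norm_add_le_of_pos {a p : Eu d} (ha : 0 < ‖a‖) :
    ‖a + p‖ ≤ ‖a‖ + (⟪a, p⟫ + ‖p‖ ^ 2 / 2) / ‖a‖ := by
  have h : ‖a + p‖ ^ 2 = ‖a‖ ^ 2 + 2 * ⟪a, p⟫ + ‖p‖ ^ 2 := norm_add_sq_real a p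
  have h2 : 2 * ‖a‖ * ‖a + p‖ ≤ ‖a‖ ^ 2 + ‖a + p‖ ^ 2 := by
    nlinarith [sq_nonneg (‖a‖ - ‖a + p‖)]
  rw [← sub_le_iff_le_add', le_div_iff₀ ha]
  nlinarith

/-- A linear form below a quadratic one has derivative 0 at the origin. This identifies a
subgradient as soon as the function lies below a smooth one that touches it at the point. -/
theorem eq_zero_of_inner_le_sq {q : Eu d} {c : ℝ} (h : ∀ p : Eu d, ⟪q, p⟫ ≤ c * ‖p‖ ^ 2) :
    q = 0 := by
  by_contra hq
  have hq0 : 0 < ‖q‖ ^ 2 := by positivity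
  have h1 := h ((1 / (2 * (|c| + 1))) • q)
  rw [real_inner_smul_right, real_inner_self_eq_norm_sq, norm_smul, mul_pow,
    Real.norm_of_nonneg (by positivity)] at h1
  set s := 1 / (2 * (|c| + 1)) with hs
  have hs0 : 0 < s := by positivity
  have h2 : s * (|c| + 1) = 1 / 2 := by rw [hs]; field_simp
  have h3 : c * (s ^ 2 * ‖q‖ ^ 2) ≤ (|c| + 1) * (s ^ 2 * ‖q‖ ^ 2) := by
    gcongr; linarith [le_abs_self c]
  have h4 : (|c| + 1) * (s ^ 2 * ‖q‖ ^ 2) = 1 / 2 * (s * ‖q‖ ^ 2) := by rw [← h2]; ring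
  have : 0 < s * ‖q‖ ^ 2 := by positivity
  linarith

/-- The properties of the subgradients of the surrogate loss at the unprojected prediction. -/
theorem surrogate_subgradient {V : Set (Eu d)} (hc : IsClosed V) (hn : V.Nonempty) {g y gs : Eu d}
    (h : IsSubgradientOn Set.univ (surrogate V g (proj V y) y) y gs) :
    ‖gs‖ ≤ ‖g‖ ∧ ∀ u ∈ V, ⟪g, proj V y - u⟫ ≤ ⟪gs, y - u⟫ := by
  have hsub := fun z => h.2 z (Set.mem_univ z)
  set x := proj V y with hx
  by_cases hcase : ⟪g, x⟫ ≤ ⟪g, y⟫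
  · have hs : ∀ u, surrogate V g x y u = ⟪g, u⟫ := fun u => by simp [surrogate, hcase]
    simp only [hs] at hsub
    have hgs : gs = g := by
      have : gs - g = 0 := by
        refine eq_zero_of_inner_le_sq (c := 0) fun p => ?_
        have := hsub (y + p)
        rw [add_sub_cancel_left, inner_add_right] at this
        rw [inner_sub_left]
        linarith
      exact sub_eq_zero.1 this
    rw [hgs]
    refine ⟨le_rfl, fun u _ => ?_⟩
    rw [inner_sub_right, inner_sub_right]
    linarith
  · have hs : ∀ u, surrogate V g x y u =
        ⟪g, u⟫ + ⟪g, x - y⟫ * (‖u - proj V u‖ / ‖x - y‖) := fun u => by simp [surrogate, hcase]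
    simp only [hs] at hsub
    push Not at hcase
    set c := ⟪g, x - y⟫ with hcdef
    have hc0 : 0 < c := by rw [hcdef, inner_sub_right]; linarith
    have hD : 0 < ‖y - x‖ := by
      rw [norm_pos_iff]
      intro h0
      have : x - y = 0 := by rw [← neg_sub, h0, neg_zero]
      rw [hcdef, this, inner_zero_right] at hc0
      exact lt_irrefl _ hc0
    have hxV : x ∈ V := proj_mem hc hn y
    have hyy : ‖y - proj V y‖ / ‖x - y‖ = 1 := by
      rw [← hx, norm_sub_rev x y, div_self hD.ne']
    constructor
    -- Replacing the distance from u to V by ‖u − x‖ gives a function that majorizes the surrogate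
    -- loss, agrees with it at y and is smooth there. Every subgradient at y is therefore the
    -- gradient of that function.
    · have hgs : gs = g + (c / ‖y - x‖ ^ 2) • (y - x) := by
        have : gs - (g + (c / ‖y - x‖ ^ 2) • (y - x)) = 0 := by
          refine eq_zero_of_inner_le_sq (c := c / ‖y - x‖ ^ 2 / 2) fun p => ?_
          have h1 := hsub (y + p)
          rw [add_sub_cancel_left, hyy, inner_add_right, norm_sub_rev x y] at h1
          have h2 : ‖y + p - proj V (y + p)‖ ≤ ‖y - x + p‖ := by
            have := (proj_isProj hc hn (y + p)).2 x hxV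
            rwa [show y + p - x = y - x + p by abel] at this
          have h3 := h2.trans (norm_add_le_of_pos hD)
          have h4 : c * (‖y + p - proj V (y + p)‖ / ‖y - x‖) ≤
              c * ((‖y - x‖ + (⟪y - x, p⟫ + ‖p‖ ^ 2 / 2) / ‖y - x‖) / ‖y - x‖) := by gcongr
          have e : c * ((‖y - x‖ + (⟪y - x, p⟫ + ‖p‖ ^ 2 / 2) / ‖y - x‖) / ‖y - x‖) =
              c + c / ‖y - x‖ ^ 2 * ⟪y - x, p⟫ + c / ‖y - x‖ ^ 2 / 2 * ‖p‖ ^ 2 := by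
            field_simp
            ring
          rw [inner_sub_left, inner_add_left, real_inner_smul_left]
          linarith
        exact sub_eq_zero.1 this
      have hcn : ⟪g, y - x⟫ = -c := by rw [hcdef, ← inner_neg_right, neg_sub]
      -- `gs` is g without its component along y − x.
      have hsq : ‖gs‖ ^ 2 = ‖g‖ ^ 2 - c ^ 2 / ‖y - x‖ ^ 2 := by
        rw [hgs, norm_add_sq_real, real_inner_smul_right, hcn, norm_smul, mul_pow,
          Real.norm_of_nonneg (by positivity)]
        field_simp
        ring
      have : 0 ≤ c ^ 2 / ‖y - x‖ ^ 2 := by positivity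
      exact abs_le_of_sq_le_sq' (by linarith) (norm_nonneg g) |>.2
    · intro u hu
      have h1 := hsub u
      rw [proj_of_mem hc hu, sub_self, norm_zero, zero_div, mul_zero, add_zero, hyy] at h1
      have e : ⟪gs, y - u⟫ = -⟪gs, u - y⟫ := by rw [← inner_neg_right, neg_sub]
      rw [e, inner_sub_right g x u]
      rw [hcdef, inner_sub_right] at h1
      linarith

/-- The gradient transformation that corresponds to the projection to a ball. -/
theorem ballSurrogate {R : ℝ} (hR : 0 < R) (g y : Eu d) :
    let x := proj (Metric.closedBall 0 R) y
    let e := (1 / ‖y‖) • y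
    let g' := if ⟪g, x⟫ ≤ ⟪g, y⟫ then g else g - ⟪g, e⟫ • e
    ‖g'‖ ≤ ‖g‖ ∧ ∀ u : Eu d, ‖u‖ ≤ R → ⟪g, x - u⟫ ≤ ⟪g', y - u⟫ := by
  intro x e g'
  by_cases hcase : ⟪g, x⟫ ≤ ⟪g, y⟫
  · have hg' : g' = g := by simp [g', hcase]
    rw [hg']
    refine ⟨le_rfl, fun u _ => ?_⟩
    rw [inner_sub_right, inner_sub_right]
    linarith
  · have hg' : g' = g - ⟪g, e⟫ • e := by simp [g', hcase]
    push Not at hcase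
    have hyR : R < ‖y‖ := by
      by_contra h
      push Not at h
      have : x = y := proj_ball_of_le h
      rw [this] at hcase
      exact lt_irrefl _ hcase
    have hy0 : 0 < ‖y‖ := hR.trans hyR
    have he : ‖e‖ = 1 := by
      simp only [e]
      rw [norm_smul, Real.norm_of_nonneg (by positivity)]; field_simp
    have hye : y = ‖y‖ • e := by
      simp only [e]
      rw [smul_smul, mul_one_div_cancel hy0.ne', one_smul]
    have hxe : x = R • e := by
      simp only [x, e]
      rw [proj_ball_of_ge hR hyR.le, smul_smul]
      congr 1
      ring
    have hge : ⟪g, e⟫ < 0 := by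
      rw [hxe, real_inner_smul_right] at hcase
      nth_rewrite 1 [hye] at hcase
      rw [real_inner_smul_right] at hcase
      nlinarith
    have hsq : ‖g'‖ ^ 2 = ‖g‖ ^ 2 - ⟪g, e⟫ ^ 2 := by
      rw [hg', norm_sub_sq_real, real_inner_smul_right, norm_smul, he, mul_one,
        Real.norm_eq_abs, sq_abs]
      ring
    refine ⟨abs_le_of_sq_le_sq' (by nlinarith [sq_nonneg ⟪g, e⟫]) (norm_nonneg g) |>.2, ?_⟩
    intro u hu
    -- The component along y has been removed, so only −⟨g', u⟩ remains; the claim becomes ⟨g,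
    -- e⟩(⟨e, u⟩ − R) ≥ 0, a product of two nonpositive factors.
    have h1 : ⟪g', y⟫ = 0 := by
      rw [hye, hg', real_inner_smul_right, inner_sub_left, real_inner_smul_left,
        real_inner_self_eq_norm_sq, he]
      ring
    have h2 : ⟪e, u⟫ ≤ R := by
      refine (real_inner_le_norm e u).trans ?_
      rw [he, one_mul]; exact hu
    rw [inner_sub_right, inner_sub_right, h1, hxe, hg', inner_sub_left, real_inner_smul_left,
      real_inner_smul_right]
    nlinarith

end Surrogate

/-! ### Sums over dyadic intervals -/

theorem sum_range_two_pow_succ (f : ℕ → ℝ) (k i : ℕ) :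
    ∑ r ∈ Finset.range (2 ^ (k + 1)), f (2 ^ (k + 1) * i + r) =
      ∑ r ∈ Finset.range (2 ^ k), f (2 ^ k * (2 * i) + r) +
        ∑ r ∈ Finset.range (2 ^ k), f (2 ^ k * (2 * i + 1) + r) := by
  rw [pow_succ, mul_two, Finset.sum_range_add]
  congr 1 <;> refine Finset.sum_congr rfl fun r _ => ?_ <;> congr 1 <;> ring

/-- A bound on all dyadic intervals of one length gives bounds on the longer ones. -/
theorem sum_dyadic_le {f : ℕ → ℝ} {B : ℝ} {j M : ℕ}
    (h : ∀ i, 1 ≤ i → 2 ^ j * (i + 1) ≤ M →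
      ∑ r ∈ Finset.range (2 ^ j), f (2 ^ j * i + r) ≤ 2 ^ j * B) {k : ℕ} (hk : j ≤ k) :
    ∀ i, 1 ≤ i → 2 ^ k * (i + 1) ≤ M →
      ∑ r ∈ Finset.range (2 ^ k), f (2 ^ k * i + r) ≤ 2 ^ k * B := by
  induction k, hk using Nat.le_induction with
  | base => exact h
  | succ k hk ih =>
    intro i hi hM
    rw [sum_range_two_pow_succ]
    have e : 2 ^ (k + 1) * (i + 1) = 2 ^ k * (2 * i + 1 + 1) := by ring
    rw [e] at hM
    have h1 := ih (2 * i) (by omega) (le_trans (Nat.mul_le_mul_left _ (by omega)) hM)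
    have h2 := ih (2 * i + 1) (by omega) hM
    have e2 : (2 : ℝ) ^ (k + 1) * B = 2 ^ k * B + 2 ^ k * B := by ring
    rw [e2]
    exact add_le_add h1 h2

/-- An interval is covered by logarithmically many dyadic intervals: at every scale, at most one is
removed at each end. -/
theorem sum_Ico_le_of_dyadic {f : ℕ → ℝ} {B : ℝ} (hB : 0 ≤ B) {a b : ℕ}
    (h : ∀ k i, 1 ≤ i → a ≤ 2 ^ k * i → 2 ^ k * (i + 1) ≤ b →
      ∑ t ∈ Finset.Ico (2 ^ k * i) (2 ^ k * (i + 1)), f t ≤ B) (m : ℕ) :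
    ∀ k i j, 1 ≤ i → i ≤ j → j ≤ 2 ^ m → a ≤ 2 ^ k * i → 2 ^ k * j ≤ b →
      ∑ t ∈ Finset.Ico (2 ^ k * i) (2 ^ k * j), f t ≤ 2 * m * B := by
  induction m with
  | zero =>
    intro k i j hi hij hj _ _
    have : i = j := by simp at hj; omega
    simp [this]
  | succ m ih =>
    intro k i j hi hij hj ha hb
    rcases hij.eq_or_lt with rfl | hlt
    · simp; positivity
    have hpk : 0 < 2 ^ k := by positivity
    -- Round i up and j down to even numbers: at most one interval is cut off at each end, and the
    -- rest is an interval at the next scale with half as many pieces.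
    obtain ⟨i', hi'⟩ : ∃ i', i = 2 * i' ∨ i + 1 = 2 * i' :=
      ⟨(i + 1) / 2, by omega⟩
    obtain ⟨j', hj'⟩ : ∃ j', j = 2 * j' ∨ j = 2 * j' + 1 := ⟨j / 2, by omega⟩
    have hij' : i' ≤ j' := by omega
    have hmid := ih (k + 1) i' j' (by omega) hij' (by rw [pow_succ] at hj; omega)
      (by rw [pow_succ, mul_assoc]; exact ha.trans (Nat.mul_le_mul_left _ (by omega)))
      (by rw [pow_succ, mul_assoc]; exact (Nat.mul_le_mul_left _ (by omega)).trans hb)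
    rw [pow_succ, mul_assoc, mul_assoc] at hmid
    have hleft : ∑ t ∈ Finset.Ico (2 ^ k * i) (2 ^ k * (2 * i')), f t ≤ B := by
      rcases hi' with h1 | h1
      · rw [← h1]; simpa using hB
      · rw [← h1]
        exact h k i hi ha ((Nat.mul_le_mul_left _ (by omega)).trans hb)
    have hright : ∑ t ∈ Finset.Ico (2 ^ k * (2 * j')) (2 ^ k * j), f t ≤ B := by
      rcases hj' with h1 | h1
      · rw [← h1]; simpa using hB
      · rw [h1]
        exact h k (2 * j') (by omega) (ha.trans (Nat.mul_le_mul_left _ (by omega)))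
          (by rw [← h1]; exact hb)
    rw [← Finset.sum_Ico_consecutive f (m := 2 ^ k * i) (n := 2 ^ k * (2 * j')) (k := 2 ^ k * j)
        (Nat.mul_le_mul_left _ (by omega)) (Nat.mul_le_mul_left _ (by omega)),
      ← Finset.sum_Ico_consecutive f (m := 2 ^ k * i) (n := 2 ^ k * (2 * i')) (k := 2 ^ k * (2 * j'))
        (Nat.mul_le_mul_left _ (by omega)) (Nat.mul_le_mul_left _ (by omega))]
    push_cast
    linarith

end OCOM

/-! ### The levels of the meta-algorithm and its subroutines -/

namespace OCOM

variable {d : ℕ}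

/-! ### The quantities of the meta-algorithm -/

/-- The memory that is used in round `t`. -/
noncomputable def Inputs.mem (P : Inputs d) (gs : ℕ → Eu d) (t : ℕ) : Memory d :=
  P.renew t (P.after gs (t - 1))

/-- The gradient that is sent to the ball subroutine at level `k` in round `t`. -/
noncomputable def Inputs.grad (P : Inputs d) (gs : ℕ → Eu d) (t k : ℕ) : Eu d :=
  P.gradLevel t (P.mem gs t) (gs t) k

/-- The gradient that is sent to the one-dimensional subroutine at level `k` in round `t`. -/
noncomputable def Inputs.lineGrad (P : Inputs d) (gs : ℕ → Eu d) (t k : ℕ) : ℝ :=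
  -⟪P.grad gs t k, P.level t (P.mem gs t) (k + 1)⟫

/-- The prediction of the ball subroutine at level `k` in round `t`. -/
noncomputable def Inputs.ballPred (P : Inputs d) (gs : ℕ → Eu d) (t k : ℕ) : Eu d :=
  (P.ballAlg k).predict (P.mem gs t k).1

/-- The prediction of the one-dimensional subroutine at level `k` in round `t`. -/
noncomputable def Inputs.linePred (P : Inputs d) (gs : ℕ → Eu d) (t k : ℕ) : ℝ :=
  (P.lineAlg k).predict (P.mem gs t k).2

/-- The loss of both subroutines at level `j` in round `t`. -/
noncomputable def Inputs.layerLoss (P : Inputs d) (gs : ℕ → Eu d) (t j : ℕ) : ℝ :=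
  ⟪P.grad gs t j, P.ballPred gs t j⟫ + P.lineGrad gs t j * P.linePred gs t j

/-- The weighted movement of both subroutines at level `j` from round `t` to round `t + 1`. -/
noncomputable def Inputs.layerMove (P : Inputs d) (gs : ℕ → Eu d) (t j : ℕ) : ℝ :=
  P.R * |P.linePred gs t j - P.linePred gs (t + 1) j| +
    ‖P.ballPred gs t j - P.ballPred gs (t + 1) j‖

theorem le_topLevel_iff {t k : ℕ} (ht : 1 ≤ t) : k ≤ topLevel t ↔ 2 ^ k ≤ t := by
  have h1 : 0 < Nat.clog 2 (t + 1) := Nat.clog_pos (by norm_num) (by omega)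
  have h2 : k < Nat.clog 2 (t + 1) ↔ 2 ^ k < t + 1 := Nat.lt_clog_iff_pow_lt (by norm_num)
  unfold topLevel
  omega

section Basic

variable {P : Inputs d} {gs : ℕ → Eu d}

theorem after_eq_feed {t : ℕ} (ht : 1 ≤ t) :
    P.after gs t = P.feed t (P.mem gs t) (gs t) := by
  obtain ⟨s, rfl⟩ : ∃ s, t = s + 1 := ⟨t - 1, by omega⟩
  rfl

theorem mem_of_dvd {t k : ℕ} (h : 2 ^ k ∣ t) : P.mem gs t k = P.fresh k := by
  simp [Inputs.mem, Inputs.renew, h]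

theorem mem_of_not_dvd {t k : ℕ} (h : ¬ 2 ^ k ∣ t) : P.mem gs t k = P.after gs (t - 1) k := by
  simp [Inputs.mem, Inputs.renew, h]

theorem after_apply {t k : ℕ} (ht : 1 ≤ t) (hk : 2 ^ k ≤ t) :
    P.after gs t k = ((P.ballAlg k).update (P.mem gs t k).1 (P.grad gs t k),
      (P.lineAlg k).update (P.mem gs t k).2 (P.lineGrad gs t k)) := by
  rw [after_eq_feed ht]
  simp only [Inputs.feed, (le_topLevel_iff ht).2 hk, if_true]
  rfl

theorem linePred_nonneg (t k : ℕ) : 0 ≤ P.linePred gs t k := clip_nonneg _ _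

theorem linePred_le_one (t k : ℕ) : P.linePred gs t k ≤ 1 := clip_le zero_le_one _

theorem ballPred_fresh {t k : ℕ} (h : 2 ^ k ∣ t) : P.ballPred gs t k = 0 := by
  rw [Inputs.ballPred, mem_of_dvd h]
  simp [Inputs.fresh, Inputs.ballAlg, subroutineBall, slowdown, learnerBall, ogd]

theorem linePred_fresh {t k : ℕ} (h : 2 ^ k ∣ t) : P.linePred gs t k = 0 := by
  rw [Inputs.linePred, mem_of_dvd h]
  simp [Inputs.fresh, Inputs.lineAlg, subroutine1d, slowdown, learner1d, Bettor.raw, clip]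

theorem rawLevel_eq {t k : ℕ} (hk : k ≤ topLevel t) :
    P.rawLevel t (P.mem gs t) k = (1 - P.linePred gs t k) • P.level t (P.mem gs t) (k + 1) +
      P.ballPred gs t k := by
  have h1 : topLevel t + 1 - k = (topLevel t + 1 - (k + 1)) + 1 := by omega
  have h2 : topLevel t - (topLevel t + 1 - (k + 1)) = k := by omega
  unfold Inputs.level
  rw [Inputs.rawLevel, h1, Inputs.combineDown, h2]
  rfl

/-- Projections are nonexpansive and 0 ≤ 1 − z ≤ 1, so a change passed down from a higher level is
not amplified; each level only adds its own movement. Both rounds are unfolded from the same top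
level K. -/
theorem norm_combineDown_sub_le (hR : 0 ≤ P.R) (K t : ℕ) (n : ℕ) :
    ‖P.combineDown K (P.mem gs t) n - P.combineDown K (P.mem gs (t + 1)) n‖ ≤
      ∑ q ∈ Finset.range n, P.layerMove gs t (K - q) := by
  induction n with
  | zero => simp [Inputs.combineDown]
  | succ n ih =>
    rw [Finset.sum_range_succ]
    simp only [Inputs.combineDown]
    set a := proj (Metric.closedBall 0 P.R) (P.combineDown K (P.mem gs t) n)
    set b := proj (Metric.closedBall 0 P.R) (P.combineDown K (P.mem gs (t + 1)) n)
    have hab : ‖a - b‖ ≤ ∑ q ∈ Finset.range n, P.layerMove gs t (K - q) :=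
      (norm_proj_ball_sub_le hR _ _).trans ih
    have ha : ‖a‖ ≤ P.R := norm_proj_ball_le hR _
    have hz0 := linePred_nonneg (P := P) (gs := gs) (t + 1) (K - n)
    have hz1 := linePred_le_one (P := P) (gs := gs) (t + 1) (K - n)
    change ‖(1 - P.linePred gs t (K - n)) • a + P.ballPred gs t (K - n) -
      ((1 - P.linePred gs (t + 1) (K - n)) • b + P.ballPred gs (t + 1) (K - n))‖ ≤ _
    have hm : P.layerMove gs t (K - n) =
        P.R * |P.linePred gs t (K - n) - P.linePred gs (t + 1) (K - n)| +
          ‖P.ballPred gs t (K - n) - P.ballPred gs (t + 1) (K - n)‖ := rfl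
    rw [hm]
    set z := P.linePred gs t (K - n)
    set z' := P.linePred gs (t + 1) (K - n)
    set w := P.ballPred gs t (K - n)
    set w' := P.ballPred gs (t + 1) (K - n)
    have e : (1 - z) • a + w - ((1 - z') • b + w') =
        (1 - z') • (a - b) + (z' - z) • a + (w - w') := by module
    rw [e]
    refine (norm_add₃_le).trans ?_
    rw [norm_smul, norm_smul, Real.norm_of_nonneg (by linarith), Real.norm_eq_abs, abs_sub_comm]
    have h1 : (1 - z') * ‖a - b‖ ≤ 1 * ‖a - b‖ := by gcongr; linarith
    have h2 : |z - z'| * ‖a‖ ≤ |z - z'| * P.R := by gcongr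
    linarith

theorem norm_rawPrediction_sub_le (hR : 0 ≤ P.R) {t : ℕ} (h : topLevel (t + 1) = topLevel t) :
    ‖P.rawLevel t (P.mem gs t) 0 - P.rawLevel (t + 1) (P.mem gs (t + 1)) 0‖ ≤
      ∑ j ∈ Finset.range (topLevel t + 1), P.layerMove gs t j := by
  unfold Inputs.rawLevel
  rw [h]
  refine (norm_combineDown_sub_le hR (topLevel t) t (topLevel t + 1 - 0)).trans (le_of_eq ?_)
  rw [← Finset.sum_range_reflect]
  refine Finset.sum_congr rfl fun q hq => ?_
  have := Finset.mem_range.1 hq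
  congr 1
  omega

theorem layerMove_nonneg (hR : 0 ≤ P.R) (t j : ℕ) : 0 ≤ P.layerMove gs t j := by
  unfold Inputs.layerMove; positivity

theorem prediction_eq {t : ℕ} (ht : 1 ≤ t) :
    P.prediction gs t = proj P.V (P.rawLevel t (P.mem gs t) 0) := by
  have : t ≠ 0 := by omega
  simp only [Inputs.prediction, this, if_false]
  rfl

theorem prediction_mem (hv : P.Valid) (t : ℕ) : P.prediction gs t ∈ P.V := by
  unfold Inputs.prediction
  split_ifs
  · exact hv.zero_mem
  · exact proj_mem hv.compact.isClosed ⟨0, hv.zero_mem⟩ _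

theorem norm_le_of_mem (hv : P.Valid) {u : Eu d} (hu : u ∈ P.V) : ‖u‖ ≤ P.R := by
  simpa using hv.subset_ball hu

theorem norm_prediction_sub_le (hv : P.Valid) {t : ℕ} (ht : 1 ≤ t)
    (h : topLevel (t + 1) = topLevel t) :
    ‖P.prediction gs t - P.prediction gs (t + 1)‖ ≤
      ∑ j ∈ Finset.range (topLevel t + 1), P.layerMove gs t j := by
  rw [prediction_eq ht, prediction_eq (by omega)]
  exact (norm_proj_sub_proj_le hv.compact.isClosed ⟨0, hv.zero_mem⟩ hv.convex _ _).trans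
    (norm_rawPrediction_sub_le hv.R_pos.le h)

theorem norm_prediction_sub_le' (hv : P.Valid) (s t : ℕ) :
    ‖P.prediction gs s - P.prediction gs t‖ ≤ 2 * P.R := by
  refine (norm_sub_le _ _).trans ?_
  have h1 := norm_le_of_mem hv (prediction_mem (gs := gs) hv s)
  have h2 := norm_le_of_mem hv (prediction_mem (gs := gs) hv t)
  linarith

end Basic

/-! ### The chain of the gradients -/

section Chain

variable {P : Inputs d} {T : ℕ} {l : ℕ → (Fin (P.H + 1) → Eu d) → ℝ} {g gs : ℕ → Eu d}

theorem IsRun.surrogate (hv : P.Valid) (hrun : P.IsRun T l g gs) {t : ℕ} (ht : 1 ≤ t)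
    (htT : t ≤ T) : ‖gs t‖ ≤ ‖g t‖ ∧ ∀ u ∈ P.V,
      ⟪g t, P.prediction gs t - u⟫ ≤ ⟪gs t, P.rawLevel t (P.mem gs t) 0 - u⟫ := by
  obtain ⟨-, -, h⟩ := hrun t (Finset.mem_Icc.2 ⟨ht, htT⟩)
  rw [prediction_eq ht] at h ⊢
  exact surrogate_subgradient hv.compact.isClosed ⟨0, hv.zero_mem⟩ h

theorem norm_grad_le (hv : P.Valid) (hrun : P.IsRun T l g gs) {t : ℕ} (ht : 1 ≤ t)
    (htT : t ≤ T) (k : ℕ) : ‖P.grad gs t k‖ ≤ ‖g t‖ := by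
  induction k with
  | zero => exact (IsRun.surrogate hv hrun ht htT).1
  | succ k ih =>
    exact (ballSurrogate hv.R_pos (P.grad gs t k) (P.rawLevel t (P.mem gs t) (k + 1))).1.trans ih

theorem norm_grad_le_Gt (hv : P.Valid) (hrun : P.IsRun T l g gs) {t : ℕ} (ht : 1 ≤ t)
    (htT : t ≤ T) (k : ℕ) : ‖P.grad gs t k‖ ≤ P.Gt :=
  (norm_grad_le hv hrun ht htT k).trans (hrun t (Finset.mem_Icc.2 ⟨ht, htT⟩)).2.1

theorem norm_lineGrad_le (hv : P.Valid) (hrun : P.IsRun T l g gs) {t : ℕ} (ht : 1 ≤ t)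
    (htT : t ≤ T) (k : ℕ) : ‖P.lineGrad gs t k‖ ≤ P.R * ‖g t‖ := by
  unfold Inputs.lineGrad
  rw [norm_neg, Real.norm_eq_abs]
  refine (abs_real_inner_le_norm _ _).trans ?_
  rw [mul_comm]
  have := hv.R_pos
  gcongr
  · exact norm_proj_ball_le hv.R_pos.le _
  · exact norm_grad_le hv hrun ht htT k

theorem norm_lineGrad_le_Gt (hv : P.Valid) (hrun : P.IsRun T l g gs) {t : ℕ} (ht : 1 ≤ t)
    (htT : t ≤ T) (k : ℕ) : ‖P.lineGrad gs t k‖ ≤ P.Gt * P.R := by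
  refine (norm_lineGrad_le hv hrun ht htT k).trans ?_
  rw [mul_comm]
  have := hv.R_pos
  gcongr
  exact (hrun t (Finset.mem_Icc.2 ⟨ht, htT⟩)).2.1

/-- Comparing z with 1 and w with u cancels the contribution of x^(k+1): this is why level k alone
can compete with u. -/
theorem inner_raw_sub {t k : ℕ} (hk : k ≤ topLevel t) (u : Eu d) :
    ⟪P.grad gs t k, P.rawLevel t (P.mem gs t) k - u⟫ =
      ⟪P.grad gs t k, P.ballPred gs t k - u⟫ + P.lineGrad gs t k * (P.linePred gs t k - 1) := by
  rw [rawLevel_eq hk, Inputs.lineGrad]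
  simp only [inner_sub_right, inner_add_right, real_inner_smul_right]
  ring

/-- Passing from level k to k + 1 separates the loss of the two subroutines from the loss of the
projected x^(k+1); the transformed gradient then removes the projection at no cost. -/
theorem inner_chain (hv : P.Valid) (hrun : P.IsRun T l g gs) {t : ℕ} (ht : 1 ≤ t)
    (htT : t ≤ T) {u : Eu d} (hu : u ∈ P.V) {k : ℕ} (hk : k ≤ topLevel t + 1) :
    ⟪g t, P.prediction gs t - u⟫ ≤ ∑ j ∈ Finset.range k, P.layerLoss gs t j +
      ⟪P.grad gs t k, P.rawLevel t (P.mem gs t) k - u⟫ := by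
  induction k with
  | zero =>
    rw [Finset.sum_range_zero, zero_add]
    exact (IsRun.surrogate hv hrun ht htT).2 u hu
  | succ k ih =>
    refine (ih (by omega)).trans ?_
    have h1 := (ballSurrogate hv.R_pos (P.grad gs t k)
      (P.rawLevel t (P.mem gs t) (k + 1))).2 u (norm_le_of_mem hv hu)
    have h2 : ⟪P.grad gs t k, P.level t (P.mem gs t) (k + 1) - u⟫ ≤
      ⟪P.grad gs t (k + 1), P.rawLevel t (P.mem gs t) (k + 1) - u⟫ := h1
    rw [inner_raw_sub (by omega), Finset.sum_range_succ, Inputs.layerLoss]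
    have e : P.lineGrad gs t k = -⟪P.grad gs t k, P.level t (P.mem gs t) (k + 1)⟫ := rfl
    rw [inner_sub_right] at h2 ⊢
    rw [mul_sub, mul_one]
    nth_rewrite 2 [e]
    linarith

end Chain

/-! ### The subroutines -/

section Subroutines

variable {P : Inputs d} {T : ℕ} {l : ℕ → (Fin (P.H + 1) → Eu d) → ℝ} {g gs : ℕ → Eu d}

theorem Inputs.Valid.L_pos (hv : P.Valid) : 0 < P.L := by
  have h := hv.Gt_pos.trans_le hv.Gt_le
  have : (0 : ℝ) < P.H + 1 := by positivity
  exact pos_of_mul_pos_left h this.le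

/-- Because of this the thresholds max{λ, G̃} of the subroutines are simply λ. -/
theorem Inputs.Valid.Gt_le_lam (hv : P.Valid) (hH : 1 ≤ P.H) : P.Gt ≤ P.lam := by
  refine hv.Gt_le.trans ?_
  have hH1 : (1 : ℝ) ≤ P.H := by exact_mod_cast hH
  have hL := hv.L_pos
  unfold Inputs.lam
  have : P.L * (P.H + 1) * 1 ≤ P.L * (P.H + 1) * P.H := by gcongr
  linarith

theorem Inputs.Valid.lam_pos (hv : P.Valid) (hH : 1 ≤ P.H) : 0 < P.lam :=
  hv.Gt_pos.trans_le (hv.Gt_le_lam hH)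

/-- A bound of the logarithmic factors in the regret of the subroutines. -/
noncomputable def Inputs.logBound (P : Inputs d) (T : ℕ) : ℝ :=
  Real.log (4 * P.lam * P.R * √(2 * (T : ℝ))) - Real.log P.eps0 + 446 * Real.log T + 5 / 2

theorem ballAlg_eq (hv : P.Valid) (hH : 1 ≤ P.H) (k : ℕ) :
    P.ballAlg k = slowdown (learnerBall d P.lam (2 ^ k * P.eps0) (P.lam + P.Gt) P.R) P.lam := by
  rw [Inputs.ballAlg, subroutineBall, max_eq_left (hv.Gt_le_lam hH)]

theorem lineAlg_eq (hv : P.Valid) (hH : 1 ≤ P.H) (k : ℕ) :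
    P.lineAlg k = slowdown (learner1d (P.lam * P.R) 0 (2 ^ k * P.eps0)
      (P.lam * P.R + P.Gt * P.R) 1) (P.lam * P.R) := by
  have : P.Gt * P.R ≤ P.lam * P.R :=
    mul_le_mul_of_nonneg_right (hv.Gt_le_lam hH) hv.R_pos.le
  rw [Inputs.lineAlg, subroutine1d, max_eq_left this]

theorem eps0_pos (hv : P.Valid) (heps : P.eps0 = P.Gt * P.R / (T + 1)) : 0 < P.eps0 := by
  have := hv.Gt_pos
  have := hv.R_pos
  rw [heps]; positivity

theorem two_pow_mul_eps0_le (hv : P.Valid) (heps : P.eps0 = P.Gt * P.R / (T + 1)) {k : ℕ}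
    (hk : 2 ^ k ≤ T) : 2 ^ k * P.eps0 ≤ P.Gt * P.R := by
  have := hv.Gt_pos
  have := hv.R_pos
  have h : (2 : ℝ) ^ k ≤ T + 1 := by
    have : ((2 ^ k : ℕ) : ℝ) ≤ T := by exact_mod_cast hk
    push_cast at this
    linarith
  rw [heps]
  calc (2 : ℝ) ^ k * (P.Gt * P.R / (T + 1)) ≤ (T + 1) * (P.Gt * P.R / (T + 1)) := by gcongr
    _ = P.Gt * P.R := by field_simp

theorem logBound_ge (hv : P.Valid) (heps : P.eps0 = P.Gt * P.R / (T + 1))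
    {C : ℝ} (hC : 0 < C) (hC4 : C ≤ 4 * P.lam * P.R) (k : ℕ) {n : ℕ} (hn : 1 ≤ n) (hnT : n ≤ T) :
    Real.log (C * √(2 * (n : ℝ))) - Real.log (2 ^ k * P.eps0) + 446 * Real.log n + 5 / 2 ≤
      P.logBound T := by
  have he := eps0_pos hv heps
  have hn1 : (1 : ℝ) ≤ n := by exact_mod_cast hn
  have hnT' : (n : ℝ) ≤ T := by exact_mod_cast hnT
  have h1 : Real.log (C * √(2 * (n : ℝ))) ≤ Real.log (4 * P.lam * P.R * √(2 * (T : ℝ))) :=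
    Real.log_le_log (by positivity) (by have := hC.le.trans hC4; gcongr)
  have h2 : Real.log P.eps0 ≤ Real.log (2 ^ k * P.eps0) :=
    Real.log_le_log he (le_mul_of_one_le_left he.le (one_le_pow₀ (by norm_num)))
  have h3 : Real.log n ≤ Real.log T := Real.log_le_log (by positivity) hnT'
  unfold Inputs.logBound
  linarith

theorem logBound_nonneg (hv : P.Valid) (hH : 1 ≤ P.H) (heps : P.eps0 = P.Gt * P.R / (T + 1))
    (hT : 1 ≤ T) : 0 ≤ P.logBound T := by
  have he := eps0_pos hv heps
  have hT1 : (1 : ℝ) ≤ T := by exact_mod_cast hT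
  have hl := hv.lam_pos hH
  have hR := hv.R_pos
  have h1 : P.eps0 ≤ 4 * P.lam * P.R * √(2 * (T : ℝ)) := by
    have h0 := two_pow_mul_eps0_le hv heps (k := 0) (by simpa using hT)
    have hs : 1 ≤ √(2 * (T : ℝ)) := Real.one_le_sqrt.2 (by linarith)
    have h2 : P.Gt * P.R ≤ P.lam * P.R :=
      mul_le_mul_of_nonneg_right (hv.Gt_le_lam hH) hv.R_pos.le
    have h3 : 4 * P.lam * P.R * 1 ≤ 4 * P.lam * P.R * √(2 * (T : ℝ)) := by gcongr
    have h4 : 0 < P.lam * P.R := by positivity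
    linarith
  have h2 := Real.log_le_log he h1
  have h3 := Real.log_nonneg hT1
  unfold Inputs.logBound
  linarith

theorem ball_good (hv : P.Valid) (hH : 1 ≤ P.H) (heps : P.eps0 = P.Gt * P.R / (T + 1)) {k : ℕ}
    (hk : 2 ^ k ≤ T) :
    (learnerBall d P.lam (2 ^ k * P.eps0) (P.lam + P.Gt) P.R).Good (fun s => s.1.round)
      (Metric.closedBall 0 P.R) (P.lam + P.Gt) P.lam (2 ^ k * P.eps0) P.R
      (2 * P.R * (P.lam + P.Gt + P.lam + P.lam) * P.logBound T + 3 * P.R * (P.lam + P.Gt)) T := by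
  have hl := hv.lam_pos hH
  have hG := hv.Gt_pos
  have hGl := hv.Gt_le_lam hH
  have hR := hv.R_pos
  have he := eps0_pos hv heps
  have hT : 1 ≤ T := Nat.one_le_two_pow.trans hk
  refine learnerBall_good ⟨hl.le, hl.le, by positivity, by positivity, hR⟩ ?_
    (logBound_nonneg hv hH heps hT) fun n hn hnT => ?_
  · refine (two_pow_mul_eps0_le hv heps hk).trans ?_
    gcongr; linarith
  · rw [← mul_assoc]
    refine logBound_ge hv heps (by positivity) ?_ k hn hnT
    rw [mul_comm]
    gcongr; linarith

theorem line_good (hv : P.Valid) (hH : 1 ≤ P.H) (heps : P.eps0 = P.Gt * P.R / (T + 1)) {k : ℕ}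
    (hk : 2 ^ k ≤ T) :
    (learner1d (P.lam * P.R) 0 (2 ^ k * P.eps0) (P.lam * P.R + P.Gt * P.R) 1).Good Bettor.round
      (Set.Icc 0 1) (P.lam * P.R + P.Gt * P.R) (P.lam * P.R) (2 ^ k * P.eps0) 1
      (2 * 1 * (P.lam * P.R + P.Gt * P.R + P.lam * P.R + 0) * P.logBound T) T := by
  have hl := hv.lam_pos hH
  have hG := hv.Gt_pos
  have hGl : P.Gt * P.R ≤ P.lam * P.R :=
    mul_le_mul_of_nonneg_right (hv.Gt_le_lam hH) hv.R_pos.le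
  have hR := hv.R_pos
  have he := eps0_pos hv heps
  have hT : 1 ≤ T := Nat.one_le_two_pow.trans hk
  have hlR : 0 < P.lam * P.R := by positivity
  have hGR : 0 < P.Gt * P.R := by positivity
  refine learner1d_good ⟨hlR.le, le_rfl, by positivity, by positivity, one_pos⟩ (by linarith) ?_
    (logBound_nonneg hv hH heps hT) fun n hn hnT => ?_
  · refine (two_pow_mul_eps0_le hv heps hk).trans ?_
    linarith
  · rw [one_mul]
    exact logBound_ge hv heps (by positivity) (by linarith) k hn hnT

/-! ### The states of the subroutines on a geometric-covering interval -/

/-- The states at level `j` on the geometric-covering interval that starts in round `s`, where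
`r = 0` is the start. -/
noncomputable def Inputs.blockState (P : Inputs d) (gs : ℕ → Eu d) (j s r : ℕ) :
    ((Bettor × (ℕ × Eu d)) × Eu d) × (Bettor × ℝ) :=
  if r = 0 then P.fresh j else P.after gs (s + r - 1) j

theorem mem_eq_blockState {j i r : ℕ} (hr : r < 2 ^ j) :
    P.mem gs (2 ^ j * i + r) j = P.blockState gs j (2 ^ j * i) r := by
  unfold Inputs.blockState
  split_ifs with h
  · subst h; exact mem_of_dvd (by simp)
  · refine mem_of_not_dvd fun hd => ?_
    rw [Nat.dvd_add_right (Dvd.intro _ rfl)] at hd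
    exact absurd (Nat.le_of_dvd (by omega) hd) (by omega)

theorem blockState_succ {j i r : ℕ} (hi : 1 ≤ i) (hr : r < 2 ^ j) :
    P.blockState gs j (2 ^ j * i) (r + 1) =
      ((P.ballAlg j).update (P.blockState gs j (2 ^ j * i) r).1 (P.grad gs (2 ^ j * i + r) j),
        (P.lineAlg j).update (P.blockState gs j (2 ^ j * i) r).2
          (P.lineGrad gs (2 ^ j * i + r) j)) := by
  have h1 : 2 ^ j ≤ 2 ^ j * i := Nat.le_mul_of_pos_right _ hi
  have h2 : 1 ≤ 2 ^ j := Nat.one_le_two_pow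
  rw [← mem_eq_blockState hr, ← after_apply (by omega) (by omega)]
  rfl

/-- The copy is replaced right after the interval and the new one predicts 0, so the move out of the
last round is the return to 0 that the comparator bound already covers. -/
theorem ball_seq_zero (hv : P.Valid) (hH : 1 ≤ P.H) (heps : P.eps0 = P.Gt * P.R / (T + 1))
    (hrun : P.IsRun T l g gs) {j i : ℕ} (hi : 1 ≤ i) (hT : 2 ^ j * (i + 1) ≤ T + 1) :
    ∑ r ∈ Finset.range (2 ^ j), (⟪P.grad gs (2 ^ j * i + r) j, P.ballPred gs (2 ^ j * i + r) j⟫ +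
      P.lam * ‖P.ballPred gs (2 ^ j * i + r) j - P.ballPred gs (2 ^ j * i + r + 1) j‖) ≤
      2 ^ j * P.eps0 := by
  have h1 : 2 ^ j ≤ 2 ^ j * i := Nat.le_mul_of_pos_right _ hi
  have h2 : 1 ≤ 2 ^ j := Nat.one_le_two_pow
  rw [mul_add, mul_one] at hT
  have hA := ball_good hv hH heps (k := j) (by omega)
  have e := ballAlg_eq hv hH j
  refine hA.seq_zero (hv.lam_pos hH).le (S := fun r => (P.blockState gs j (2 ^ j * i) r).1)
    (γ := fun r => P.grad gs (2 ^ j * i + r) j) (p := fun r => P.ballPred gs (2 ^ j * i + r) j)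
    h2 ?_ ?_ ?_ ?_ ?_
  · rw [← e]; rfl
  · intro r hr
    simp only [blockState_succ hi hr, ← e]
  · intro r hr
    exact norm_grad_le_Gt hv hrun (by omega) (by omega) j
  · intro r hr
    simp only [← mem_eq_blockState hr, ← e]
    rfl
  · exact ballPred_fresh (by simp)

theorem line_seq_zero (hv : P.Valid) (hH : 1 ≤ P.H) (heps : P.eps0 = P.Gt * P.R / (T + 1))
    (hrun : P.IsRun T l g gs) {j i : ℕ} (hi : 1 ≤ i) (hT : 2 ^ j * (i + 1) ≤ T + 1) :
    ∑ r ∈ Finset.range (2 ^ j), (P.lineGrad gs (2 ^ j * i + r) j * P.linePred gs (2 ^ j * i + r) j +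
      P.lam * P.R * |P.linePred gs (2 ^ j * i + r) j - P.linePred gs (2 ^ j * i + r + 1) j|) ≤
      2 ^ j * P.eps0 := by
  have h1 : 2 ^ j ≤ 2 ^ j * i := Nat.le_mul_of_pos_right _ hi
  have h2 : 1 ≤ 2 ^ j := Nat.one_le_two_pow
  rw [mul_add, mul_one] at hT
  have hA := line_good hv hH heps (k := j) (by omega)
  have e := lineAlg_eq hv hH j
  have hl := hv.lam_pos hH
  have hR := hv.R_pos
  have := hA.seq_zero (by positivity) (S := fun r => (P.blockState gs j (2 ^ j * i) r).2)
    (γ := fun r => P.lineGrad gs (2 ^ j * i + r) j) (p := fun r => P.linePred gs (2 ^ j * i + r) j)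
    h2 ?_ ?_ ?_ ?_ ?_
  · simpa only [real_inner_eq_mul, Real.norm_eq_abs, add_assoc] using this
  · rw [← e]; rfl
  · intro r hr
    simp only [blockState_succ hi hr, ← e]
  · intro r hr
    exact norm_lineGrad_le_Gt hv hrun (by omega) (by omega) j
  · intro r hr
    simp only [← mem_eq_blockState hr, ← e]
    rfl
  · exact linePred_fresh (by simp)

theorem ball_seq_regret (hv : P.Valid) (hH : 1 ≤ P.H) (heps : P.eps0 = P.Gt * P.R / (T + 1))
    (hrun : P.IsRun T l g gs) {j i : ℕ} (hi : 1 ≤ i) (hT : 2 ^ j * (i + 1) ≤ T + 1) {u : Eu d}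
    (hu : ‖u‖ ≤ P.R) :
    ∑ r ∈ Finset.range (2 ^ j),
        ⟪P.grad gs (2 ^ j * i + r) j, P.ballPred gs (2 ^ j * i + r) j - u⟫ ≤
      2 ^ j * P.eps0 + (2 * P.R * (P.lam + P.Gt + P.lam + P.lam) * P.logBound T +
        3 * P.R * (P.lam + P.Gt)) *
        √((∑ r ∈ Finset.range (2 ^ j), ‖g (2 ^ j * i + r)‖) / P.lam) + 2 * P.R * P.lam := by
  have h1 : 2 ^ j ≤ 2 ^ j * i := Nat.le_mul_of_pos_right _ hi
  have h2 : 1 ≤ 2 ^ j := Nat.one_le_two_pow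
  rw [mul_add, mul_one] at hT
  have hA := ball_good hv hH heps (k := j) (by omega)
  have e := ballAlg_eq hv hH j
  have hl := hv.lam_pos hH
  have hR := hv.R_pos
  have hG := hv.Gt_pos
  have hX := logBound_nonneg hv hH heps (by omega)
  refine (hA.seq_regret hl (by positivity) (n := 2 ^ j)
    (S := fun r => (P.blockState gs j (2 ^ j * i) r).1)
    (γ := fun r => P.grad gs (2 ^ j * i + r) j) (p := fun r => P.ballPred gs (2 ^ j * i + r) j)
    (by omega) ?_ ?_ ?_ ?_ (by simpa using hu) hu).trans ?_
  · rw [← e]; rfl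
  · intro r hr
    simp only [blockState_succ hi hr, ← e]
  · intro r hr
    exact norm_grad_le_Gt hv hrun (by omega) (by omega) j
  · intro r hr
    simp only [← mem_eq_blockState hr, ← e]
    rfl
  · gcongr with r hr
    have := Finset.mem_range.1 hr
    exact norm_grad_le hv hrun (by omega) (by omega) j

theorem line_seq_regret (hv : P.Valid) (hH : 1 ≤ P.H) (heps : P.eps0 = P.Gt * P.R / (T + 1))
    (hrun : P.IsRun T l g gs) {j i : ℕ} (hi : 1 ≤ i) (hT : 2 ^ j * (i + 1) ≤ T + 1) :
    ∑ r ∈ Finset.range (2 ^ j),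
        P.lineGrad gs (2 ^ j * i + r) j * (P.linePred gs (2 ^ j * i + r) j - 1) ≤
      2 ^ j * P.eps0 + 2 * 1 * (P.lam * P.R + P.Gt * P.R + P.lam * P.R + 0) * P.logBound T *
        √((∑ r ∈ Finset.range (2 ^ j), ‖g (2 ^ j * i + r)‖) / P.lam) + 2 * 1 * (P.lam * P.R) := by
  have h1 : 2 ^ j ≤ 2 ^ j * i := Nat.le_mul_of_pos_right _ hi
  have h2 : 1 ≤ 2 ^ j := Nat.one_le_two_pow
  rw [mul_add, mul_one] at hT
  have hA := line_good hv hH heps (k := j) (by omega)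
  have e := lineAlg_eq hv hH j
  have hl := hv.lam_pos hH
  have hR := hv.R_pos
  have hG := hv.Gt_pos
  have hX := logBound_nonneg hv hH heps (by omega)
  have := hA.seq_regret (by positivity) (by positivity) (n := 2 ^ j)
    (S := fun r => (P.blockState gs j (2 ^ j * i) r).2)
    (γ := fun r => P.lineGrad gs (2 ^ j * i + r) j) (p := fun r => P.linePred gs (2 ^ j * i + r) j)
    (by omega) ?_ ?_ ?_ ?_ (u := 1) (by simp) (by simp)
  · simp only [real_inner_eq_mul] at this
    refine this.trans ?_
    -- Gradients and threshold of the one-dimensional subroutine both carry a factor R, which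
    -- cancels.
    have h3 : (∑ r ∈ Finset.range (2 ^ j), ‖P.lineGrad gs (2 ^ j * i + r) j‖) / (P.lam * P.R) ≤
        (∑ r ∈ Finset.range (2 ^ j), ‖g (2 ^ j * i + r)‖) / P.lam := by
      rw [div_le_div_iff₀ (by positivity) hl]
      have : ∑ r ∈ Finset.range (2 ^ j), ‖P.lineGrad gs (2 ^ j * i + r) j‖ ≤
          P.R * ∑ r ∈ Finset.range (2 ^ j), ‖g (2 ^ j * i + r)‖ := by
        rw [Finset.mul_sum]
        refine Finset.sum_le_sum fun r hr => ?_
        have := Finset.mem_range.1 hr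
        exact norm_lineGrad_le hv hrun (by omega) (by omega) j
      calc _ ≤ P.R * (∑ r ∈ Finset.range (2 ^ j), ‖g (2 ^ j * i + r)‖) * P.lam := by gcongr
        _ = _ := by ring
    gcongr
  · rw [← e]; rfl
  · intro r hr
    simp only [blockState_succ hi hr, ← e]
  · intro r hr
    exact norm_lineGrad_le_Gt hv hrun (by omega) (by omega) j
  · intro r hr
    simp only [← mem_eq_blockState hr, ← e]
    rfl

/-- The states of the active subroutines are reached by runs of these. -/
theorem exists_run (hv : P.Valid) (hrun : P.IsRun T l g gs) {t : ℕ} (ht : 1 ≤ t) (htT : t ≤ T) :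
    ∀ j, 2 ^ j ≤ t →
      (∃ n U l m v, (P.ballAlg j).Run P.Gt n (P.mem gs t j).1 U l m v) ∧
      (∃ n U l m v, (P.lineAlg j).Run (P.Gt * P.R) n (P.mem gs t j).2 U l m v) := by
  induction t, ht using Nat.le_induction with
  | base =>
    intro j hj
    have hd : 2 ^ j ∣ 1 := by
      have : 2 ^ j = 1 := le_antisymm hj Nat.one_le_two_pow
      simp [this]
    rw [mem_of_dvd hd]
    exact ⟨⟨_, _, _, _, _, .start⟩, ⟨_, _, _, _, _, .start⟩⟩
  | succ t ht ih =>
    intro j hj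
    by_cases hd : 2 ^ j ∣ t + 1
    · rw [mem_of_dvd hd]
      exact ⟨⟨_, _, _, _, _, .start⟩, ⟨_, _, _, _, _, .start⟩⟩
    · have hj' : 2 ^ j ≤ t := by
        rcases hj.eq_or_lt with h | h
        · exact absurd (by rw [h]) hd
        · omega
      obtain ⟨⟨n, U, l, m, v, h1⟩, ⟨n', U', l', m', v', h2⟩⟩ := ih (by omega) j hj'
      rw [mem_of_not_dvd hd, Nat.add_sub_cancel, after_apply ht hj']
      exact ⟨⟨_, _, _, _, _, h1.step _ (norm_grad_le_Gt hv hrun ht (by omega) j)⟩,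
        ⟨_, _, _, _, _, h2.step _ (norm_lineGrad_le_Gt hv hrun ht (by omega) j)⟩⟩

/-- A restart at level j ≥ k needs a multiple of 2^k, and there is none strictly inside the block.
-/
theorem mem_succ {k i j r : ℕ} (hi : 1 ≤ i) (hkj : k ≤ j) (hr : r + 1 < 2 ^ k)
    (hj : 2 ^ j ≤ 2 ^ k * i) :
    P.mem gs (2 ^ k * i + (r + 1)) j =
      ((P.ballAlg j).update (P.mem gs (2 ^ k * i + r) j).1 (P.grad gs (2 ^ k * i + r) j),
        (P.lineAlg j).update (P.mem gs (2 ^ k * i + r) j).2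
          (P.lineGrad gs (2 ^ k * i + r) j)) := by
  have h1 : 2 ^ k ≤ 2 ^ k * i := Nat.le_mul_of_pos_right _ hi
  have hd : ¬ 2 ^ j ∣ 2 ^ k * i + (r + 1) := by
    intro h
    have h2 : 2 ^ k ∣ 2 ^ k * i + (r + 1) := (pow_dvd_pow 2 hkj).trans h
    rw [Nat.dvd_add_right (Dvd.intro _ rfl)] at h2
    exact absurd (Nat.le_of_dvd (by omega) h2) (by omega)
  rw [mem_of_not_dvd hd, ← add_assoc, Nat.add_sub_cancel, after_apply (by omega) (by omega)]

/-- The movement of the subroutines of the higher levels on a geometric-covering interval. -/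
theorem layerMove_seq (hv : P.Valid) (hH : 1 ≤ P.H) (heps : P.eps0 = P.Gt * P.R / (T + 1))
    (hrun : P.IsRun T l g gs) {k i j : ℕ} (hi : 1 ≤ i) (hkj : k ≤ j)
    (hT : 2 ^ k * (i + 1) ≤ T + 1) (hj : 2 ^ j ≤ 2 ^ k * i) :
    ∑ r ∈ Finset.range (2 ^ k - 1), P.layerMove gs (2 ^ k * i + r) j ≤
      1000 * P.R * √(1 + (∑ r ∈ Finset.range (2 ^ k), ‖g (2 ^ k * i + r)‖) / P.lam) := by
  have h1 : 2 ^ k ≤ 2 ^ k * i := Nat.le_mul_of_pos_right _ hi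
  have h2 : 1 ≤ 2 ^ k := Nat.one_le_two_pow
  rw [mul_add, mul_one] at hT
  have hl := hv.lam_pos hH
  have hR := hv.R_pos
  have hB := ball_good hv hH heps (k := j) (by omega)
  have eB := ballAlg_eq hv hH j
  have hL := line_good hv hH heps (k := j) (by omega)
  have eL := lineAlg_eq hv hH j
  obtain ⟨hrB, hrL⟩ := exists_run hv hrun (t := 2 ^ k * i) (by omega) (by omega) j hj
  rw [eB] at hrB
  rw [eL] at hrL
  have hmB := hB.seq_move hl hR.le (n := 2 ^ k - 1) (S := fun r => (P.mem gs (2 ^ k * i + r) j).1)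
    (γ := fun r => P.grad gs (2 ^ k * i + r) j) hrB
    (fun r hr => by
      have := mem_succ (P := P) (gs := gs) hi hkj (r := r) (by omega) hj
      simp only [this, ← eB])
    (fun r hr => norm_grad_le_Gt hv hrun (by omega) (by omega) j)
  have hmL := hL.seq_move (by positivity) zero_le_one (n := 2 ^ k - 1)
    (S := fun r => (P.mem gs (2 ^ k * i + r) j).2)
    (γ := fun r => P.lineGrad gs (2 ^ k * i + r) j) hrL
    (fun r hr => by
      have := mem_succ (P := P) (gs := gs) hi hkj (r := r) (by omega) hj
      simp only [this, ← eL])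
    (fun r hr => norm_lineGrad_le_Gt hv hrun (by omega) (by omega) j)
  rw [← eB] at hmB
  rw [← eL] at hmL
  have hsub : Finset.range (2 ^ k - 1) ⊆ Finset.range (2 ^ k) :=
    Finset.range_subset_range.2 (Nat.sub_le _ _)
  have hVB : ∑ r ∈ Finset.range (2 ^ k - 1), ‖P.grad gs (2 ^ k * i + r) j‖ ≤
      ∑ r ∈ Finset.range (2 ^ k), ‖g (2 ^ k * i + r)‖ := by
    refine (Finset.sum_le_sum fun r hr => ?_).trans
      (Finset.sum_le_sum_of_subset_of_nonneg hsub fun _ _ _ => norm_nonneg _)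
    have := Finset.mem_range.1 hr
    exact norm_grad_le hv hrun (by omega) (by omega) j
  have hVL : (∑ r ∈ Finset.range (2 ^ k - 1), ‖P.lineGrad gs (2 ^ k * i + r) j‖) / (P.lam * P.R) ≤
      (∑ r ∈ Finset.range (2 ^ k), ‖g (2 ^ k * i + r)‖) / P.lam := by
    rw [div_le_div_iff₀ (by positivity) hl]
    have : ∑ r ∈ Finset.range (2 ^ k - 1), ‖P.lineGrad gs (2 ^ k * i + r) j‖ ≤
        P.R * ∑ r ∈ Finset.range (2 ^ k), ‖g (2 ^ k * i + r)‖ := by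
      rw [Finset.mul_sum]
      refine (Finset.sum_le_sum fun r hr => ?_).trans
        (Finset.sum_le_sum_of_subset_of_nonneg hsub fun _ _ _ => by positivity)
      have := Finset.mem_range.1 hr
      exact norm_lineGrad_le hv hrun (by omega) (by omega) j
    calc _ ≤ P.R * (∑ r ∈ Finset.range (2 ^ k), ‖g (2 ^ k * i + r)‖) * P.lam := by gcongr
      _ = _ := by ring
  set V := ∑ r ∈ Finset.range (2 ^ k), ‖g (2 ^ k * i + r)‖
  have hB' := hmB.trans (show _ ≤ 500 * P.R * √(1 + V / P.lam) by gcongr)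
  have hL' := hmL.trans (show _ ≤ 500 * 1 * √(1 + V / P.lam) by gcongr)
  have hL'' := mul_le_mul_of_nonneg_left hL' hR.le
  unfold Inputs.layerMove
  rw [Finset.sum_add_distrib, ← Finset.mul_sum]
  exact (add_le_add hL'' hB').trans (le_of_eq (by ring))

end Subroutines

end OCOM

/-! ### Cost on blocks and intervals, memory, conclusion -/

namespace OCOM

variable {d : ℕ} {P : Inputs d} {T : ℕ} {l : ℕ → (Fin (P.H + 1) → Eu d) → ℝ} {g gs : ℕ → Eu d}

/-! ### The cost on a geometric-covering interval -/

/-- A new level opens only at a power of two. Powers below 2^k lie before the block, and the others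
are multiples of 2^k, so none is strictly inside. -/
theorem topLevel_block {k i r : ℕ} (hi : 1 ≤ i) (hr : r < 2 ^ k) :
    topLevel (2 ^ k * i + r) = topLevel (2 ^ k * i) := by
  have h1 : 2 ^ k ≤ 2 ^ k * i := Nat.le_mul_of_pos_right _ hi
  have h2 : 1 ≤ 2 ^ k := Nat.one_le_two_pow
  refine eq_of_forall_le_iff fun j => ?_
  rw [le_topLevel_iff (by omega), le_topLevel_iff (by omega)]
  refine ⟨fun h => ?_, fun h => by omega⟩
  rcases le_total j k with hjk | hjk
  · exact (Nat.pow_le_pow_right (by norm_num) hjk).trans h1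
  · obtain ⟨m, rfl⟩ : ∃ m, j = k + m := ⟨j - k, by omega⟩
    rw [pow_add] at h ⊢
    have h3 : 2 ^ k * 2 ^ m < 2 ^ k * (i + 1) := by rw [mul_add, mul_one]; omega
    have h4 := Nat.lt_of_mul_lt_mul_left h3
    exact Nat.mul_le_mul_left _ (by omega)

theorem layer_seq_zero (hv : P.Valid) (hH : 1 ≤ P.H) (heps : P.eps0 = P.Gt * P.R / (T + 1))
    (hrun : P.IsRun T l g gs) {j k i : ℕ} (hjk : j ≤ k) (hi : 1 ≤ i)
    (hT : 2 ^ k * (i + 1) ≤ T + 1) :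
    ∑ r ∈ Finset.range (2 ^ k), (P.layerLoss gs (2 ^ k * i + r) j +
      P.lam * P.layerMove gs (2 ^ k * i + r) j) ≤ 2 ^ k * (2 * P.eps0) := by
  refine sum_dyadic_le (f := fun t => P.layerLoss gs t j + P.lam * P.layerMove gs t j)
    (M := T + 1) (fun i hi hT => ?_) hjk i hi hT
  have h1 := ball_seq_zero hv hH heps hrun hi hT
  have h2 := line_seq_zero hv hH heps hrun hi hT
  refine le_trans (le_of_eq ?_) ((add_le_add h1 h2).trans (le_of_eq (by ring)))
  rw [← Finset.sum_add_distrib]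
  refine Finset.sum_congr rfl fun r _ => ?_
  unfold Inputs.layerLoss Inputs.layerMove
  ring

theorem block_regret (hv : P.Valid) (hrun : P.IsRun T l g gs) {k i : ℕ} (hi : 1 ≤ i)
    (hT : 2 ^ k * (i + 1) ≤ T + 1) {u : Eu d} (hu : u ∈ P.V) :
    ∑ r ∈ Finset.range (2 ^ k), ⟪g (2 ^ k * i + r), P.prediction gs (2 ^ k * i + r) - u⟫ ≤
      ∑ j ∈ Finset.range k, ∑ r ∈ Finset.range (2 ^ k), P.layerLoss gs (2 ^ k * i + r) j +
      (∑ r ∈ Finset.range (2 ^ k),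
        ⟪P.grad gs (2 ^ k * i + r) k, P.ballPred gs (2 ^ k * i + r) k - u⟫ +
      ∑ r ∈ Finset.range (2 ^ k),
        P.lineGrad gs (2 ^ k * i + r) k * (P.linePred gs (2 ^ k * i + r) k - 1)) := by
  have h1 : 2 ^ k ≤ 2 ^ k * i := Nat.le_mul_of_pos_right _ hi
  have h2 : 1 ≤ 2 ^ k := Nat.one_le_two_pow
  rw [mul_add, mul_one] at hT
  rw [Finset.sum_comm, ← Finset.sum_add_distrib, ← Finset.sum_add_distrib]
  refine Finset.sum_le_sum fun r hr => ?_
  have hr := Finset.mem_range.1 hr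
  have hk : k ≤ topLevel (2 ^ k * i + r) := (le_topLevel_iff (by omega)).2 (by omega)
  rw [← inner_raw_sub hk]
  exact inner_chain hv hrun (by omega) (by omega) hu (by omega)

/-- Movements at levels below k are kept, since their comparator bounds will pay for them. At each
of the at most K + 1 remaining levels the subroutines run without restart inside the block, so slow
change applies. Only the 2^k − 1 moves within the block are counted. -/
theorem block_move (hv : P.Valid) (hH : 1 ≤ P.H) (heps : P.eps0 = P.Gt * P.R / (T + 1))
    (hrun : P.IsRun T l g gs) {k i : ℕ} (hi : 1 ≤ i) (hT : 2 ^ k * (i + 1) ≤ T + 1) :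
    ∑ r ∈ Finset.range (2 ^ k - 1), ‖P.prediction gs (2 ^ k * i + r) -
        P.prediction gs (2 ^ k * i + r + 1)‖ ≤
      ∑ j ∈ Finset.range k, ∑ r ∈ Finset.range (2 ^ k), P.layerMove gs (2 ^ k * i + r) j +
      (topLevel (2 ^ k * i) + 1 : ℝ) * (1000 * P.R *
        √(1 + (∑ r ∈ Finset.range (2 ^ k), ‖g (2 ^ k * i + r)‖) / P.lam)) := by
  have h1 : 2 ^ k ≤ 2 ^ k * i := Nat.le_mul_of_pos_right _ hi
  have h2 : 1 ≤ 2 ^ k := Nat.one_le_two_pow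
  have hk : k ≤ topLevel (2 ^ k * i) := (le_topLevel_iff (by omega)).2 h1
  set K := topLevel (2 ^ k * i) with hK
  set D := 1000 * P.R * √(1 + (∑ r ∈ Finset.range (2 ^ k), ‖g (2 ^ k * i + r)‖) / P.lam)
  have hD : 0 ≤ D := by have := hv.R_pos; positivity
  have hA : ∑ r ∈ Finset.range (2 ^ k - 1), ‖P.prediction gs (2 ^ k * i + r) -
        P.prediction gs (2 ^ k * i + r + 1)‖ ≤
      ∑ j ∈ Finset.range (K + 1), ∑ r ∈ Finset.range (2 ^ k - 1),
        P.layerMove gs (2 ^ k * i + r) j := by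
    rw [Finset.sum_comm]
    refine Finset.sum_le_sum fun r hr => ?_
    have hr := Finset.mem_range.1 hr
    have e1 : topLevel (2 ^ k * i + r) = K := topLevel_block hi (by omega)
    have e2 : topLevel (2 ^ k * i + r + 1) = K := by
      rw [add_assoc]; exact topLevel_block hi (by omega)
    rw [← e1]
    exact norm_prediction_sub_le hv (by omega) (by rw [e1, e2])
  refine hA.trans ?_
  rw [show K + 1 = k + (K + 1 - k) by omega, Finset.sum_range_add]
  refine add_le_add ?_ ?_
  · refine Finset.sum_le_sum fun j _ => ?_
    exact Finset.sum_le_sum_of_subset_of_nonneg (Finset.range_subset_range.2 (Nat.sub_le _ _))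
      fun _ _ _ => layerMove_nonneg hv.R_pos.le _ _
  · have h3 : ∀ q ∈ Finset.range (K + 1 - k), ∑ r ∈ Finset.range (2 ^ k - 1),
        P.layerMove gs (2 ^ k * i + r) (k + q) ≤ D := by
      intro q hq
      have hq := Finset.mem_range.1 hq
      exact layerMove_seq hv hH heps hrun hi (by omega) hT
        ((le_topLevel_iff (by omega)).1 (by omega))
    refine (Finset.sum_le_card_nsmul _ _ _ h3).trans ?_
    rw [Finset.card_range, nsmul_eq_mul]
    gcongr
    exact_mod_cast Nat.sub_le (K + 1) k

/-- The linearized regret and the movement of the round `t`. -/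
noncomputable def Inputs.cost (P : Inputs d) (g gs : ℕ → Eu d) (u : Eu d) (t : ℕ) : ℝ :=
  ⟪g t, P.prediction gs t - u⟫ + P.lam * ‖P.prediction gs t - P.prediction gs (t + 1)‖

/-- Below level k, the losses from `block_regret` and the weighted movements from `block_move`
combine into quantities bounded by 2^(k+1) ε₀ each, with 2^k ε₀ ≤ G̃R ≤ λR. At level k the regret
bounds apply, and λ√(V/λ) = √(λV) gives the final form. -/
theorem block_cost (hv : P.Valid) (hH : 1 ≤ P.H) (heps : P.eps0 = P.Gt * P.R / (T + 1))
    (hrun : P.IsRun T l g gs) {k i : ℕ} (hi : 1 ≤ i) (hT : 2 ^ k * (i + 1) ≤ T + 1) {u : Eu d}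
    (hu : u ∈ P.V) {V : ℝ} (hV : ∑ t ∈ Finset.Ico (2 ^ k * i) (2 ^ k * (i + 1)), ‖g t‖ ≤ V) :
    ∑ t ∈ Finset.Ico (2 ^ k * i) (2 ^ k * (i + 1)), P.cost g gs u t ≤
      P.R * (P.lam + √(P.lam * V)) * (14 * P.logBound T + 1016 * (Nat.log 2 T + 1)) := by
  have h1 : 2 ^ k ≤ 2 ^ k * i := Nat.le_mul_of_pos_right _ hi
  have h2 : 1 ≤ 2 ^ k := Nat.one_le_two_pow
  have hT' : 2 ^ k * i + 2 ^ k ≤ T + 1 := by rwa [mul_add, mul_one] at hT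
  have hl := hv.lam_pos hH
  have hR := hv.R_pos
  have hG := hv.Gt_pos
  have hGl := hv.Gt_le_lam hH
  have hX := logBound_nonneg hv hH heps (by omega)
  have hcard : 2 ^ k * (i + 1) - 2 ^ k * i = 2 ^ k := by rw [mul_add, mul_one]; omega
  rw [Finset.sum_Ico_eq_sum_range, hcard] at hV ⊢
  have hreg := block_regret hv hrun hi hT hu
  have hmov := mul_le_mul_of_nonneg_left (block_move hv hH heps hrun hi hT) hl.le
  have hB := ball_seq_regret hv hH heps hrun hi hT (norm_le_of_mem hv hu)
  have hL := line_seq_regret hv hH heps hrun hi hT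
  have hlow : ∑ j ∈ Finset.range k, ∑ r ∈ Finset.range (2 ^ k), (P.layerLoss gs (2 ^ k * i + r) j +
      P.lam * P.layerMove gs (2 ^ k * i + r) j) ≤ k * (2 ^ k * (2 * P.eps0)) := by
    refine (Finset.sum_le_card_nsmul _ _ _ fun j hj => layer_seq_zero hv hH heps hrun
      (Finset.mem_range.1 hj).le hi hT).trans (le_of_eq ?_)
    rw [Finset.card_range, nsmul_eq_mul]
  simp only [Finset.sum_add_distrib, ← Finset.mul_sum] at hlow
  set V0 := ∑ r ∈ Finset.range (2 ^ k), ‖g (2 ^ k * i + r)‖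
  have hV0 : 0 ≤ V0 := Finset.sum_nonneg fun _ _ => norm_nonneg _
  have he := two_pow_mul_eps0_le hv heps (k := k) (by omega)
  set e := 2 ^ k * P.eps0
  set q := √(V0 / P.lam) with hq
  have hq0 : 0 ≤ q := Real.sqrt_nonneg _
  set v := √(P.lam * V) with hvdef
  have hv0 : 0 ≤ v := Real.sqrt_nonneg _
  have hlq : P.lam * q ≤ v := by
    refine Real.le_sqrt_of_sq_le ?_
    rw [mul_pow, hq, Real.sq_sqrt (by positivity)]
    calc P.lam ^ 2 * (V0 / P.lam) = P.lam * V0 := by field_simp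
      _ ≤ P.lam * V := by gcongr
  have hp : √(1 + V0 / P.lam) ≤ 1 + q := by
    refine (sqrt_add_le _ _).trans ?_
    rw [Real.sqrt_one]
  set p := √(1 + V0 / P.lam)
  set N : ℝ := (Nat.log 2 T : ℝ) + 1 with hN
  have hN1 : 1 ≤ N := by rw [hN]; linarith [(Nat.cast_nonneg (Nat.log 2 T) : (0 : ℝ) ≤ _)]
  have hkK : k ≤ topLevel (2 ^ k * i) := (le_topLevel_iff (by omega)).2 h1
  have hKN : topLevel (2 ^ k * i) ≤ Nat.log 2 T :=
    Nat.le_log_of_pow_le (by norm_num)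
      (((le_topLevel_iff (t := 2 ^ k * i) (by omega)).1 le_rfl).trans (by omega))
  have hKN' : (topLevel (2 ^ k * i) : ℝ) + 1 ≤ N := by
    rw [hN]; gcongr
  have hkN : (k : ℝ) ≤ N := by
    have : (k : ℝ) ≤ topLevel (2 ^ k * i) := by exact_mod_cast hkK
    linarith
  -- the move after the last round
  have hlast : ∑ r ∈ Finset.range (2 ^ k), P.cost g gs u (2 ^ k * i + r) ≤
      ∑ r ∈ Finset.range (2 ^ k), ⟪g (2 ^ k * i + r), P.prediction gs (2 ^ k * i + r) - u⟫ +
      P.lam * ∑ r ∈ Finset.range (2 ^ k - 1), ‖P.prediction gs (2 ^ k * i + r) -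
        P.prediction gs (2 ^ k * i + r + 1)‖ + P.lam * (2 * P.R) := by
    unfold Inputs.cost
    rw [Finset.sum_add_distrib, ← Finset.mul_sum, add_assoc, ← mul_add]
    gcongr
    obtain ⟨m, hm⟩ : ∃ m, 2 ^ k = m + 1 := ⟨2 ^ k - 1, by omega⟩
    rw [hm, Finset.sum_range_succ, Nat.add_sub_cancel]
    gcongr
    exact norm_prediction_sub_le' hv _ _
  set X := P.logBound T
  have hlR : 0 < P.lam * P.R := by positivity
  have heR : e ≤ P.lam * P.R := he.trans (by gcongr)
  have b1 : (k : ℝ) * (2 ^ k * (2 * P.eps0)) ≤ 2 * N * (P.lam * P.R) := by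
    have e1 : (k : ℝ) * (2 ^ k * (2 * P.eps0)) = 2 * k * e := by simp only [e]; ring
    rw [e1]
    calc 2 * (k : ℝ) * e ≤ 2 * k * (P.lam * P.R) := by gcongr
      _ ≤ 2 * N * (P.lam * P.R) := by gcongr
  have b2 : (2 * P.R * (P.lam + P.Gt + P.lam + P.lam) * X + 3 * P.R * (P.lam + P.Gt)) * q ≤
      P.R * (8 * X + 6) * v := by
    calc _ ≤ (2 * P.R * (P.lam + P.lam + P.lam + P.lam) * X + 3 * P.R * (P.lam + P.lam)) * q := by
          gcongr
      _ = P.R * (8 * X + 6) * (P.lam * q) := by ring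
      _ ≤ _ := by gcongr
  have b3 : 2 * 1 * (P.lam * P.R + P.Gt * P.R + P.lam * P.R + 0) * X * q ≤
      P.R * (6 * X) * v := by
    calc _ ≤ 2 * 1 * (P.lam * P.R + P.lam * P.R + P.lam * P.R + 0) * X * q := by gcongr
      _ = P.R * (6 * X) * (P.lam * q) := by ring
      _ ≤ _ := by gcongr
  have b4 : P.lam * ((topLevel (2 ^ k * i) + 1 : ℝ) * (1000 * P.R * p)) ≤
      1000 * N * P.R * (P.lam + v) := by
    calc _ ≤ P.lam * (N * (1000 * P.R * (1 + q))) := by gcongr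
      _ = 1000 * N * P.R * (P.lam + P.lam * q) := by ring
      _ ≤ _ := by gcongr
  have b5 : 2 * N * (P.lam * P.R) + 10 * (P.lam * P.R) + P.R * (8 * X + 6) * v +
      P.R * (6 * X) * v + 1000 * N * P.R * (P.lam + v) ≤
      P.R * (P.lam + v) * (14 * X + 1016 * N) := by
    have e1 : P.R * (P.lam + v) * (14 * X + 1016 * N) -
        (2 * N * (P.lam * P.R) + 10 * (P.lam * P.R) + P.R * (8 * X + 6) * v +
          P.R * (6 * X) * v + 1000 * N * P.R * (P.lam + v)) =
        P.R * P.lam * (14 * X) + P.R * P.lam * (14 * N - 10) + P.R * v * (16 * N - 6) := by ring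
    have h3 : 0 ≤ 14 * N - 10 := by linarith
    have h4 : 0 ≤ 16 * N - 6 := by linarith
    have : 0 ≤ P.R * P.lam * (14 * X) + P.R * P.lam * (14 * N - 10) + P.R * v * (16 * N - 6) := by
      positivity
    linarith
  rw [mul_add] at hmov
  linarith

/-- The cost on an arbitrary interval. -/
theorem interval_cost (hv : P.Valid) (hH : 1 ≤ P.H) (heps : P.eps0 = P.Gt * P.R / (T + 1))
    (hrun : P.IsRun T l g gs) {a b : ℕ} (ha : 1 ≤ a) (hab : a ≤ b) (hbT : b ≤ T) {u : Eu d}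
    (hu : u ∈ P.V) :
    ∑ t ∈ Finset.Icc a b, P.cost g gs u t ≤ 2 * (Nat.log 2 T + 1) *
      (P.R * (P.lam + √(P.lam * ∑ t ∈ Finset.Icc a b, ‖g t‖)) *
        (14 * P.logBound T + 1016 * (Nat.log 2 T + 1))) := by
  have hl := hv.lam_pos hH
  have hR := hv.R_pos
  have hX := logBound_nonneg hv hH heps (by omega)
  have hIcc : Finset.Icc a b = Finset.Ico a (b + 1) := by ext; simp
  -- The recursion runs over the scales k = 0, 1, …, and b + 1 ≤ T + 1 ≤ 2^(⌊log₂ T⌋ + 1) bounds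
  -- their number.
  have hpow : b + 1 ≤ 2 ^ (Nat.log 2 T + 1) := by
    have := Nat.lt_pow_succ_log_self (b := 2) (by norm_num) T
    omega
  have h := sum_Ico_le_of_dyadic (f := P.cost g gs u) (a := a) (b := b + 1)
    (B := P.R * (P.lam + √(P.lam * ∑ t ∈ Finset.Icc a b, ‖g t‖)) *
        (14 * P.logBound T + 1016 * (Nat.log 2 T + 1))) (by positivity)
    (fun k i hi hai hib => block_cost hv hH heps hrun hi (by omega) hu
      (Finset.sum_le_sum_of_subset_of_nonneg
        (by rw [hIcc]; exact Finset.Ico_subset_Ico hai hib) fun _ _ _ => norm_nonneg _))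
    (Nat.log 2 T + 1) 0 a (b + 1) ha (by omega) hpow (by simp)
    (by simp)
  rw [pow_zero, one_mul, one_mul, ← hIcc] at h
  push_cast at h
  exact h

/-! ### The memory -/

/-- A function that is Lipschitz in each argument separately. -/
theorem abs_sub_le_sum {f : (Fin (P.H + 1) → Eu d) → ℝ} (hf : P.ValidLoss f)
    {y z : Fin (P.H + 1) → Eu d} (hy : ∀ j, y j ∈ P.V) (hz : ∀ j, z j ∈ P.V) :
    |f y - f z| ≤ P.L * ∑ j, ‖y j - z j‖ := by
  have key : ∀ s : Finset (Fin (P.H + 1)),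
      |f (s.piecewise y z) - f z| ≤ P.L * ∑ j ∈ s, ‖y j - z j‖ := by
    intro s
    induction s using Finset.induction_on with
    | empty => simp
    | insert j s hj ih =>
      rw [Finset.piecewise_insert, Finset.sum_insert hj, mul_add]
      have hm : ∀ i, s.piecewise y z i ∈ P.V := fun i => by
        by_cases hi : i ∈ s
        · rw [Finset.piecewise_eq_of_mem _ _ _ hi]; exact hy i
        · rw [Finset.piecewise_eq_of_notMem _ _ _ hi]; exact hz i
      have h1 := hf.lipschitz_arg _ hm j (y j) (hy j)
      rw [Finset.piecewise_eq_of_notMem _ _ _ hj] at h1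
      exact (abs_sub_le _ (f (s.piecewise y z)) _).trans (add_le_add h1 ih)
  simpa using key Finset.univ

theorem sum_history_le (hv : P.Valid) {t : ℕ} {f : (Fin (P.H + 1) → Eu d) → ℝ}
    (hf : P.ValidLoss f) :
    f (P.history gs t) - inst f (P.prediction gs t) ≤ P.L * ∑ q ∈ Finset.range (P.H + 1),
      ‖P.prediction gs (t - q) - P.prediction gs t‖ := by
  have h := abs_sub_le_sum hf (y := P.history gs t) (z := fun _ => P.prediction gs t)
    (fun j => prediction_mem hv _) (fun j => prediction_mem hv _)
  refine (le_abs_self _).trans (h.trans (le_of_eq ?_))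
  congr 1
  rw [← Finset.sum_range_reflect, ← Fin.sum_univ_eq_sum_range
    (fun j => ‖P.prediction gs (t - (P.H + 1 - 1 - j)) - P.prediction gs t‖)]
  refine Finset.sum_congr rfl fun j _ => ?_
  have : t + (j : ℕ) - P.H = t - (P.H + 1 - 1 - j) := by omega
  rw [Inputs.history, this]

/-- In the first q rounds of the interval the lag may reach back before a, and the diameter bound 2R
is used. Afterwards it is bounded by a path inside the interval, where the step from s to s + 1 is
counted only in the rounds s < t ≤ s + q. -/
theorem sum_lag_le (hv : P.Valid) {a b : ℕ} (q : ℕ) :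
    ∑ t ∈ Finset.Icc a b, ‖P.prediction gs (t - q) - P.prediction gs t‖ ≤
      q * (∑ s ∈ Finset.Icc a b, ‖P.prediction gs s - P.prediction gs (s + 1)‖ + 2 * P.R) := by
  have hR := hv.R_pos
  set δ : ℕ → ℝ := fun s => ‖P.prediction gs s - P.prediction gs (s + 1)‖ with hδ
  have hδ0 : ∀ s, 0 ≤ δ s := fun s => norm_nonneg _
  have hpt : ∀ t ∈ Finset.Icc a b, ‖P.prediction gs (t - q) - P.prediction gs t‖ ≤
      ∑ s ∈ Finset.Icc a b, (if s < t ∧ t ≤ s + q then δ s else 0) +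
        if t < a + q then 2 * P.R else 0 := by
    intro t ht
    have ht := Finset.mem_Icc.1 ht
    have hnn : 0 ≤ ∑ s ∈ Finset.Icc a b, (if s < t ∧ t ≤ s + q then δ s else 0) :=
      Finset.sum_nonneg fun s _ => by split_ifs <;> simp [hδ0]
    by_cases hta : t < a + q
    · rw [if_pos hta]
      have := norm_prediction_sub_le' (gs := gs) hv (t - q) t
      linarith
    · rw [if_neg hta, add_zero]
      have h1 := dist_le_Ico_sum_dist (P.prediction gs) (Nat.sub_le t q)
      simp only [dist_eq_norm] at h1
      refine h1.trans ?_
      rw [← Finset.sum_filter]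
      refine Finset.sum_le_sum_of_subset_of_nonneg (fun s hs => ?_) fun s _ _ => hδ0 s
      have := Finset.mem_Ico.1 hs
      simp only [Finset.mem_filter, Finset.mem_Icc]
      omega
  refine (Finset.sum_le_sum hpt).trans ?_
  rw [Finset.sum_add_distrib, Finset.sum_comm, mul_add]
  refine add_le_add ?_ ?_
  · rw [Finset.mul_sum]
    refine Finset.sum_le_sum fun s _ => ?_
    rw [← Finset.sum_filter, Finset.sum_const, nsmul_eq_mul]
    refine mul_le_mul_of_nonneg_right ?_ (hδ0 s)
    have hsub : {t ∈ Finset.Icc a b | s < t ∧ t ≤ s + q} ⊆ Finset.Ioc s (s + q) := by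
      intro t ht
      simp only [Finset.mem_filter] at ht
      simp only [Finset.mem_Ioc]
      omega
    have := Finset.card_le_card hsub
    rw [Nat.card_Ioc] at this
    exact_mod_cast this.trans (by omega)
  · rw [← Finset.sum_filter, Finset.sum_const, nsmul_eq_mul]
    refine mul_le_mul_of_nonneg_right ?_ (by positivity)
    have hsub : {t ∈ Finset.Icc a b | t < a + q} ⊆ Finset.Ico a (a + q) := by
      intro t ht
      simp only [Finset.mem_filter, Finset.mem_Icc] at ht
      simp only [Finset.mem_Ico]
      omega
    have := Finset.card_le_card hsub
    rw [Nat.card_Ico] at this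
    exact_mod_cast this.trans (by omega)

theorem sum_range_cast_mul_two (n : ℕ) :
    (∑ q ∈ Finset.range (n + 1), (q : ℝ)) * 2 = n * (n + 1) := by
  induction n with
  | zero => simp
  | succ n ih => rw [Finset.sum_range_succ, add_mul, ih]; push_cast; ring

/-- The price of the memory is bounded by the movement. -/
theorem memory_cost (hv : P.Valid) (hl : ∀ t ∈ Finset.Icc 1 T, P.ValidLoss (l t)) {a b : ℕ}
    (ha : 1 ≤ a) (hbT : b ≤ T) :
    ∑ t ∈ Finset.Icc a b, (l t (P.history gs t) - inst (l t) (P.prediction gs t)) ≤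
      P.lam * (∑ s ∈ Finset.Icc a b, ‖P.prediction gs s - P.prediction gs (s + 1)‖ + P.R) := by
  have hL := hv.L_pos
  have hR := hv.R_pos
  set D := ∑ s ∈ Finset.Icc a b, ‖P.prediction gs s - P.prediction gs (s + 1)‖ with hD
  have hD0 : 0 ≤ D := Finset.sum_nonneg fun _ _ => norm_nonneg _
  calc _ ≤ ∑ t ∈ Finset.Icc a b, P.L * ∑ q ∈ Finset.range (P.H + 1),
        ‖P.prediction gs (t - q) - P.prediction gs t‖ := by
        refine Finset.sum_le_sum fun t ht => sum_history_le hv (hl t ?_)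
        simp only [Finset.mem_Icc] at ht ⊢
        omega
    _ = P.L * ∑ q ∈ Finset.range (P.H + 1), ∑ t ∈ Finset.Icc a b,
        ‖P.prediction gs (t - q) - P.prediction gs t‖ := by
        rw [← Finset.mul_sum, Finset.sum_comm]
    _ ≤ P.L * ∑ q ∈ Finset.range (P.H + 1), (q : ℝ) * (D + 2 * P.R) := by
        gcongr with q _
        exact sum_lag_le hv q
    -- The lags 0, …, H sum to H(H + 1)/2, the source of λ = LH(H + 1).
    _ = P.lam / 2 * (D + 2 * P.R) := by
        have := sum_range_cast_mul_two P.H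
        rw [← Finset.sum_mul, Inputs.lam]
        linear_combination P.L * (D + 2 * P.R) / 2 * this
    _ ≤ P.lam * (D + P.R) := by
        have : 0 ≤ P.lam * D := by unfold Inputs.lam; positivity
        linarith

/-! ### The logarithmic factors -/

theorem natLog_le {T : ℕ} (hT : 1 ≤ T) : (Nat.log 2 T : ℝ) ≤ 2 * Real.log T := by
  have h1 : 2 ^ Nat.log 2 T ≤ T := Nat.pow_log_le_self 2 (by omega)
  have h2 : (2 : ℝ) ^ Nat.log 2 T ≤ T := by exact_mod_cast h1
  have h3 := Real.log_le_log (by positivity) h2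
  rw [Real.log_pow] at h3
  have h4 := Real.log_two_gt_d9
  have h5 : (0 : ℝ) ≤ Nat.log 2 T := Nat.cast_nonneg _
  nlinarith

theorem log_add_one_le {x : ℝ} (hx : 1 ≤ x) : Real.log (x + 1) ≤ Real.log x + 1 := by
  have h1 : Real.log (x + 1) ≤ Real.log (2 * x) := Real.log_le_log (by linarith) (by linarith)
  rw [Real.log_mul (by norm_num) (by linarith)] at h1
  have := Real.log_two_lt_d9
  linarith

theorem logBound_le (hv : P.Valid) (hH : 1 ≤ P.H) (heps : P.eps0 = P.Gt * P.R / (T + 1))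
    (hT : 1 ≤ T) : P.logBound T ≤ 450 * P.logs T := by
  have hl := hv.lam_pos hH
  have hR := hv.R_pos
  have hG := hv.Gt_pos
  have hL := hv.L_pos
  have hT1 : (1 : ℝ) ≤ T := by exact_mod_cast hT
  have hH1 : (1 : ℝ) ≤ P.H := by exact_mod_cast hH
  have hT0 : (0 : ℝ) < T := by linarith
  have e1 : Real.log (4 * P.lam * P.R * √(2 * (T : ℝ))) =
      2 * Real.log 2 + Real.log P.lam + Real.log P.R + (Real.log 2 + Real.log T) / 2 := by
    rw [Real.log_mul (by positivity) (by positivity), Real.log_mul (by positivity) hR.ne',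
      Real.log_mul (by norm_num) hl.ne', Real.log_sqrt (by positivity),
      Real.log_mul (by norm_num) hT0.ne', show (4 : ℝ) = 2 ^ 2 by norm_num, Real.log_pow]
    push_cast
    ring
  have e2 : Real.log P.lam = Real.log P.L + Real.log P.H + Real.log (P.H + 1) := by
    rw [Inputs.lam, Real.log_mul (by positivity) (by positivity),
      Real.log_mul hL.ne' (by positivity)]
  -- The term log R cancels against the one in `e1`; only the ratio of λ and G̃ and powers of T
  -- remain.
  have e3 : Real.log P.eps0 = Real.log P.Gt + Real.log P.R - Real.log (T + 1) := by
    rw [heps, Real.log_div (by positivity) (by positivity), Real.log_mul hG.ne' hR.ne']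
  have h1 := log_add_one_le hT1
  have h2 := log_add_one_le hH1
  have h3 := Real.log_two_lt_d9
  have h4 := Real.log_nonneg hT1
  have h5 := Real.log_nonneg hH1
  have h6 := le_abs_self (Real.log P.L)
  have h7 := neg_le_abs (Real.log P.Gt)
  have h8 := abs_nonneg (Real.log P.R)
  have h9 := abs_nonneg (Real.log P.L)
  have h10 := abs_nonneg (Real.log P.Gt)
  unfold Inputs.logBound Inputs.logs
  rw [e1, e2, e3]
  linarith

theorem exists_isMinOn (hv : P.Valid) (hl : ∀ t ∈ Finset.Icc 1 T, P.ValidLoss (l t)) {a b : ℕ}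
    (ha : 1 ≤ a) (hbT : b ≤ T) :
    ∃ u ∈ P.V, IsMinOn (fun x => ∑ t ∈ Finset.Icc a b, inst (l t) x) P.V u := by
  refine hv.compact.exists_isMinOn ⟨0, hv.zero_mem⟩ (continuousOn_finsetSum _ fun t ht => ?_)
  have h := (hl t (by simp only [Finset.mem_Icc] at ht ⊢; omega)).lipschitz_inst
  refine (LipschitzOnWith.of_dist_le_mul (K := ⟨P.Gt, hv.Gt_pos.le⟩) fun x hx y hy => ?_).continuousOn
  rw [Real.dist_eq, dist_eq_norm]
  exact h x hx y hy

/-- The policy regret in terms of `lam`. -/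
theorem policy_regret (hv : P.Valid) (hH : 1 ≤ P.H) (heps : P.eps0 = P.Gt * P.R / (T + 1))
    (hl : ∀ t ∈ Finset.Icc 1 T, P.ValidLoss (l t)) (hrun : P.IsRun T l g gs) {a b : ℕ}
    (ha : 1 ≤ a) (hab : a ≤ b) (hbT : b ≤ T) {u : Eu d} (hu : u ∈ P.V) :
    ∑ t ∈ Finset.Icc a b, l t (P.history gs t) - ∑ t ∈ Finset.Icc a b, inst (l t) u ≤
      33330 * P.logs T ^ 2 * (P.R * (P.lam + √(P.lam * ∑ t ∈ Finset.Icc a b, ‖g t‖))) := by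
  have hlam := hv.lam_pos hH
  have hR := hv.R_pos
  have hT : 1 ≤ T := by omega
  have hcost := interval_cost hv hH heps hrun ha hab hbT hu
  have hmem := memory_cost (gs := gs) hv hl ha hbT
  have hX := logBound_nonneg hv hH heps hT
  have hX' := logBound_le hv hH heps hT
  have hsub : ∑ t ∈ Finset.Icc a b, (inst (l t) (P.prediction gs t) - inst (l t) u) ≤
      ∑ t ∈ Finset.Icc a b, ⟪g t, P.prediction gs t - u⟫ := by
    refine Finset.sum_le_sum fun t ht => ?_
    have h := (hrun t (by simp only [Finset.mem_Icc] at ht ⊢; omega)).1.2 u hu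
    rw [← neg_sub, inner_neg_right] at h
    linarith
  have hN : (Nat.log 2 T : ℝ) + 1 ≤ 2 * P.logs T ∧ 1 ≤ P.logs T := by
    have h1 := natLog_le hT
    have h4 := Real.log_nonneg (show (1 : ℝ) ≤ T by exact_mod_cast hT)
    have h5 := Real.log_nonneg (show (1 : ℝ) ≤ P.H by exact_mod_cast hH)
    have h8 := abs_nonneg (Real.log P.R)
    have h9 := abs_nonneg (Real.log P.L)
    have h10 := abs_nonneg (Real.log P.Gt)
    unfold Inputs.logs
    constructor <;> linarith
  obtain ⟨hN, hΛ⟩ := hN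
  set Y := P.R * (P.lam + √(P.lam * ∑ t ∈ Finset.Icc a b, ‖g t‖)) with hY
  have hY0 : 0 ≤ Y := by positivity
  have hYR : P.lam * P.R ≤ Y := by
    rw [hY, mul_comm]
    gcongr
    linarith [Real.sqrt_nonneg (P.lam * ∑ t ∈ Finset.Icc a b, ‖g t‖)]
  set Λ := P.logs T
  set N : ℝ := (Nat.log 2 T : ℝ) + 1
  have hN0 : 0 ≤ N := by positivity
  have b1 : 2 * N * (Y * (14 * P.logBound T + 1016 * N)) ≤
      2 * (2 * Λ) * (Y * (14 * (450 * Λ) + 1016 * (2 * Λ))) := by gcongr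
  have b2 : Y ≤ Λ ^ 2 * Y := le_mul_of_one_le_left hY0 (one_le_pow₀ hΛ)
  unfold Inputs.cost at hcost
  rw [Finset.sum_add_distrib, ← Finset.mul_sum] at hcost
  rw [Finset.sum_sub_distrib] at hmem hsub
  rw [mul_add] at hmem
  -- 4(14·450 + 2032) = 33328; the boundary term λR of the memory adds at most 1.
  have b3 : 2 * (2 * Λ) * (Y * (14 * (450 * Λ) + 1016 * (2 * Λ))) = 33328 * (Λ ^ 2 * Y) := by ring
  linarith

end OCOM

theorem theorem2 :
    ∃ (C : ℝ) (p : ℕ), ∀ (d : ℕ) (P : OCOM.Inputs d) (T : ℕ)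
      (l : ℕ → (Fin (P.H + 1) → OCOM.Eu d) → ℝ) (g gs : ℕ → OCOM.Eu d),
      P.Valid → 1 ≤ P.H → P.eps0 = P.Gt * P.R / (T + 1) →
      (∀ t ∈ Finset.Icc 1 T, P.ValidLoss (l t)) →
      P.IsRun T l g gs →
      ∀ a b : ℕ, 1 ≤ a → a ≤ b → b ≤ T →
        ∃ u ∈ P.V, IsMinOn (fun x => ∑ t ∈ Finset.Icc a b, OCOM.inst (l t) x) P.V u ∧
          ∑ t ∈ Finset.Icc a b, l t (P.history gs t) -
              ∑ t ∈ Finset.Icc a b, OCOM.inst (l t) u ≤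
            C * (P.R * P.L * P.H ^ 3 * Real.log ((Finset.Icc a b).card)) +
            C * P.logs T ^ p *
              (P.R * P.L * P.H ^ 2 +
                P.R * P.H * √(P.L * ∑ t ∈ Finset.Icc a b, ‖g t‖)) := by
  refine ⟨66800, 2, fun d P T l g gs hv hH heps hl hrun a b ha hab hbT => ?_⟩
  obtain ⟨u, hu, hmin⟩ := OCOM.exists_isMinOn hv hl ha hbT
  refine ⟨u, hu, hmin, ?_⟩
  have hreg := OCOM.policy_regret hv hH heps hl hrun ha hab hbT hu
  have hL := hv.L_pos
  have hR := hv.R_pos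
  have hH1 : (1 : ℝ) ≤ P.H := by exact_mod_cast hH
  -- The first term of the claimed bound is needed only as a nonnegative quantity: the second one
  -- already dominates the regret.
  have hlog : 0 ≤ 66800 * (P.R * P.L * P.H ^ 3 * Real.log ((Finset.Icc a b).card)) := by
    have : 0 ≤ Real.log ((Finset.Icc a b).card) := Real.log_natCast_nonneg _
    positivity
  -- H + 1 ≤ 2H costs a factor 2, which turns 33330 into 66660 ≤ 66800.
  have hlam : P.lam ≤ 2 * (P.L * P.H ^ 2) := by
    unfold OCOM.Inputs.lam
    have : P.L * P.H * (P.H + 1) ≤ P.L * P.H * (P.H + P.H) := by gcongr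
    linarith
  set V := ∑ t ∈ Finset.Icc a b, ‖g t‖
  have hV : 0 ≤ V := Finset.sum_nonneg fun _ _ => norm_nonneg _
  have hsq : √(P.lam * V) ≤ 2 * (P.H * √(P.L * V)) := by
    rw [Real.sqrt_le_left (by positivity), mul_pow, mul_pow, Real.sq_sqrt (by positivity)]
    have h1 : P.lam * V ≤ 2 * (P.L * P.H ^ 2) * V := by gcongr
    have h2 : 0 ≤ P.L * P.H ^ 2 * V := by positivity
    linarith
  have hY : P.R * (P.lam + √(P.lam * V)) ≤
      2 * (P.R * P.L * P.H ^ 2 + P.R * P.H * √(P.L * V)) := by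
    calc P.R * (P.lam + √(P.lam * V)) ≤
          P.R * (2 * (P.L * P.H ^ 2) + 2 * (P.H * √(P.L * V))) := by gcongr
      _ = _ := by ring
  calc _ ≤ _ := hreg
    _ ≤ 33330 * P.logs T ^ 2 * (2 * (P.R * P.L * P.H ^ 2 + P.R * P.H * √(P.L * V))) := by gcongr
    _ ≤ 66800 * (P.R * P.L * P.H ^ 3 * Real.log ((Finset.Icc a b).card)) +
        66800 * P.logs T ^ 2 * (P.R * P.L * P.H ^ 2 + P.R * P.H * √(P.L * V)) := by
      have h1 : 0 ≤ P.logs T ^ 2 * (P.R * P.L * P.H ^ 2 + P.R * P.H * √(P.L * V)) := by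
        positivity
      linarith
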